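/- Let $\Gamma$ be a two-sided noetherian ring. Modules are right modules unless stated otherwise; $\operatorname{mod}\Gamma$ is the category of finitely generated $\Gamma$-modules and $\operatorname{proj}\Gamma$ the category of finitely generated projective $\Gamma$-modules. An exact structure (in the sense of Quillen) on $\mathcal E=\operatorname{proj}\Gamma$ is called admissible if for every deflation $g\colon Y\to Z$ the functor $\operatorname{Coker}(\mathcal E(-,Y)\xrightarrow{g\circ-}\mathcal E(-,Z))$ on $\mathcal E$ has finite length. A simple $\Gamma$-module $S$ satisfies the 2-regular condition if $\operatorname{pd}S_\Gamma=2$, $\operatorname{Ext}^i_\Gamma(S,\Gamma)=0$ for $i=0,1$, and $\operatorname{Ext}^2_\Gamma(S,\Gamma)$ is a simple left $\Gamma$-module. For a set $\mathsf S$ of isomorphism classes of simple modules, $\operatorname{Filt}\mathsf S$ denotes the class of $\Gamma$-modules of finite length all of whose composition factors lie in $\mathsf S$. (a) There is a bijection between admissible exact structures $F$ on $\operatorname{proj}\Gamma$ and sets $\mathsf S$ of isomorphism classes of simple $\Gamma$-modules satisfying the 2-regular condition. It is given as follows. For given $\mathsf S$, a complex $X\xrightarrow{f}Y\xrightarrow{g}Z$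 in $\operatorname{proj}\Gamma$ is a conflation of the corresponding $F$ if and only if there is an exact sequence $0\to X\xrightarrow{f}Y\xrightarrow{g}Z\to M\to0$ in $\operatorname{mod}\Gamma$ with $M\in\operatorname{Filt}\mathsf S$. For given $F$, a simple $\Gamma$-module $S$ belongs to the corresponding $\mathsf S$ if and only if there is a deflation $g$ of $F$ with $\operatorname{Coker}(g)\cong S$ in $\operatorname{mod}\Gamma$. (b) Suppose that $\Gamma$ is in addition a noetherian $R$-algebra (that is, an $R$-algebra which is finitely generated as an $R$-module) over a commutative noetherian complete local ring $R$. Let $\mathcal J$ be the radical of the category $\operatorname{proj}\Gamma$ and put $k_P=\operatorname{End}_\Gamma(P)/\operatorname{rad}\operatorname{End}_\Gamma(P)$. Let $Q(\Gamma)$ be the valued quiver whose vertices are the isomorphism classes of indecomposable objects of $\operatorname{proj}\Gamma$, which has an arrow $P\to Q$ whenever $\mathcal J(P,Q)/\mathcal J^2(P,Q)\neq0$, valued by the dimensions of this quotient over $k_P$ and over $k_Q$, and which has a dotted arrow from $P$ to $\tau P$ whenever $P/\operatorname{rad}P$ satisfies the 2-regular condition; here $\tau P$ is the projective module such that $\operatorname{Hom}_\Gamma(\tau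 P,\Gamma)$ is a projective cover of the left module $\operatorname{Ext}^2_\Gamma(P/\operatorname{rad}P,\Gamma)$. Then there is a bijection between admissible exact structures $F$ on $\operatorname{proj}\Gamma$ and sets $\mathsf X$ of dotted arrows of $Q(\Gamma)$, under which a dotted arrow $P\dashrightarrow\tau P$ lies in $\mathsf X$ if and only if $P/\operatorname{rad}P$ lies in the set $\mathsf S$ corresponding to $F$ in (a). Moreover, the Auslander–Reiten quiver of the exact category $(\operatorname{proj}\Gamma,F)$ is the quiver $Q(\Gamma)$ with exactly the dotted arrows in $\mathsf X$. (The vertices of the Auslander–Reiten quiver are the isomorphism classes of indecomposable objects; it has an arrow $P\to Q$ if there is an irreducible morphism $P\to Q$, with valuation the dimensions of $\mathcal J(P,Q)/\mathcal J^2(P,Q)$ over $k_P$ and over $k_Q$, and a dotted arrow from $P$ to $Q$ if there is a conflation $Q\xrightarrow{f}E\xrightarrow{g}P$ with $f$ left almost split and $g$ right almost split.) -/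

import Mathlib

open CategoryTheory CategoryTheory.Limits

universe w v u v' u'

/-! ### Exact structures on preadditive categories -/

section ExactCategories

variable {C : Type u} [Category.{v} C] [Preadditive C]

/-- `X ⟶ Y ⟶ Z` is a kernel-cokernel pair: the first map is a kernel of the second and the second
map is a cokernel of the first. -/
def IsKernelCokernelPair (S : ShortComplex C) : Prop :=
  Nonempty (IsLimit (KernelFork.ofι S.f S.zero)) ∧
    Nonempty (IsColimit (CokernelCofork.ofπ S.g S.zero))

variable (C) in
/-- A Quillen exact structure: a class of kernel-cokernel pairs (the conflations), closed under
isomorphism, subject to the axioms (Ex0)-(Ex2) and their duals. -/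
@[ext]
structure ExactStructure where
  /-- The class of conflations. -/
  conflation : ShortComplex C → Prop
  isKernelCokernelPair : ∀ S, conflation S → IsKernelCokernelPair S
  of_iso : ∀ S T : ShortComplex C, (S ≅ T) → conflation S → conflation T
  /-- (Ex0): `0 ⟶ X = X` is a conflation. -/
  ex0 : ∀ (O X : C), IsZero O →
    conflation (ShortComplex.mk (0 : O ⟶ X) (𝟙 X) zero_comp)
  /-- (Ex0) dual: `X = X ⟶ 0` is a conflation. -/
  ex0_op : ∀ (O X : C), IsZero O →
    conflation (ShortComplex.mk (𝟙 X) (0 : X ⟶ O) comp_zero)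
  /-- (Ex1): deflations are closed under composition. -/
  ex1 : ∀ {X Y Z : C} (g : X ⟶ Y) (h : Y ⟶ Z),
    (∃ (K : C) (i : K ⟶ X) (w : i ≫ g = 0), conflation (ShortComplex.mk i g w)) →
    (∃ (K : C) (i : K ⟶ Y) (w : i ≫ h = 0), conflation (ShortComplex.mk i h w)) →
    ∃ (K : C) (i : K ⟶ X) (w : i ≫ g ≫ h = 0), conflation (ShortComplex.mk i (g ≫ h) w)
  /-- (Ex1) dual: inflations are closed under composition. -/
  ex1_op : ∀ {X Y Z : C} (g : X ⟶ Y) (h : Y ⟶ Z),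
    (∃ (K : C) (p : Y ⟶ K) (w : g ≫ p = 0), conflation (ShortComplex.mk g p w)) →
    (∃ (K : C) (p : Z ⟶ K) (w : h ≫ p = 0), conflation (ShortComplex.mk h p w)) →
    ∃ (K : C) (p : Z ⟶ K) (w : (g ≫ h) ≫ p = 0), conflation (ShortComplex.mk (g ≫ h) p w)
  /-- (Ex2): the pullback of a deflation along any morphism exists and is a deflation. -/
  ex2 : ∀ {Y Z W : C} (g : Y ⟶ Z) (h : W ⟶ Z),
    (∃ (K : C) (i : K ⟶ Y) (w : i ≫ g = 0), conflation (ShortComplex.mk i g w)) →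
    ∃ (E : C) (l : E ⟶ Y) (k : E ⟶ W), IsPullback l k g h ∧
      ∃ (K : C) (i : K ⟶ E) (w : i ≫ k = 0), conflation (ShortComplex.mk i k w)
  /-- (Ex2) dual: the pushout of an inflation along any morphism exists and is an inflation. -/
  ex2_op : ∀ {X Y W : C} (f : X ⟶ Y) (h : X ⟶ W),
    (∃ (K : C) (p : Y ⟶ K) (w : f ≫ p = 0), conflation (ShortComplex.mk f p w)) →
    ∃ (E : C) (l : Y ⟶ E) (k : W ⟶ E), IsPushout f h l k ∧
      ∃ (K : C) (p : E ⟶ K) (w : k ≫ p = 0), conflation (ShortComplex.mk k p w)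

namespace ExactStructure

variable (F : ExactStructure C)

/-- `g` is a deflation: it is the second map of a conflation. -/
def IsDeflation {Y Z : C} (g : Y ⟶ Z) : Prop :=
  ∃ (X : C) (f : X ⟶ Y) (w : f ≫ g = 0), F.conflation (ShortComplex.mk f g w)

/-- The exact structure is admissible: for each deflation `g : Y ⟶ Z`, the contravariant functor
`Coker (C(-, Y) ⟶ C(-, Z))` from `C` to abelian groups has finite length, that is, satisfies the
ascending and the descending chain condition on subobjects. (A subfunctor of an additive functor is
additive, so it is the same to take subobjects among all functors or among additive functors.) -/
def IsAdmissible : Prop :=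
  ∀ {Y Z : C} (g : Y ⟶ Z), F.IsDeflation g →
    IsNoetherianObject (cokernel (preadditiveYoneda.map g)) ∧
      IsArtinianObject (cokernel (preadditiveYoneda.map g))

end ExactStructure

/-! ### Almost split and irreducible morphisms, the radical -/

/-- `g : Y ⟶ Z` is right almost split: it is not a retraction, and every morphism to `Z` which is
not a retraction factors through `g`. -/
def IsRightAlmostSplit {Y Z : C} (g : Y ⟶ Z) : Prop :=
  ¬ IsSplitEpi g ∧ ∀ (W : C) (h : W ⟶ Z), ¬ IsSplitEpi h → ∃ t : W ⟶ Y, t ≫ g = h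

/-- `f : X ⟶ Y` is left almost split: it is not a section, and every morphism from `X` which is
not a section factors through `f`. -/
def IsLeftAlmostSplit {X Y : C} (f : X ⟶ Y) : Prop :=
  ¬ IsSplitMono f ∧ ∀ (W : C) (h : X ⟶ W), ¬ IsSplitMono h → ∃ t : Y ⟶ W, f ≫ t = h

/-- An Auslander-Reiten conflation: a conflation whose first map is left almost split and whose
second map is right almost split. -/
def ExactStructure.IsARConflation (F : ExactStructure C) (S : ShortComplex C) : Prop :=
  F.conflation S ∧ IsLeftAlmostSplit S.f ∧ IsRightAlmostSplit S.g

/-- `f` is irreducible: it is neither a section nor a retraction, and in each factorization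
`f = g ≫ h` either `g` is a section or `h` is a retraction. -/
def IsIrreducibleMorphism {X Y : C} (f : X ⟶ Y) : Prop :=
  ¬ IsSplitMono f ∧ ¬ IsSplitEpi f ∧
    ∀ (W : C) (g : X ⟶ W) (h : W ⟶ Y), g ≫ h = f → IsSplitMono g ∨ IsSplitEpi h

/-- The Jacobson radical `J(X, Y)` of the category: the morphisms `f : X ⟶ Y` such that
`1 - f ≫ g` is invertible for each `g : Y ⟶ X`. -/
def catRadical (X Y : C) : AddSubgroup (X ⟶ Y) where
  carrier := {f | ∀ g : Y ⟶ X, IsIso (𝟙 X - f ≫ g)}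
  zero_mem' := fun g => by
    rw [zero_comp, sub_zero]; infer_instance
  add_mem' := by
    intro a b ha hb g
    have h1 : IsIso (𝟙 X - a ≫ g) := ha g
    have h2 : IsIso (𝟙 X - b ≫ g ≫ inv (𝟙 X - a ≫ g)) := hb _
    have e : 𝟙 X - (a + b) ≫ g =
        (𝟙 X - b ≫ g ≫ inv (𝟙 X - a ≫ g)) ≫ (𝟙 X - a ≫ g) := by
      rw [Preadditive.sub_comp, Category.id_comp, Category.assoc, Category.assoc,
        IsIso.inv_hom_id, Category.comp_id, Preadditive.add_comp]
      abel
    rw [e]; infer_instance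
  neg_mem' := by
    intro a ha g
    have h := ha (-g)
    rwa [Preadditive.comp_neg, ← Preadditive.neg_comp] at h

/-- `J²(X, Y)`: the finite sums of composites of two radical morphisms. -/
def catRadicalSq (X Y : C) : AddSubgroup (X ⟶ Y) :=
  AddSubgroup.closure
    {h | ∃ (W : C) (f : X ⟶ W) (g : W ⟶ Y), f ∈ catRadical X W ∧ g ∈ catRadical W Y ∧ f ≫ g = h}

lemma comp_mem_catRadical {X Y Z : C} {f : X ⟶ Y} (hf : f ∈ catRadical X Y) (g : Y ⟶ Z) :
    f ≫ g ∈ catRadical X Z := fun t => by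
  have h : IsIso (𝟙 X - f ≫ (g ≫ t)) := hf (g ≫ t)
  rwa [← Category.assoc] at h

lemma isIso_one_sub_swap {X Y : C} (a : X ⟶ Y) (b : Y ⟶ X) (h : IsIso (𝟙 X - a ≫ b)) :
    IsIso (𝟙 Y - b ≫ a) := by
  have h1 : (𝟙 X - a ≫ b) ≫ inv (𝟙 X - a ≫ b) = 𝟙 X := IsIso.hom_inv_id _
  have h2 : inv (𝟙 X - a ≫ b) ≫ (𝟙 X - a ≫ b) = 𝟙 X := IsIso.inv_hom_id _
  generalize inv (𝟙 X - a ≫ b) = c at h1 h2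
  rw [Preadditive.sub_comp, Category.id_comp, Category.assoc] at h1
  rw [Preadditive.comp_sub, Category.comp_id] at h2
  have h3 : b ≫ c ≫ a - b ≫ a ≫ b ≫ c ≫ a = b ≫ a := by
    have := congrArg (fun t => b ≫ t ≫ a) h1
    simpa [Preadditive.comp_sub, Preadditive.sub_comp, Category.assoc] using this
  have h4 : b ≫ c ≫ a - b ≫ c ≫ a ≫ b ≫ a = b ≫ a := by
    have := congrArg (fun t => b ≫ t ≫ a) h2
    simpa [Preadditive.comp_sub, Preadditive.sub_comp, Category.assoc] using this
  refine ⟨𝟙 Y + b ≫ c ≫ a, ?_, ?_⟩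
  · rw [Preadditive.sub_comp, Category.id_comp, Preadditive.comp_add, Category.comp_id]
    simp only [Category.assoc]
    rw [← sub_eq_zero]
    calc _ = (b ≫ c ≫ a - b ≫ a ≫ b ≫ c ≫ a) - b ≫ a := by abel
      _ = 0 := by rw [h3, sub_self]
  · rw [Preadditive.comp_sub, Category.comp_id, Preadditive.add_comp, Category.id_comp]
    simp only [Category.assoc]
    rw [← sub_eq_zero]
    calc _ = (b ≫ c ≫ a - b ≫ c ≫ a ≫ b ≫ a) - b ≫ a := by abel
      _ = 0 := by rw [h4, sub_self]

lemma comp_mem_catRadical' {X Y Z : C} (f : X ⟶ Y) {g : Y ⟶ Z} (hg : g ∈ catRadical Y Z) :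
    f ≫ g ∈ catRadical X Z := fun t => by
  have h := isIso_one_sub_swap (g ≫ t) f
    (by have h : IsIso (𝟙 Y - g ≫ (t ≫ f)) := hg (t ≫ f)
        rwa [← Category.assoc] at h)
  rwa [← Category.assoc] at h

lemma catRadicalSq_comp {X Y Z : C} {f : X ⟶ Y} (hf : f ∈ catRadicalSq X Y) (g : Y ⟶ Z) :
    f ≫ g ∈ catRadicalSq X Z := by
  induction hf using AddSubgroup.closure_induction with
  | mem x hx =>
    obtain ⟨W, a, b, ha, hb, rfl⟩ := hx
    exact AddSubgroup.subset_closure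
      ⟨W, a, b ≫ g, ha, comp_mem_catRadical hb g, (Category.assoc _ _ _).symm⟩
  | zero => rw [zero_comp]; exact zero_mem _
  | add x y _ _ hx hy => rw [Preadditive.add_comp]; exact add_mem hx hy
  | neg x _ hx => rw [Preadditive.neg_comp]; exact neg_mem hx

lemma comp_catRadicalSq {X Y Z : C} (f : X ⟶ Y) {g : Y ⟶ Z} (hg : g ∈ catRadicalSq Y Z) :
    f ≫ g ∈ catRadicalSq X Z := by
  induction hg using AddSubgroup.closure_induction with
  | mem x hx =>
    obtain ⟨W, a, b, ha, hb, rfl⟩ := hx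
    exact AddSubgroup.subset_closure
      ⟨W, f ≫ a, b, comp_mem_catRadical' f ha, hb, Category.assoc _ _ _⟩
  | zero => rw [comp_zero]; exact zero_mem _
  | add x y _ _ hx hy => rw [Preadditive.comp_add]; exact add_mem hx hy
  | neg x _ hx => rw [Preadditive.comp_neg]; exact neg_mem hx

/-- `J(X, Y)` as a left `End Y`-submodule of `Hom(X, Y)`. -/
def catRadicalL (X Y : C) : Submodule (End Y) (X ⟶ Y) :=
  { catRadical X Y with smul_mem' := fun r _ hx => comp_mem_catRadical hx r }

/-- `J²(X, Y)` as a left `End Y`-submodule of `Hom(X, Y)`. -/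
def catRadicalSqL (X Y : C) : Submodule (End Y) (X ⟶ Y) :=
  { catRadicalSq X Y with smul_mem' := fun r _ hx => catRadicalSq_comp hx r }

/-- `J(X, Y)` as a right `End X`-submodule of `Hom(X, Y)`. -/
def catRadicalR (X Y : C) : Submodule (End X)ᵐᵒᵖ (X ⟶ Y) :=
  { catRadical X Y with smul_mem' := fun r _ hx => comp_mem_catRadical' r.unop hx }

/-- `J²(X, Y)` as a right `End X`-submodule of `Hom(X, Y)`. -/
def catRadicalSqR (X Y : C) : Submodule (End X)ᵐᵒᵖ (X ⟶ Y) :=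
  { catRadicalSq X Y with smul_mem' := fun r _ hx => comp_catRadicalSq r.unop hx }

/-- `J(X, Y) / J²(X, Y)`, with its left `End Y`-module structure. -/
abbrev RadQuotL (X Y : C) : Type v :=
  catRadicalL X Y ⧸ (catRadicalSqL X Y).submoduleOf (catRadicalL X Y)

/-- `J(X, Y) / J²(X, Y)`, with its right `End X`-module structure. -/
abbrev RadQuotR (X Y : C) : Type v :=
  catRadicalR X Y ⧸ (catRadicalSqR X Y).submoduleOf (catRadicalR X Y)

lemma isUnit_one_sub_of_mem_jacobson {A : Type w} [Ring A] {r : A} (hr : r ∈ Ring.jacobson A)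
    (a : A) : IsUnit (1 - a * r) := by
  have key : ∀ s ∈ Ring.jacobson A, ∃ b, b * (1 - s) = 1 := fun s hs => by
    rw [← Ideal.jacobson_bot, Ideal.mem_jacobson_iff] at hs
    obtain ⟨z, hz⟩ := hs (-1)
    refine ⟨z, ?_⟩
    have hz : z * -1 * s + z - 1 = 0 := by simpa using hz
    rw [mul_sub, mul_one, ← sub_eq_zero, ← hz]; noncomm_ring
  have hs : a * r ∈ Ring.jacobson A := Ideal.mul_mem_left _ a hr
  obtain ⟨b, hb⟩ := key _ hs
  have hb' : b = 1 - -(b * (a * r)) := by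
    rw [mul_sub, mul_one] at hb
    rw [sub_neg_eq_add, ← hb]; abel
  obtain ⟨c, hc⟩ := key _ (neg_mem (Ideal.mul_mem_left (Ring.jacobson A) b hs))
  rw [← hb'] at hc
  have hcb : c = 1 - a * r := by
    calc c = c * (b * (1 - a * r)) := by rw [hb, mul_one]
      _ = 1 - a * r := by rw [← mul_assoc, hc, one_mul]
  exact ⟨⟨1 - a * r, b, by rw [← hcb, hc], hb⟩, rfl⟩

lemma mem_catRadical_of_mem_jacobson {Y : C} {r : End Y} (hr : r ∈ Ring.jacobson (End Y)) :
    (r : Y ⟶ Y) ∈ catRadical Y Y := fun g => by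
  have h := isUnit_one_sub_of_mem_jacobson hr (g : End Y)
  rw [isUnit_iff_isIso] at h
  exact h

lemma mem_catRadical_of_mem_jacobson_op {X : C} {r : (End X)ᵐᵒᵖ}
    (hr : r ∈ Ring.jacobson (End X)ᵐᵒᵖ) : (r.unop : X ⟶ X) ∈ catRadical X X := fun g => by
  have h := isUnit_one_sub_of_mem_jacobson hr (MulOpposite.op (g : End X))
  have h := h.unop
  rw [isUnit_iff_isIso] at h
  exact isIso_one_sub_swap (g : X ⟶ X) (r.unop : X ⟶ X) h

lemma radQuotL_torsion (X Y : C) :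
    Module.IsTorsionBySet (End Y) (RadQuotL X Y) (Ring.jacobson (End Y)) := by
  rintro x ⟨r, hr⟩
  obtain ⟨⟨f, hf⟩, rfl⟩ := Submodule.Quotient.mk_surjective _ x
  refine (Submodule.Quotient.mk_eq_zero _).2 ?_
  exact AddSubgroup.subset_closure ⟨Y, f, r, hf, mem_catRadical_of_mem_jacobson hr, rfl⟩

lemma radQuotR_torsion (X Y : C) :
    Module.IsTorsionBySet (End X)ᵐᵒᵖ (RadQuotR X Y) (Ring.jacobson (End X)ᵐᵒᵖ) := by
  rintro x ⟨r, hr⟩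
  obtain ⟨⟨f, hf⟩, rfl⟩ := Submodule.Quotient.mk_surjective _ x
  refine (Submodule.Quotient.mk_eq_zero _).2 ?_
  exact AddSubgroup.subset_closure ⟨X, r.unop, f, mem_catRadical_of_mem_jacobson_op hr, hf, rfl⟩

/-- The dimension of `J(X, Y) / J²(X, Y)` over `k_X = End X / rad (End X)` (a right `k_X`-module,
that is, a module over the opposite ring). -/
noncomputable def valuationSource (X Y : C) : Cardinal.{v} :=
  letI : Module ((End X)ᵐᵒᵖ ⧸ Ring.jacobson (End X)ᵐᵒᵖ) (RadQuotR X Y) :=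
    (radQuotR_torsion X Y).module
  Module.rank ((End X)ᵐᵒᵖ ⧸ Ring.jacobson (End X)ᵐᵒᵖ) (RadQuotR X Y)

/-- The dimension of `J(X, Y) / J²(X, Y)` over `k_Y = End Y / rad (End Y)`. -/
noncomputable def valuationTarget (X Y : C) : Cardinal.{v} :=
  letI : Module (End Y ⧸ Ring.jacobson (End Y)) (RadQuotL X Y) := (radQuotL_torsion X Y).module
  Module.rank (End Y ⧸ Ring.jacobson (End Y)) (RadQuotL X Y)

end ExactCategories

/-! ### Valued quivers with dotted arrows, Auslander-Reiten quivers -/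

/-- A valued quiver with an additional set of dotted arrows, on the vertex set `V`. The valuation
is recorded for all pairs of vertices. -/
@[ext]
structure DottedValuedQuiver (V : Type w) where
  /-- There is an ordinary arrow. -/
  arrow : V → V → Prop
  /-- The valuation `(d, d')` of an arrow. -/
  valuation : V → V → Cardinal.{u} × Cardinal.{u}
  /-- There is a dotted arrow. -/
  dotted : V → V → Prop

section ARQuiver

variable (C : Type u) [Category.{v} C] [Preadditive C] [HasBinaryBiproducts C]

/-- `ind C`: the isomorphism classes of indecomposable objects. -/
def IndClass : Type u :=
  {c : Quotient (isIsomorphicSetoid C) // ∃ X : C, Indecomposable X ∧ Quotient.mk _ X = c}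

variable {C}

/-- A representative of an isomorphism class. -/
noncomputable def IndClass.rep (c : IndClass C) : C := Quotient.out c.1

/-- The Auslander-Reiten quiver of an exact category: the vertices are the isomorphism classes of
indecomposable objects, there is an arrow `X ⟶ Y` if there is an irreducible morphism from `X` to
`Y`, its valuation consists of the dimensions of `J(X, Y) / J²(X, Y)` over `k_X` and over `k_Y`, and
there is a dotted arrow from `Z` to `X` if there is an Auslander-Reiten conflation
`X ⟶ E ⟶ Z`. -/
noncomputable def ExactStructure.arQuiver (F : ExactStructure C) :
    DottedValuedQuiver.{u, v} (IndClass C) where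
  arrow X Y := ∃ f : X.rep ⟶ Y.rep, IsIrreducibleMorphism f
  valuation X Y := (valuationSource X.rep Y.rep, valuationTarget X.rep Y.rep)
  dotted Z X := ∃ (E : C) (f : X.rep ⟶ E) (g : E ⟶ Z.rep) (w : f ≫ g = 0),
    F.IsARConflation (ShortComplex.mk f g w)

end ARQuiver

/-! ### The category of finitely generated projective right modules -/

section Modules

variable (Γ : Type u) [Ring Γ]

/-- Right `Γ`-modules. -/
abbrev RightMod := ModuleCat.{u} Γᵐᵒᵖ

/-- The finitely generated projective right `Γ`-modules. -/
def isFGProj : ObjectProperty (RightMod Γ) :=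
  fun M => Module.Finite Γᵐᵒᵖ M ∧ Module.Projective Γᵐᵒᵖ M

/-- The category `proj Γ` of finitely generated projective right `Γ`-modules. -/
abbrev ProjCat := (isFGProj Γ).FullSubcategory

instance : (isFGProj Γ).IsClosedUnderIsomorphisms where
  of_iso e h := by
    obtain ⟨h1, h2⟩ := h
    exact ⟨Module.Finite.equiv e.toLinearEquiv, Module.Projective.of_equiv e.toLinearEquiv⟩

instance : (isFGProj Γ).IsClosedUnderBinaryProducts where
  limitsOfShape_le := by
    rintro M ⟨h⟩
    have h1 := h.prop_diag_obj ⟨WalkingPair.left⟩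
    have h2 := h.prop_diag_obj ⟨WalkingPair.right⟩
    obtain ⟨h1, h1'⟩ := h1
    obtain ⟨h2, h2'⟩ := h2
    have e := h.isLimit.conePointUniqueUpToIso
      ((IsLimit.postcomposeHomEquiv (diagramIsoPair h.diag).symm _).2
        (ModuleCat.binaryProductLimitCone (h.diag.obj ⟨WalkingPair.left⟩)
          (h.diag.obj ⟨WalkingPair.right⟩)).isLimit)
    refine (isFGProj Γ).prop_of_iso e.symm ?_
    exact ⟨inferInstanceAs (Module.Finite Γᵐᵒᵖ
        (h.diag.obj ⟨WalkingPair.left⟩ × h.diag.obj ⟨WalkingPair.right⟩ : Type u)),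
      inferInstanceAs (Module.Projective Γᵐᵒᵖ
        (h.diag.obj ⟨WalkingPair.left⟩ × h.diag.obj ⟨WalkingPair.right⟩ : Type u))⟩

instance : HasBinaryBiproducts (ProjCat Γ) := HasBinaryBiproducts.of_hasBinaryProducts

/-- The regular right module `Γ`. -/
abbrev regularRight : RightMod Γ := ModuleCat.of Γᵐᵒᵖ Γ

/-- The abelian group `Ext^n(M, Γ)` for a right `Γ`-module `M`. It is a left `Γ`-module, see
below. -/
def ExtToRing (M : RightMod Γ) (n : ℕ) : Type u := Abelian.Ext.{u} M (regularRight Γ) n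

noncomputable instance (M : RightMod Γ) (n : ℕ) : AddCommGroup (ExtToRing Γ M n) :=
  inferInstanceAs (AddCommGroup (Abelian.Ext.{u} M (regularRight Γ) n))

variable {Γ} in
/-- Left multiplication by `a`, an endomorphism of the right module `Γ`. -/
def leftMulHom (a : Γ) : regularRight Γ ⟶ regularRight Γ :=
  ModuleCat.ofHom (DistribSMul.toLinearMap Γᵐᵒᵖ Γ a)

variable {Γ} in
/-- The action of `a` on `Ext^n(M, Γ)`: functoriality of `Ext^n(M, -)` applied to left multiplication
by `a`. -/
noncomputable def extAct (M : RightMod Γ) (n : ℕ) (a : Γ)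
    (x : Abelian.Ext.{u} M (regularRight Γ) n) : Abelian.Ext.{u} M (regularRight Γ) n :=
  x.comp (Abelian.Ext.mk₀ (leftMulHom a)) (add_zero n)

section

variable {Γ} (M : RightMod Γ) (n : ℕ)

lemma extAct_one (x : Abelian.Ext.{u} M (regularRight Γ) n) : extAct M n 1 x = x := by
  have h : leftMulHom (1 : Γ) = 𝟙 (regularRight Γ) := by
    ext; exact one_smul Γ (1 : Γ)
  rw [extAct, h, Abelian.Ext.comp_mk₀_id]

lemma extAct_mul (a b : Γ) (x : Abelian.Ext.{u} M (regularRight Γ) n) :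
    extAct M n (a * b) x = extAct M n a (extAct M n b x) := by
  have h : leftMulHom (a * b) = leftMulHom b ≫ leftMulHom a := by
    ext; exact mul_smul a b (1 : Γ)
  rw [extAct, extAct, extAct, h, ← Abelian.Ext.mk₀_comp_mk₀]
  exact (Abelian.Ext.comp_assoc_of_third_deg_zero _ _ _ _).symm

lemma extAct_zero_right (a : Γ) : extAct M n a 0 = 0 := by
  rw [extAct, Abelian.Ext.zero_comp]

lemma extAct_add_right (a : Γ) (x y : Abelian.Ext.{u} M (regularRight Γ) n) :
    extAct M n a (x + y) = extAct M n a x + extAct M n a y := by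
  rw [extAct, Abelian.Ext.add_comp]; rfl

lemma extAct_add_left (a b : Γ) (x : Abelian.Ext.{u} M (regularRight Γ) n) :
    extAct M n (a + b) x = extAct M n a x + extAct M n b x := by
  have h : leftMulHom (a + b) = leftMulHom a + leftMulHom b := by
    ext; exact add_smul a b (1 : Γ)
  rw [extAct, h, Abelian.Ext.mk₀_add, Abelian.Ext.comp_add]; rfl

lemma extAct_zero_left (x : Abelian.Ext.{u} M (regularRight Γ) n) : extAct M n 0 x = 0 := by
  have h : leftMulHom (0 : Γ) = 0 := by
    ext; exact zero_smul Γ (1 : Γ)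
  rw [extAct, h, Abelian.Ext.mk₀_zero, Abelian.Ext.comp_zero]

end

/-- The left `Γ`-module structure on `Ext^n(M, Γ)`. -/
noncomputable instance (M : RightMod Γ) (n : ℕ) : Module Γ (ExtToRing Γ M n) where
  smul a x := extAct M n a x
  one_smul x := extAct_one M n x
  mul_smul a b x := extAct_mul M n a b x
  smul_zero a := extAct_zero_right M n a
  smul_add a x y := extAct_add_right M n a x y
  add_smul a b x := extAct_add_left M n a b x
  zero_smul x := extAct_zero_left M n x

variable {Γ}

/-- `S` is a simple right `Γ`-module satisfying the 2-regular condition. -/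
structure IsTwoRegularSimple (S : RightMod Γ) : Prop where
  isSimple : IsSimpleModule Γᵐᵒᵖ S
  projDim_eq : projectiveDimension S = 2
  ext_zero : Subsingleton (ExtToRing Γ S 0)
  ext_one : Subsingleton (ExtToRing Γ S 1)
  ext_two : IsSimpleModule Γ (ExtToRing Γ S 2)

/-- The isomorphism class of a right `Γ`-module. -/
abbrev isoClass (M : RightMod Γ) : Quotient (isIsomorphicSetoid (RightMod Γ)) :=
  Quotient.mk _ M

variable (Γ) in
/-- The sets of isomorphism classes of simple right `Γ`-modules satisfying the 2-regular
condition. -/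
def TwoRegularSet : Type (u + 1) :=
  {T : Set (Quotient (isIsomorphicSetoid (RightMod Γ))) //
    ∀ c ∈ T, ∃ S : RightMod Γ, IsTwoRegularSimple S ∧ isoClass S = c}

/-- `Filt T`: the right modules of finite length all of whose composition factors have their
isomorphism class in `T`. In a module of finite length, the composition factors are the
subquotients `N' / N` with `N < N'` and nothing strictly in between. -/
def IsFilt (T : Set (Quotient (isIsomorphicSetoid (RightMod Γ)))) (M : RightMod Γ) : Prop :=
  IsFiniteLength Γᵐᵒᵖ M ∧ ∀ N N' : Submodule Γᵐᵒᵖ M, N ⋖ N' →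
    isoClass (ModuleCat.of Γᵐᵒᵖ (N' ⧸ N.submoduleOf N')) ∈ T

/-- The sequence of right modules `0 ⟶ X ⟶ Y ⟶ Z ⟶ M ⟶ 0` is exact, where `X ⟶ Y ⟶ Z` is the
given complex in `proj Γ` and `p : Z ⟶ M`. -/
def IsResolutionOf (S : ShortComplex (ProjCat Γ)) (M : RightMod Γ)
    (p : S.X₃.obj →ₗ[Γᵐᵒᵖ] M) : Prop :=
  Function.Injective S.f.hom.hom ∧ Function.Exact S.f.hom.hom S.g.hom.hom ∧
    Function.Exact S.g.hom.hom p ∧ Function.Surjective p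

variable (Γ) in
/-- Admissible exact structures on `proj Γ`. -/
def AdmissibleExactStructure : Type (u + 1) :=
  {F : ExactStructure (ProjCat Γ) // F.IsAdmissible}

/-! ### The quiver of `Γ` -/

/-- `π : P → M` is a projective cover: `P` is projective, `π` is surjective, and the kernel of `π` is
a superfluous submodule. -/
def IsProjectiveCover {A : Type w} [Ring A] {P : Type u} [AddCommGroup P] [Module A P]
    {M : Type u'} [AddCommGroup M] [Module A M] (π : P →ₗ[A] M) : Prop :=
  Module.Projective A P ∧ Function.Surjective π ∧
    ∀ N : Submodule A P, N ⊔ LinearMap.ker π = ⊤ → N = ⊤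

/-- The top `P / rad P` of a right module, where `rad P` is the intersection of the maximal
submodules. -/
abbrev topModule (P : RightMod Γ) : RightMod Γ :=
  ModuleCat.of Γᵐᵒᵖ (P ⧸ Module.jacobson Γᵐᵒᵖ P)

/-- `Q = τ P`: the module `P / rad P` satisfies the 2-regular condition, and the left module
`Hom(Q, Γ)` is a projective cover of the simple left module `Ext²(P / rad P, Γ)`. -/
def IsTranslate (P Q : ProjCat Γ) : Prop :=
  IsTwoRegularSimple (topModule P.obj) ∧
    ∃ π : (Q.obj →ₗ[Γᵐᵒᵖ] Γ) →ₗ[Γ] ExtToRing Γ (topModule P.obj) 2, IsProjectiveCover π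

variable (Γ)

/-- The valued translation quiver `Q(Γ)`: the vertices are the isomorphism classes of indecomposable
objects of `proj Γ`, there is an arrow from `P` to `Q` if `J(P, Q) / J²(P, Q) ≠ 0`, valued by the
dimensions of this quotient over `k_P` and over `k_Q`, and there is a dotted arrow from `P` to
`τ P`. -/
noncomputable def quiverOf : DottedValuedQuiver.{u + 1, u} (IndClass (ProjCat Γ)) where
  arrow P Q := ¬ catRadical P.rep Q.rep ≤ catRadicalSq P.rep Q.rep
  valuation P Q := (valuationSource P.rep Q.rep, valuationTarget P.rep Q.rep)
  dotted P Q := IsTranslate P.rep Q.rep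

/-- The dotted arrows of `Q(Γ)`. -/
def DottedArrow : Type (u + 1) :=
  {a : IndClass (ProjCat Γ) × IndClass (ProjCat Γ) // (quiverOf Γ).dotted a.1 a.2}

/-- The valued quiver `Q(Γ)` in which only the dotted arrows from the set `X` are kept. -/
noncomputable def quiverWith (X : Set (DottedArrow Γ)) :
    DottedValuedQuiver.{u + 1, u} (IndClass (ProjCat Γ)) :=
  { quiverOf Γ with dotted := fun P Q => ∃ a ∈ X, a.1 = (P, Q) }

end Modules

/-! An exact structure on `proj Γ` is governed by the cokernels, taken in `mod Γ`, of its
deflations. A left exact complex X → Y → Z of projectives is a conflation as soon as its cokernel is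
the cokernel of some deflation (`conflation_iff_isCokerOfDeflation`): pull that deflation back along
a lift to Z and compare kernels by a pushout. Pullbacks, composites and sums of deflations show that
these cokernels are closed under submodules, quotients and extensions. Admissibility says that they
have finite length (`cokerFunctor_finiteLength_iff`), so the class is determined by the simple
modules in it.

Such a simple module S is 2-regular. A conflation is a kernel-cokernel pair, and in `proj Γ` this
means that 0 → X → Y → Z and the dual sequence 0 → Z* → Y* → X* are exact
(`isKernelCokernelPair_iff`). The first gives a projective resolution of S of length two; the second
says that Ext⁰ and Ext¹ into Γ vanish, while Ext² is X*/im f*. Pushing out along an arbitrary linear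
form on X shows that this quotient is simple (`isSimpleModule_dual_quotient`).

Conversely, let T be a set of 2-regular simple modules. Long exact sequences extend the Ext
conditions from T to all modules filtered by T, and Ext²(-, Γ) exchanges these modules with the left
modules filtered by the classes Ext²(S, Γ), twice Ext² being the identity
(`isExtRegular_extBi_two`). Hence deflations are the maps whose cokernel is filtered by T, and
inflations are the maps whose dual has a cokernel filtered by the dual classes
(`exists_filtConflation_iff_dual`). The axioms on deflations and their duals become closure
properties of filtered modules on the two sides. The Ext calculus is set up for a bimodule D so that
it serves both sides.

Over a complete local base, idempotents lift, so indecomposable projectives have local endomorphism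
rings and simple modules are their tops. Thus 2-regular simple modules are the same as dotted
arrows. A map to P is right almost split exactly when its image is rad P, so an Auslander-Reiten
conflation ending in P exists only if the top of P is the cokernel of a deflation. If it is, pushing
out along the map X → τP dual to a lift of the projective cover (τP)* → Ext² produces one that
starts in τP (`exists_isARConflation`). -/

set_option linter.unusedSectionVars false

/-! ### Modules filtered by a set of simple modules -/

section Filtered

variable {A : Type u} [Ring A]

/-- Isomorphism classes of left `A`-modules. -/
abbrev ModClass (A : Type u) [Ring A] : Type (u + 1) :=
  Quotient (isIsomorphicSetoid (ModuleCat.{u} A))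

/-- The isomorphism class of an unbundled module. -/
def modClass (A : Type u) [Ring A] (M : Type u) [AddCommGroup M] [Module A M] : ModClass A :=
  Quotient.mk _ (ModuleCat.of A M)

lemma modClass_eq_iff {M N : Type u} [AddCommGroup M] [Module A M] [AddCommGroup N] [Module A N] :
    modClass A M = modClass A N ↔ Nonempty (M ≃ₗ[A] N) := by
  rw [modClass, modClass, Quotient.eq]
  exact ⟨fun ⟨e⟩ => ⟨e.toLinearEquiv⟩, fun ⟨e⟩ => ⟨e.toModuleIso⟩⟩

lemma modClass_congr {M N : Type u} [AddCommGroup M] [Module A M] [AddCommGroup N] [Module A N]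
    (e : M ≃ₗ[A] N) : modClass A M = modClass A N :=
  modClass_eq_iff.2 ⟨e⟩

/-- Modules with a finite filtration whose subquotients have their class in `T`. -/
inductive FiltBy (T : Set (ModClass A)) : ∀ (M : Type u) [AddCommGroup M] [Module A M], Prop
  | of_subsingleton {M : Type u} [AddCommGroup M] [Module A M] [Subsingleton M] : FiltBy T M
  | of_quotient {M : Type u} [AddCommGroup M] [Module A M] (N : Submodule A M) :
      FiltBy T N → modClass A (M ⧸ N) ∈ T → FiltBy T M

/-- All classes in `T` are classes of simple modules. -/
def SimpleClasses (T : Set (ModClass A)) : Prop :=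
  ∀ (M : Type u) [AddCommGroup M] [Module A M], modClass A M ∈ T → IsSimpleModule A M

variable {T : Set (ModClass A)}

namespace FiltBy

variable {M N Q : Type u} [AddCommGroup M] [Module A M] [AddCommGroup N] [Module A N]
  [AddCommGroup Q] [Module A Q]

lemma equiv (e : M ≃ₗ[A] N) (h : FiltBy T M) : FiltBy T N := by
  induction h generalizing N with
  | of_subsingleton =>
    have := e.symm.toEquiv.subsingleton
    exact .of_subsingleton
  | @of_quotient M _ _ K _ hK ih =>
    refine .of_quotient (K.map (e : M →ₗ[A] N)) (ih (e.submoduleMap K)) ?_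
    rwa [modClass_congr (Submodule.Quotient.equiv K _ e rfl).symm]

/-- The kernel of the restriction of `q` to the preimage of a submodule. -/
noncomputable def kerRestrictComap (q : M →ₗ[A] Q) (N : Submodule A Q) :
    LinearMap.ker q ≃ₗ[A] LinearMap.ker (q.restrict (p := N.comap q) (q := N) fun _ h => h) :=
  { toFun x := ⟨⟨x.1, by
        have hx : q x.1 = 0 := x.2
        change q x.1 ∈ N
        rw [hx]; exact N.zero_mem⟩, Subtype.ext (x.2 : q x.1 = 0)⟩
    invFun x := ⟨x.1.1, congrArg Subtype.val (x.2 : _ = _)⟩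
    map_add' _ _ := rfl
    map_smul' _ _ := rfl
    left_inv _ := rfl
    right_inv _ := rfl }

/-- Closure under extensions: the filtration of Q is pulled back along q and sits on top of that of
the kernel. -/
lemma of_surjective_of_ker (hQ : FiltBy T Q) (q : M →ₗ[A] Q) (hq : Function.Surjective q)
    (hk : FiltBy T (LinearMap.ker q)) : FiltBy T M := by
  induction hQ generalizing M with
  | of_subsingleton =>
    have : LinearMap.ker q = ⊤ := by
      rw [eq_top_iff]; intro x _; exact Subsingleton.elim _ _
    rw [this] at hk
    exact hk.equiv Submodule.topEquiv
  | @of_quotient Q _ _ N _ hN ih =>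
    refine .of_quotient (N.comap q) (ih (q.restrict (p := N.comap q) (q := N) fun _ h => h)
      ?_ (hk.equiv (kerRestrictComap q N))) ?_
    · rintro ⟨y, hy⟩
      obtain ⟨x, rfl⟩ := hq y
      exact ⟨⟨x, hy⟩, rfl⟩
    · have e : (M ⧸ N.comap q) ≃ₗ[A] Q ⧸ N :=
        (Submodule.quotEquivOfEq _ _ (by rw [LinearMap.ker_comp, Submodule.ker_mkQ])).trans
          ((N.mkQ ∘ₗ q).quotKerEquivOfSurjective (N.mkQ_surjective.comp hq))
      rwa [modClass_congr e]

/-- Intersect the filtration with N. Each new factor embeds in a simple module, so it is zero and is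
skipped, or it is the old factor. -/
lemma of_injective (hT : SimpleClasses T) (h : FiltBy T M) (f : N →ₗ[A] M)
    (hf : Function.Injective f) : FiltBy T N := by
  induction h generalizing N with
  | of_subsingleton =>
    have := hf.subsingleton
    exact .of_subsingleton
  | @of_quotient M _ _ K _ hK ih =>
    have hN : FiltBy T (K.comap f) := ih (f.restrict (p := K.comap f) (q := K) fun _ h => h)
      fun x y h => Subtype.ext (hf (congrArg Subtype.val h))
    have := hT _ hK
    let g : (N ⧸ K.comap f) →ₗ[A] M ⧸ K := (K.comap f).mapQ K f le_rfl
    have hg : Function.Injective g := by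
      rw [injective_iff_map_eq_zero]
      intro x hx
      obtain ⟨x, rfl⟩ := Submodule.Quotient.mk_surjective _ x
      exact (Submodule.Quotient.mk_eq_zero _).2
        ((Submodule.Quotient.mk_eq_zero K).1 hx : f x ∈ K)
    rcases eq_bot_or_eq_top (LinearMap.range g) with h | h
    · refine hN.equiv ((LinearEquiv.ofEq _ _ ?_).trans Submodule.topEquiv)
      rw [eq_top_iff]
      intro x _
      have : g (Submodule.Quotient.mk x) ∈ LinearMap.range g := ⟨_, rfl⟩
      rw [h, Submodule.mem_bot] at this
      exact (Submodule.Quotient.mk_eq_zero K).1 this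
    · refine .of_quotient _ hN ?_
      rwa [modClass_congr (LinearEquiv.ofBijective g ⟨hg, LinearMap.range_eq_top.1 h⟩)]

/-- Take the image of the filtration. Each new factor is a quotient of a simple module, so it is the
old factor or zero. -/
lemma of_surjective (hT : SimpleClasses T) (h : FiltBy T M) (f : M →ₗ[A] N)
    (hf : Function.Surjective f) : FiltBy T N := by
  induction h generalizing N with
  | of_subsingleton =>
    have := hf.subsingleton
    exact .of_subsingleton
  | @of_quotient M _ _ K _ hK ih =>
    have hN : FiltBy T (K.map f) := ih (f.submoduleMap K) (f.submoduleMap_surjective K)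
    have := hT _ hK
    let g : (M ⧸ K) →ₗ[A] N ⧸ K.map f := K.mapQ (K.map f) f (Submodule.le_comap_map f K)
    have hg : Function.Surjective g := by
      intro y
      obtain ⟨y, rfl⟩ := Submodule.Quotient.mk_surjective _ y
      obtain ⟨x, rfl⟩ := hf y
      exact ⟨Submodule.Quotient.mk x, rfl⟩
    rcases eq_bot_or_eq_top (LinearMap.ker g) with h | h
    · refine .of_quotient _ hN ?_
      rwa [← modClass_congr (LinearEquiv.ofBijective g ⟨LinearMap.ker_eq_bot.1 h, hg⟩)]
    · refine hN.equiv ((LinearEquiv.ofEq _ _ ?_).trans Submodule.topEquiv)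
      rw [eq_top_iff]
      intro y _
      obtain ⟨z, hz⟩ := hg (Submodule.Quotient.mk y)
      rw [LinearMap.ker_eq_top.1 h, LinearMap.zero_apply] at hz
      exact (Submodule.Quotient.mk_eq_zero _).1 hz.symm

/-- The top factor of the filtration is a nonzero quotient of M, hence M itself. This recovers T
from the modules that it filters. -/
lemma mem_of_isSimpleModule (hT : SimpleClasses T) [IsSimpleModule A M] (h : FiltBy T M) :
    modClass A M ∈ T := by
  have := IsSimpleModule.nontrivial A M
  cases h with
  | of_subsingleton => exact (not_subsingleton M ‹_›).elim
  | of_quotient K _ hK =>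
    have h := hT _ hK
    rcases eq_bot_or_eq_top K with rfl | rfl
    · rwa [modClass_congr (Submodule.quotEquivOfEqBot (⊥ : Submodule A M) rfl)] at hK
    · have := IsSimpleModule.nontrivial A (M ⧸ (⊤ : Submodule A M))
      exact (not_subsingleton (M ⧸ (⊤ : Submodule A M)) inferInstance).elim

lemma of_mem (h : modClass A M ∈ T) : FiltBy T M :=
  .of_quotient ⊥ .of_subsingleton
    (by rwa [modClass_congr (Submodule.quotEquivOfEqBot (⊥ : Submodule A M) rfl)])

lemma isFiniteLength (hT : SimpleClasses T) (h : FiltBy T M) : IsFiniteLength A M := by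
  induction h with
  | of_subsingleton => exact .of_subsingleton
  | of_quotient N _ hN ih =>
    have := hT _ hN
    exact .of_simple_quotient ih

/-- The quotient of a module filtered by `T` by a submodule, restricted to a bigger one. -/
lemma submoduleOf (hT : SimpleClasses T) (h : FiltBy T M) (N N' : Submodule A M) :
    FiltBy T (N' ⧸ N.submoduleOf N') :=
  (h.of_injective hT N'.subtype N'.injective_subtype).of_surjective hT _
    (Submodule.mkQ_surjective _)

end FiltBy

lemma isSimpleModule_quotient_of_covBy {M : Type u} [AddCommGroup M] [Module A M]
    {N N' : Submodule A M} (h : N ⋖ N') : IsSimpleModule A (N' ⧸ N.submoduleOf N') :=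
  (covBy_iff_quot_is_simple h.le).1 h

/-- Induction on the length: a covering pair inside a submodule K stays covering in M with the same
subquotient, and K ⋖ ⊤ supplies the last factor. -/
lemma filtBy_of_covBy {M : Type u} [AddCommGroup M] [Module A M] (h : IsFiniteLength A M)
    (hM : ∀ N N' : Submodule A M, N ⋖ N' → modClass A (N' ⧸ N.submoduleOf N') ∈ T) :
    FiltBy T M := by
  induction h with
  | of_subsingleton => exact .of_subsingleton
  | @of_simple_quotient M _ _ K hK _ ih =>
    refine .of_quotient K (ih fun N N' h => ?_) ?_
    · have h' : N.map K.subtype ⋖ N'.map K.subtype := by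
        refine ⟨(Submodule.map_strictMono_of_injective K.injective_subtype) h.lt, fun P h1 h2 => ?_⟩
        have hP : (P.comap K.subtype).map K.subtype = P :=
          Submodule.map_comap_eq_self ((h2.le.trans (Submodule.map_subtype_le _ _)).trans
            (Submodule.range_subtype K).ge)
        rw [← hP] at h1 h2
        have hm := Submodule.map_strictMono_of_injective K.injective_subtype
        have hs : ∀ {U V : Submodule A K}, U.map K.subtype < V.map K.subtype → U < V := by
          intro U V hUV
          refine lt_of_le_of_ne ((Submodule.map_le_map_iff_of_injective K.injective_subtype _ _).1
            hUV.le) fun e => hUV.ne (by rw [e])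
        exact h.2 (hs h1) (hs h2)
      let e := Submodule.equivMapOfInjective K.subtype K.injective_subtype N'
      rw [modClass_congr (Submodule.Quotient.equiv (N.submoduleOf N')
        ((N.map K.subtype).submoduleOf (N'.map K.subtype)) e ?_)]
      · exact hM _ _ h'
      · ext ⟨x, hx⟩
        rw [Submodule.mem_map]
        change _ ↔ x ∈ N.map K.subtype
        rw [Submodule.mem_map]
        constructor
        · rintro ⟨y, hy, hyx⟩
          exact ⟨y.1, hy, congrArg Subtype.val hyx⟩
        · rintro ⟨y, hy, hyx⟩
          exact ⟨⟨y, h.le hy⟩, hy, Subtype.ext hyx⟩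
    · have hc : K ⋖ ⊤ := (covBy_iff_quot_is_simple le_top).2
        (IsSimpleModule.congr (Submodule.Quotient.equiv _ K Submodule.topEquiv (by
          ext x; simp)))
      rw [← modClass_congr (Submodule.Quotient.equiv (K.submoduleOf ⊤) K Submodule.topEquiv (by
          ext x; simp; rfl))]
      exact hM K ⊤ hc

lemma isFilt_iff {Γ : Type u} [Ring Γ] {T : Set (ModClass Γᵐᵒᵖ)} (hT : SimpleClasses T)
    (M : RightMod Γ) : IsFilt T M ↔ FiltBy T M := by
  refine ⟨fun h => filtBy_of_covBy h.1 h.2, fun h => ⟨h.isFiniteLength hT, fun N N' hN => ?_⟩⟩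
  have := isSimpleModule_quotient_of_covBy hN
  exact (h.submoduleOf hT N N').mem_of_isSimpleModule hT

end Filtered

/-! ### Ext groups into a bimodule -/

section ExtBimodule

open Abelian

variable (A B : Type u) [Ring A] [Ring B] (D : Type u) [AddCommGroup D] [Module A D] [Module B D]
  [SMulCommClass A B D] [SMulCommClass B A D]

/-- `Ext^n_A(M, D)` for an `A`-module `M` and an `A`-`B`-bimodule `D`, seen as a `B`-module. -/
@[nolint unusedArguments]
def ExtBi (_B : Type u) (M : Type u) [AddCommGroup M] [Module A M] (n : ℕ) : Type u :=
  Ext.{u} (ModuleCat.of A M) (ModuleCat.of A D) n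

variable {M M' M'' N : Type u} [AddCommGroup M] [Module A M] [AddCommGroup M'] [Module A M']
  [AddCommGroup M''] [Module A M''] [AddCommGroup N] [Module A N]

noncomputable instance (n : ℕ) : AddCommGroup (ExtBi A D B M n) :=
  inferInstanceAs (AddCommGroup (Ext.{u} (ModuleCat.of A M) (ModuleCat.of A D) n))

variable {B} in
/-- The endomorphism of the `A`-module `D` given by the action of `b`. -/
def actHom (b : B) : ModuleCat.of A D ⟶ ModuleCat.of A D :=
  ModuleCat.ofHom (DistribSMul.toLinearMap A D b)

lemma actHom_one : actHom A D (1 : B) = 𝟙 _ := by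
  ext x; exact one_smul B (x : D)

variable {B}

lemma actHom_mul (a b : B) : actHom A D (a * b) = actHom A D b ≫ actHom A D a := by
  ext x; exact mul_smul a b (x : D)

lemma actHom_add (a b : B) : actHom A D (a + b) = actHom A D a + actHom A D b := by
  ext x; exact add_smul a b (x : D)

variable (B)

lemma actHom_zero : actHom A D (0 : B) = 0 := by
  ext x; exact zero_smul B (x : D)

noncomputable instance (n : ℕ) : Module B (ExtBi A D B M n) where
  smul b x := Ext.comp (show Ext.{u} (ModuleCat.of A M) (ModuleCat.of A D) n from x)
    (Ext.mk₀ (actHom A D b)) (add_zero n)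
  one_smul x := by
    change Ext.comp _ (Ext.mk₀ (actHom A D (1 : B))) (add_zero n) = _
    rw [actHom_one, Ext.comp_mk₀_id]
  mul_smul a b x := by
    change Ext.comp _ (Ext.mk₀ (actHom A D (a * b))) (add_zero n) = _
    rw [actHom_mul, ← Ext.mk₀_comp_mk₀]
    exact (Ext.comp_assoc_of_third_deg_zero _ _ _ _).symm
  smul_zero b := by
    change Ext.comp 0 (Ext.mk₀ (actHom A D b)) (add_zero n) = _
    rw [Ext.zero_comp]
    rfl
  smul_add b x y := Ext.add_comp _ _ _ _
  add_smul a b x := by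
    change Ext.comp _ (Ext.mk₀ (actHom A D (a + b))) (add_zero n) = _
    rw [actHom_add, Ext.mk₀_add, Ext.comp_add]
    rfl
  zero_smul x := by
    change Ext.comp _ (Ext.mk₀ (actHom A D (0 : B))) (add_zero n) = _
    rw [actHom_zero, Ext.mk₀_zero, Ext.comp_zero]
    rfl

variable {A}

/-- Contravariant functoriality of `Ext^n_A(-, D)`. -/
noncomputable def extBiMap (f : M →ₗ[A] M') (n : ℕ) : ExtBi A D B M' n →ₗ[B] ExtBi A D B M n where
  toFun x := Ext.comp (Ext.mk₀ (ModuleCat.ofHom f))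
    (show Ext.{u} (ModuleCat.of A M') (ModuleCat.of A D) n from x) (zero_add n)
  map_add' _ _ := Ext.comp_add _ _ _ _
  map_smul' _ _ := (Ext.comp_assoc_of_third_deg_zero _ _ _ _).symm

lemma extBiMap_id (n : ℕ) (x : ExtBi A D B M n) : extBiMap B D (LinearMap.id (R := A)) n x = x :=
  Ext.mk₀_id_comp _

lemma extBiMap_comp (f : M →ₗ[A] M') (g : M' →ₗ[A] M'') (n : ℕ) (x : ExtBi A D B M'' n) :
    extBiMap B D (g ∘ₗ f) n x = extBiMap B D f n (extBiMap B D g n x) := by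
  change Ext.comp (Ext.mk₀ (ModuleCat.ofHom f ≫ ModuleCat.ofHom g)) x (zero_add n) = _
  rw [← Ext.mk₀_comp_mk₀]
  exact Ext.comp_assoc_of_second_deg_zero _ _ _ _

/-- Isomorphic modules have isomorphic Ext groups. -/
noncomputable def extBiCongr (e : M ≃ₗ[A] M') (n : ℕ) : ExtBi A D B M n ≃ₗ[B] ExtBi A D B M' n :=
  LinearEquiv.ofLinearMap (extBiMap B D e.symm.toLinearMap n) (extBiMap B D e.toLinearMap n)
    (by
      ext x
      rw [LinearMap.comp_apply, ← extBiMap_comp, LinearEquiv.comp_symm, extBiMap_id]; rfl)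
    (by
      ext x
      rw [LinearMap.comp_apply, ← extBiMap_comp, LinearEquiv.symm_comp, extBiMap_id]; rfl)

/-- A homomorphism, seen as an element of `Ext^0`. -/
noncomputable def extBiZeroMap : (M →ₗ[A] D) →ₗ[B] ExtBi A D B M 0 where
  toFun φ := (Ext.mk₀ (ModuleCat.ofHom φ) : Ext.{u} (ModuleCat.of A M) (ModuleCat.of A D) 0)
  map_add' φ ψ := by
    change Ext.mk₀ (ModuleCat.ofHom φ + ModuleCat.ofHom ψ) = _
    rw [Ext.mk₀_add]
    rfl
  map_smul' b φ := by
    change Ext.mk₀ (ModuleCat.ofHom φ ≫ actHom A D b) = _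
    rw [← Ext.mk₀_comp_mk₀]
    rfl

lemma extBiZeroMap_bijective : Function.Bijective (extBiZeroMap (M := M) (A := A) B D) := by
  have h := Ext.mk₀_bijective (ModuleCat.of A M) (ModuleCat.of A D)
  refine ⟨fun φ ψ hφ => congrArg ModuleCat.Hom.hom (h.1 hφ), fun x => ?_⟩
  obtain ⟨φ, hφ⟩ := h.2 x
  exact ⟨φ.hom, hφ⟩

lemma extBiMap_extBiZeroMap (f : M →ₗ[A] M') (φ : M' →ₗ[A] D) :
    extBiMap B D f 0 (extBiZeroMap B D φ) = extBiZeroMap B D (φ ∘ₗ f) := by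
  change Ext.comp (Ext.mk₀ (ModuleCat.ofHom f)) (Ext.mk₀ (ModuleCat.ofHom φ)) (zero_add 0) = _
  rw [Ext.mk₀_comp_mk₀]
  rfl

lemma subsingleton_extBi_of_projective [Module.Projective A M] (n : ℕ) :
    Subsingleton (ExtBi A D B M (n + 1)) := by
  have : Projective (ModuleCat.of A M) := (IsProjective.iff_projective M).1 inferInstance
  exact HasProjectiveDimensionLT.subsingleton (ModuleCat.of A M) 1 _ (by lia) _

section LES

variable {f : M →ₗ[A] M'} {g : M' →ₗ[A] M''}

lemma shortExact_of_exact (hf : Function.Injective f) (hfg : Function.Exact f g)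
    (hg : Function.Surjective g) :
    (ModuleCat.shortComplexOfCompEqZero f g hfg.linearMap_comp_eq_zero).ShortExact :=
  ModuleCat.shortComplex_shortExact _ hfg hf hg

lemma mk₀_zero_comp {X Y Z : ModuleCat.{u} A} {n : ℕ} (y : Ext.{u} Y Z n) :
    (Ext.mk₀ (0 : X ⟶ Y)).comp y (zero_add n) = 0 := by
  rw [Ext.mk₀_zero, Ext.zero_comp]

lemma exact_extBiMap (hf : Function.Injective f) (hfg : Function.Exact f g)
    (hg : Function.Surjective g) (n : ℕ) :
    Function.Exact (extBiMap B D g n) (extBiMap B D f n) := by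
  intro x
  constructor
  · intro hx
    exact Ext.contravariant_sequence_exact₂ (shortExact_of_exact hf hfg hg) _ x hx
  · rintro ⟨y, rfl⟩
    rw [← extBiMap_comp, hfg.linearMap_comp_eq_zero]
    exact mk₀_zero_comp _

/-- The connecting homomorphism. -/
noncomputable def extBiδ (hf : Function.Injective f) (hfg : Function.Exact f g)
    (hg : Function.Surjective g) (n : ℕ) : ExtBi A D B M n →ₗ[B] ExtBi A D B M'' (n + 1) where
  toFun x := Ext.comp (shortExact_of_exact hf hfg hg).extClass
    (show Ext.{u} (ModuleCat.of A M) (ModuleCat.of A D) n from x) (add_comm 1 n)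
  map_add' _ _ := Ext.comp_add _ _ _ _
  map_smul' _ _ := (Ext.comp_assoc_of_third_deg_zero _ _ _ _).symm

lemma exact_extBiMap_extBiδ (hf : Function.Injective f) (hfg : Function.Exact f g)
    (hg : Function.Surjective g) (n : ℕ) :
    Function.Exact (extBiMap B D f n) (extBiδ B D hf hfg hg n) := by
  intro x
  constructor
  · intro hx
    exact Ext.contravariant_sequence_exact₁ (shortExact_of_exact hf hfg hg) _ x (add_comm 1 n) hx
  · rintro ⟨y, rfl⟩
    exact (shortExact_of_exact hf hfg hg).extClass_comp_assoc (h := add_comm 1 n) _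

lemma exact_extBiδ_extBiMap (hf : Function.Injective f) (hfg : Function.Exact f g)
    (hg : Function.Surjective g) (n : ℕ) :
    Function.Exact (extBiδ B D hf hfg hg n) (extBiMap B D g (n + 1)) := by
  intro x
  constructor
  · intro hx
    exact Ext.contravariant_sequence_exact₃ (shortExact_of_exact hf hfg hg) _ x hx (add_comm 1 n)
  · rintro ⟨y, rfl⟩
    exact (shortExact_of_exact hf hfg hg).comp_extClass_assoc _ (add_comm 1 n)

end LES

end ExtBimodule

/-- For right modules over `Γ`, the Ext groups agree with those of the statement. -/
noncomputable def extBiToRing {Γ : Type u} [Ring Γ] (M : RightMod Γ) (n : ℕ) :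
    ExtBi Γᵐᵒᵖ Γ Γ M n ≃ₗ[Γ] ExtToRing Γ M n where
  toFun x := x
  invFun x := x
  map_add' _ _ := rfl
  map_smul' _ _ := rfl
  left_inv _ := rfl
  right_inv _ := rfl

/-! ### Resolutions of length two and the duality given by a bimodule -/

section Resolutions

variable {A B : Type u} [Ring A] [Ring B] {D : Type u} [AddCommGroup D] [Module A D] [Module B D]
  [SMulCommClass A B D] [SMulCommClass B A D]

variable {X Y Z M N : Type u} [AddCommGroup M] [Module A M] [AddCommGroup X] [Module A X]
  [AddCommGroup Y] [Module A Y] [AddCommGroup N] [Module A N] [AddCommGroup Z] [Module A Z]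

lemma exists_comp_eq_of_ker_le {g : Y →ₗ[A] Z} (hg : Function.Surjective g) (ψ : Y →ₗ[A] N)
    (h : LinearMap.ker g ≤ LinearMap.ker ψ) : ∃ φ : Z →ₗ[A] N, φ ∘ₗ g = ψ := by
  refine ⟨(LinearMap.ker g).liftQ ψ h ∘ₗ (g.quotKerEquivOfSurjective hg).symm.toLinearMap, ?_⟩
  ext y
  have : (g.quotKerEquivOfSurjective hg).symm (g y) = Submodule.Quotient.mk y := by
    rw [LinearEquiv.symm_apply_eq]; rfl
  simp [this]

lemma exists_comp_eq_of_range_le {f : X →ₗ[A] Y} (hf : Function.Injective f) (ψ : N →ₗ[A] Y)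
    (h : LinearMap.range ψ ≤ LinearMap.range f) : ∃ φ : N →ₗ[A] X, f ∘ₗ φ = ψ := by
  refine ⟨(LinearEquiv.ofInjective f hf).symm.toLinearMap ∘ₗ
    ψ.codRestrict (LinearMap.range f) fun x => h ⟨x, rfl⟩, ?_⟩
  ext x
  exact congrArg Subtype.val ((LinearEquiv.ofInjective f hf).apply_symm_apply
    (ψ.codRestrict (LinearMap.range f) (fun x => h ⟨x, rfl⟩) x))

lemma exists_comp_eq_of_projective [Module.Projective A N] {f : X →ₗ[A] Y} (ψ : N →ₗ[A] Y)
    (h : LinearMap.range ψ ≤ LinearMap.range f) : ∃ φ : N →ₗ[A] X, f ∘ₗ φ = ψ := by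
  obtain ⟨φ, hφ⟩ := Module.projective_lifting_property f.rangeRestrict
    (ψ.codRestrict (LinearMap.range f) fun x => h ⟨x, rfl⟩) f.surjective_rangeRestrict
  refine ⟨φ, ?_⟩
  ext x
  exact congrArg Subtype.val (LinearMap.congr_fun hφ x)

/-- The sequence `0 ⟶ X ⟶ Y ⟶ Z ⟶ M ⟶ 0` is exact. -/
structure IsLengthTwoResolution (f : X →ₗ[A] Y) (g : Y →ₗ[A] Z) (p : Z →ₗ[A] M) : Prop where
  injective : Function.Injective f
  exact₁ : Function.Exact f g
  exact₂ : Function.Exact g p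
  surjective : Function.Surjective p

lemma isLengthTwoResolution_mkQ {f : X →ₗ[A] Y} {g : Y →ₗ[A] Z} (hf : Function.Injective f)
    (hfg : Function.Exact f g) : IsLengthTwoResolution f g (LinearMap.range g).mkQ where
  injective := hf
  exact₁ := hfg
  exact₂ := by rw [LinearMap.exact_iff, Submodule.ker_mkQ]
  surjective := Submodule.mkQ_surjective _

namespace IsLengthTwoResolution

variable {f : X →ₗ[A] Y} {g : Y →ₗ[A] Z} {p : Z →ₗ[A] M}

lemma ker_eq (h : IsLengthTwoResolution f g p) : LinearMap.ker p = LinearMap.range g :=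
  LinearMap.exact_iff.1 h.exact₂

lemma exact_rangeRestrict (h : IsLengthTwoResolution f g p) :
    Function.Exact f g.rangeRestrict := by
  intro y
  rw [← h.exact₁ y]
  exact Subtype.ext_iff

lemma exact_subtype (h : IsLengthTwoResolution f g p) :
    Function.Exact (LinearMap.range g).subtype p := by
  rw [LinearMap.exact_iff, Submodule.range_subtype, h.ker_eq]

/-- The cokernel of the middle map is the given module. -/
noncomputable def quotEquiv (h : IsLengthTwoResolution f g p) : (Z ⧸ LinearMap.range g) ≃ₗ[A] M :=
  (Submodule.quotEquivOfEq _ _ h.ker_eq.symm).trans (p.quotKerEquivOfSurjective h.surjective)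

/-- The bound 3 is strict, so this is projective dimension at most two. Cut the resolution at the
image of g and shift dimension along both short exact sequences. -/
lemma hasProjectiveDimensionLT [Module.Projective A X] [Module.Projective A Y]
    [Module.Projective A Z] (h : IsLengthTwoResolution f g p) :
    HasProjectiveDimensionLT (ModuleCat.of A M) 3 := by
  have hX := (IsProjective.iff_projective (R := A) X).1 inferInstance
  have hY := (IsProjective.iff_projective (R := A) Y).1 inferInstance
  have hZ := (IsProjective.iff_projective (R := A) Z).1 inferInstance
  have s1 := shortExact_of_exact h.injective h.exact_rangeRestrict g.surjective_rangeRestrict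
  have s2 := shortExact_of_exact (LinearMap.range g).injective_subtype h.exact_subtype h.surjective
  exact (s2.hasProjectiveDimensionLT_X₃_iff 1 hZ).2 ((s1.hasProjectiveDimensionLT_X₃_iff 0 hY).2
    (projective_iff_hasProjectiveDimensionLT_one.1 hX))

/-- The same dimension shift read backwards: second syzygies are projective. -/
lemma projective [Module.Projective A Y] [Module.Projective A Z] (h : IsLengthTwoResolution f g p)
    (hM : HasProjectiveDimensionLT (ModuleCat.of A M) 3) : Module.Projective A X := by
  have hY := (IsProjective.iff_projective (R := A) Y).1 inferInstance
  have hZ := (IsProjective.iff_projective (R := A) Z).1 inferInstance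
  have s1 := shortExact_of_exact h.injective h.exact_rangeRestrict g.surjective_rangeRestrict
  have s2 := shortExact_of_exact (LinearMap.range g).injective_subtype h.exact_subtype h.surjective
  exact (IsProjective.iff_projective (R := A) X).2 (projective_iff_hasProjectiveDimensionLT_one.2
    ((s1.hasProjectiveDimensionLT_X₃_iff 0 hY).1 ((s2.hasProjectiveDimensionLT_X₃_iff 1 hZ).1 hM)))

variable (B D)

/-- Hom(M, D) is the kernel of Hom(Z, D) → Hom(Y, D), as M is the cokernel of g. -/
lemma subsingleton_extBi_zero_iff (h : IsLengthTwoResolution f g p) :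
    Subsingleton (ExtBi A D B M 0) ↔ Function.Injective (LinearMap.lcomp B D g) := by
  rw [← (Equiv.ofBijective _ (extBiZeroMap_bijective (M := M) (A := A) B D)).subsingleton_congr]
  constructor
  · intro hs
    rw [injective_iff_map_eq_zero]
    intro φ hφ
    obtain ⟨ψ, rfl⟩ := exists_comp_eq_of_ker_le h.surjective φ (by
      rw [h.ker_eq]
      rintro _ ⟨y, rfl⟩
      exact LinearMap.congr_fun hφ y)
    rw [Subsingleton.elim ψ 0, LinearMap.zero_comp]
  · intro hi
    refine subsingleton_of_forall_eq 0 fun ψ => ?_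
    have : ψ ∘ₗ p = 0 := hi (by
      ext y
      simp [h.exact₂.apply_apply_eq_zero y])
    ext m
    obtain ⟨z, rfl⟩ := h.surjective m
    exact LinearMap.congr_fun this z

/-- With I the image of g, Ext¹(M, D) is the cokernel of Hom(Z, D) → Hom(I, D), and Hom(I, D) is the
kernel of Hom(Y, D) → Hom(X, D). -/
lemma subsingleton_extBi_one_iff [Module.Projective A Z] (h : IsLengthTwoResolution f g p) :
    Subsingleton (ExtBi A D B M 1) ↔
      Function.Exact (LinearMap.lcomp B D g) (LinearMap.lcomp B D f) := by
  have hi := (LinearMap.range g).injective_subtype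
  have e1 := exact_extBiMap_extBiδ B D hi h.exact_subtype h.surjective 0
  have e2 := exact_extBiδ_extBiMap B D hi h.exact_subtype h.surjective 0
  have := subsingleton_extBi_of_projective B D (A := A) (M := Z) 0
  constructor
  · intro hs ψ
    constructor
    · intro hψ
      obtain ⟨φ, hφ⟩ := exists_comp_eq_of_ker_le g.surjective_rangeRestrict ψ (by
        rw [LinearMap.exact_iff.1 h.exact_rangeRestrict]
        rintro _ ⟨x, rfl⟩
        exact LinearMap.congr_fun hψ x)
      obtain ⟨y, hy⟩ := (e1 (extBiZeroMap B D φ)).1 (Subsingleton.elim _ _)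
      obtain ⟨χ, rfl⟩ := (extBiZeroMap_bijective B D).2 y
      rw [extBiMap_extBiZeroMap] at hy
      refine ⟨χ, ?_⟩
      rw [← hφ, ← (extBiZeroMap_bijective B D).1 hy]
      rfl
    · rintro ⟨φ, rfl⟩
      ext x
      simp [h.exact₁.apply_apply_eq_zero x]
  · intro he
    refine subsingleton_of_forall_eq 0 fun x => ?_
    obtain ⟨y, rfl⟩ := (e2 x).1 (Subsingleton.elim _ _)
    obtain ⟨φ, rfl⟩ := (extBiZeroMap_bijective B D).2 y
    obtain ⟨χ, hχ⟩ := (he (φ ∘ₗ g.rangeRestrict)).1 (by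
      ext x
      have := h.exact_rangeRestrict.apply_apply_eq_zero x
      simp [this])
    refine (e1 _).2 ⟨extBiZeroMap B D χ, ?_⟩
    rw [extBiMap_extBiZeroMap]
    congr 1
    ext ⟨_, y, rfl⟩
    exact LinearMap.congr_fun hχ y

/-- The dual of a projective resolution computes `Ext^2`. -/
lemma exists_extBi_two [Module.Projective A Y] [Module.Projective A Z]
    (h : IsLengthTwoResolution f g p) :
    ∃ π : (X →ₗ[A] D) →ₗ[B] ExtBi A D B M 2,
      Function.Surjective π ∧ Function.Exact (LinearMap.lcomp B D f) π := by
  have hi := (LinearMap.range g).injective_subtype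
  let δ₂ := extBiδ B D hi h.exact_subtype h.surjective 1
  let δ₁ := extBiδ B D h.injective h.exact_rangeRestrict g.surjective_rangeRestrict 0
  have a1 := exact_extBiMap_extBiδ B D hi h.exact_subtype h.surjective 1
  have a2 := exact_extBiδ_extBiMap B D hi h.exact_subtype h.surjective 1
  have b1 := exact_extBiMap_extBiδ B D h.injective h.exact_rangeRestrict
    g.surjective_rangeRestrict 0
  have b2 := exact_extBiδ_extBiMap B D h.injective h.exact_rangeRestrict
    g.surjective_rangeRestrict 0
  have := subsingleton_extBi_of_projective B D (A := A) (M := Z) 0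
  have := subsingleton_extBi_of_projective B D (A := A) (M := Z) 1
  have := subsingleton_extBi_of_projective B D (A := A) (M := Y) 0
  have hδ₂ : Function.Injective δ₂ := by
    rw [injective_iff_map_eq_zero]
    intro x hx
    obtain ⟨y, rfl⟩ := (a1 x).1 hx
    rw [Subsingleton.elim y 0, map_zero]
  -- Both connecting maps Hom(X, D) → Ext¹(I, D) → Ext²(M, D), with I the image of g, are onto
  -- because Ext¹ of Y and Ext² of Z vanish; the second is also injective.
  refine ⟨δ₂ ∘ₗ δ₁ ∘ₗ extBiZeroMap B D, ?_, ?_⟩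
  · intro x
    obtain ⟨y, rfl⟩ := (a2 x).1 (Subsingleton.elim _ _)
    obtain ⟨z, rfl⟩ := (b2 y).1 (Subsingleton.elim _ _)
    obtain ⟨φ, rfl⟩ := (extBiZeroMap_bijective B D).2 z
    exact ⟨φ, rfl⟩
  · intro φ
    constructor
    · intro hφ
      have hφ : δ₁ (extBiZeroMap B D φ) = 0 := hδ₂ (hφ.trans (map_zero _).symm)
      obtain ⟨y, hy⟩ := (b1 _).1 hφ
      obtain ⟨ψ, rfl⟩ := (extBiZeroMap_bijective B D).2 y
      rw [extBiMap_extBiZeroMap] at hy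
      exact ⟨ψ, (extBiZeroMap_bijective B D).1 hy⟩
    · rintro ⟨ψ, rfl⟩
      have : δ₁ (extBiZeroMap B D (ψ ∘ₗ f)) = 0 := (b1 _).2 ⟨extBiZeroMap B D ψ,
        extBiMap_extBiZeroMap _ _ _ _⟩
      change δ₂ (δ₁ (extBiZeroMap B D (ψ ∘ₗ f))) = 0
      rw [this, map_zero]

/-- `Ext^2` as a cokernel. -/
noncomputable def extBiTwoEquiv [Module.Projective A Y] [Module.Projective A Z]
    (h : IsLengthTwoResolution f g p) :
    ((X →ₗ[A] D) ⧸ LinearMap.range (LinearMap.lcomp B D f)) ≃ₗ[B] ExtBi A D B M 2 :=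
  (Submodule.quotEquivOfEq _ _
    (LinearMap.exact_iff.1 (h.exists_extBi_two B D).choose_spec.2).symm).trans
    ((h.exists_extBi_two B D).choose.quotKerEquivOfSurjective
      (h.exists_extBi_two B D).choose_spec.1)

end IsLengthTwoResolution

/-- Cover M by a finite free module, and the kernel, which is finitely generated, by another; the
second kernel is projective by the dimension bound. -/
lemma exists_isLengthTwoResolution [IsNoetherianRing A] [Module.Finite A M]
    (hM : HasProjectiveDimensionLT (ModuleCat.of A M) 3) :
    ∃ (n m : ℕ) (X : Submodule A (Fin n → A)) (g : (Fin n → A) →ₗ[A] Fin m → A)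
      (p : (Fin m → A) →ₗ[A] M), Module.Projective A X ∧ IsLengthTwoResolution X.subtype g p := by
  obtain ⟨m, p, hp⟩ := Module.Finite.exists_fin' A M
  obtain ⟨n, q, hq⟩ := Module.Finite.exists_fin' A (LinearMap.ker p)
  have h : IsLengthTwoResolution (LinearMap.ker ((LinearMap.ker p).subtype ∘ₗ q)).subtype
      ((LinearMap.ker p).subtype ∘ₗ q) p := by
    refine ⟨Submodule.injective_subtype _, ?_, ?_, hp⟩
    · rw [LinearMap.exact_iff, Submodule.range_subtype]
    · rw [LinearMap.exact_iff, LinearMap.range_comp_of_range_eq_top _ (LinearMap.range_eq_top.2 hq),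
        Submodule.range_subtype]
  exact ⟨n, m, _, _, p, h.projective hM, h⟩

/-- The regularity conditions carried by `FiltBy`, relative to a set `T'` of classes on the other
side. -/
structure IsExtRegular (A : Type u) [Ring A] (T' : Set (ModClass B)) (D : Type u)
    [AddCommGroup D] [Module A D] [Module B D] [SMulCommClass A B D] [SMulCommClass B A D]
    (M : Type u) [AddCommGroup M] [Module A M] : Prop where
  projDim : HasProjectiveDimensionLT (ModuleCat.of A M) 3
  ext_zero : Subsingleton (ExtBi A D B M 0)
  ext_one : Subsingleton (ExtBi A D B M 1)
  ext_two : FiltBy T' (ExtBi A D B M 2)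

lemma IsExtRegular.of_exact {T' : Set (ModClass B)} (hT' : SimpleClasses T') {f : X →ₗ[A] Y}
    {g : Y →ₗ[A] Z}
    (hf : Function.Injective f) (hfg : Function.Exact f g) (hg : Function.Surjective g)
    (hX : IsExtRegular A T' D X) (hZ : IsExtRegular A T' D Z) : IsExtRegular A T' D Y where
  projDim := (shortExact_of_exact hf hfg hg).hasProjectiveDimensionLT_X₂ 3 hX.projDim hZ.projDim
  ext_zero := by
    have := hX.ext_zero
    have := hZ.ext_zero
    refine subsingleton_of_forall_eq 0 fun x => ?_
    obtain ⟨y, rfl⟩ := (exact_extBiMap B D hf hfg hg 0 x).1 (Subsingleton.elim _ _)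
    rw [Subsingleton.elim y 0, map_zero]
  ext_one := by
    have := hX.ext_one
    have := hZ.ext_one
    refine subsingleton_of_forall_eq 0 fun x => ?_
    obtain ⟨y, rfl⟩ := (exact_extBiMap B D hf hfg hg 1 x).1 (Subsingleton.elim _ _)
    rw [Subsingleton.elim y 0, map_zero]
  ext_two := by
    have e := exact_extBiMap B D hf hfg hg 2
    -- Ext² of Y is an extension of a submodule of Ext² of X by a quotient of Ext² of Z. Nothing
    -- about Ext³ is needed, since filtered modules are closed under both.
    refine .of_surjective_of_ker (Q := LinearMap.range (extBiMap B D f 2))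
      (hX.ext_two.of_injective hT' (Submodule.subtype _) (Submodule.injective_subtype _))
      (extBiMap B D f 2).rangeRestrict (LinearMap.surjective_rangeRestrict _) ?_
    rw [LinearMap.ker_rangeRestrict, LinearMap.exact_iff.1 e]
    exact hZ.ext_two.of_surjective hT' (extBiMap B D g 2).rangeRestrict
      (LinearMap.surjective_rangeRestrict _)

lemma IsExtRegular.of_subsingleton {T' : Set (ModClass B)} [Subsingleton M] :
    IsExtRegular A T' D M := by
  have hp : Module.Projective A M := inferInstance
  have : Projective (ModuleCat.of A M) := (IsProjective.iff_projective M).1 hp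
  have h1 := subsingleton_extBi_of_projective B D (A := A) (M := M) 1
  refine ⟨inferInstanceAs (HasProjectiveDimensionLT (ModuleCat.of A M) (1 + 2)), ?_,
    subsingleton_extBi_of_projective B D (A := A) (M := M) 0, .of_subsingleton⟩
  exact (Equiv.ofBijective _ (extBiZeroMap_bijective (M := M) (A := A) B D)).symm.subsingleton

lemma FiltBy.isExtRegular {T : Set (ModClass A)} {T' : Set (ModClass B)} (hT' : SimpleClasses T')
    (h : ∀ (S : Type u) [AddCommGroup S] [Module A S], modClass A S ∈ T → IsExtRegular A T' D S)
    (hM : FiltBy T M) : IsExtRegular A T' D M := by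
  induction hM with
  | of_subsingleton => exact .of_subsingleton
  | of_quotient N _ hN ih =>
    exact .of_exact hT' N.injective_subtype (LinearMap.exact_subtype_mkQ N)
      N.mkQ_surjective ih (h _ hN)

end Resolutions

/-! ### Duality of finitely generated projectives and of 2-regular modules over a dualizing bimodule
-/

section Dualizing

/-- A bimodule which is free of rank one on both sides on a common generator. -/
structure DualizingBimodule (A B D : Type u) [Ring A] [Ring B] [AddCommGroup D] [Module A D]
    [Module B D] where
  /-- The coordinate over `A`. -/
  left : D ≃ₗ[A] A
  /-- The coordinate over `B`. -/
  right : D ≃ₗ[B] B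
  smul_comm : ∀ d d' : D, left d • d' = right d' • d

variable {A B : Type u} [Ring A] [Ring B] {D : Type u} [AddCommGroup D] [Module A D] [Module B D]

/-- Exchange of the two sides. -/
def DualizingBimodule.symm (h : DualizingBimodule A B D) : DualizingBimodule B A D where
  left := h.right
  right := h.left
  smul_comm d d' := (h.smul_comm d' d).symm

/-- The regular bimodule, with its right structure first. -/
def regularBimodule (Γ : Type u) [Ring Γ] : DualizingBimodule Γᵐᵒᵖ Γ Γ where
  left :=
    { toFun := MulOpposite.op
      invFun := MulOpposite.unop
      map_add' _ _ := rfl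
      map_smul' _ _ := rfl
      left_inv _ := rfl
      right_inv _ := rfl }
  right := LinearEquiv.refl Γ Γ
  -- Both sides are the product d' * d in Γ.
  smul_comm _ _ := rfl

variable [SMulCommClass A B D] [SMulCommClass B A D]

variable {X Y Z M P Q : Type u} [AddCommGroup M] [Module A M] [AddCommGroup X] [Module A X]
  [AddCommGroup Y] [Module A Y] [AddCommGroup Z] [Module A Z] [AddCommGroup P] [Module A P]
  [AddCommGroup Q] [Module A Q]

variable (B D) in
/-- The evaluation map into the bidual. -/
def evalBidual (P : Type u) [AddCommGroup P] [Module A P] : P →ₗ[A] ((P →ₗ[A] D) →ₗ[B] D) where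
  toFun x := { toFun φ := φ x, map_add' _ _ := rfl, map_smul' _ _ := rfl }
  map_add' _ _ := by ext φ; exact map_add φ _ _
  map_smul' _ _ := by ext φ; exact map_smul φ _ _

@[simp] lemma evalBidual_apply (x : P) (φ : P →ₗ[A] D) : evalBidual B D P x φ = φ x := rfl

lemma lcomp_lcomp_evalBidual (f : X →ₗ[A] Y) (x : X) :
    LinearMap.lcomp A D (LinearMap.lcomp B D f) (evalBidual B D X x) = evalBidual B D Y (f x) :=
  rfl

namespace DualizingBimodule

variable (h : DualizingBimodule A B D)
include h

/-- The forms are the coordinates of a section of a surjection Aⁿ → P, transported from A to D. -/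
lemma exists_dualBasis [Module.Finite A P] [Module.Projective A P] :
    ∃ (n : ℕ) (q : Fin n → P) (φ : Fin n → P →ₗ[A] D), ∀ x, ∑ i, h.left (φ i x) • q i = x := by
  obtain ⟨n, π, hπ⟩ := Module.Finite.exists_fin' A P
  obtain ⟨s, hs⟩ := Module.projective_lifting_property π LinearMap.id hπ
  refine ⟨n, fun i => π (Pi.single i 1), fun i => h.left.symm.toLinearMap ∘ₗ LinearMap.proj i ∘ₗ s,
    fun x => ?_⟩
  have hx : π (s x) = x := LinearMap.congr_fun hs x
  conv_rhs => rw [← hx, ← Finset.univ_sum_single (s x), map_sum]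
  refine Finset.sum_congr rfl fun i _ => ?_
  simp only [LinearMap.comp_apply, LinearEquiv.coe_coe, LinearEquiv.apply_symm_apply,
    LinearMap.proj_apply, ← map_smul]
  congr 1
  rw [← Pi.single_smul, smul_eq_mul, mul_one]

variable {n : ℕ} {q : Fin n → P} {φ : Fin n → P →ₗ[A] D}

/-- `smul_comm` trades the A-coefficient from φ i for the B-coefficient from ψ (q i), so the same
data form a dual basis of the dual module. -/
lemma sum_right_smul (hb : ∀ x, ∑ i, h.left (φ i x) • q i = x) (ψ : P →ₗ[A] D) :
    ∑ i, h.right (ψ (q i)) • φ i = ψ := by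
  ext x
  conv_rhs => rw [← hb x, map_sum]
  simp [LinearMap.sum_apply, h.smul_comm]

lemma finite_dual [Module.Finite A P] [Module.Projective A P] : Module.Finite B (P →ₗ[A] D) := by
  obtain ⟨n, q, φ, hb⟩ := h.exists_dualBasis (P := P)
  refine Module.Finite.of_surjective (Fintype.linearCombination B φ) fun ψ =>
    ⟨fun i => h.right (ψ (q i)), ?_⟩
  rw [Fintype.linearCombination_apply, h.sum_right_smul hb ψ]

lemma projective_dual [Module.Finite A P] [Module.Projective A P] :
    Module.Projective B (P →ₗ[A] D) := by
  obtain ⟨n, q, φ, hb⟩ := h.exists_dualBasis (P := P)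
  let i : (P →ₗ[A] D) →ₗ[B] Fin n → B :=
    LinearMap.pi fun j => h.right.toLinearMap ∘ₗ
      { toFun := fun ψ => ψ (q j), map_add' := fun _ _ => rfl, map_smul' := fun _ _ => rfl }
  refine Module.Projective.of_split i (Fintype.linearCombination B φ) ?_
  ext1 ψ
  rw [LinearMap.comp_apply, Fintype.linearCombination_apply]
  exact h.sum_right_smul hb ψ

/-- The dual basis separates points, and a functional on the dual is evaluation at the element whose
coordinates are its values on the φ i. -/
lemma evalBidual_bijective [Module.Finite A P] [Module.Projective A P] :
    Function.Bijective (evalBidual (A := A) B D P) := by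
  obtain ⟨n, q, φ, hb⟩ := h.exists_dualBasis (P := P)
  constructor
  · rw [injective_iff_map_eq_zero]
    intro x hx
    rw [← hb x]
    refine Finset.sum_eq_zero fun i _ => ?_
    rw [show φ i x = 0 from LinearMap.congr_fun hx (φ i), map_zero, zero_smul]
  · intro Ψ
    refine ⟨∑ i, h.left (Ψ (φ i)) • q i, ?_⟩
    ext ψ
    conv_rhs => rw [← h.sum_right_smul hb ψ, map_sum]
    simp [h.smul_comm]

/-- Every map between duals is the dual of a map. -/
lemma exists_eq_lcomp [Module.Finite A Q] [Module.Projective A Q]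
    (α : (Q →ₗ[A] D) →ₗ[B] (P →ₗ[A] D)) : ∃ a : P →ₗ[A] Q, LinearMap.lcomp B D a = α := by
  let e := LinearEquiv.ofBijective _ (h.evalBidual_bijective (P := Q))
  refine ⟨e.symm.toLinearMap ∘ₗ LinearMap.lcomp A D α ∘ₗ evalBidual B D P, ?_⟩
  ext ψ x
  have : evalBidual B D Q (e.symm (LinearMap.lcomp A D α (evalBidual B D P x))) =
    LinearMap.lcomp A D α (evalBidual B D P x) := e.apply_symm_apply _
  exact LinearMap.congr_fun this ψ

lemma lcomp_injective [Module.Finite A Q] [Module.Projective A Q] {a b : P →ₗ[A] Q}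
    (hab : LinearMap.lcomp B D a = LinearMap.lcomp B D b) : a = b := by
  ext x
  refine (h.evalBidual_bijective (P := Q)).1 ?_
  ext ψ
  exact LinearMap.congr_fun (LinearMap.congr_fun hab ψ) x

section Bidual

variable [Module.Finite A X] [Module.Projective A X] [Module.Finite A Y] [Module.Projective A Y]
  [Module.Finite A Z] [Module.Projective A Z]

lemma injective_bidual_iff (f : X →ₗ[A] Y) :
    Function.Injective (LinearMap.lcomp A D (LinearMap.lcomp B D f)) ↔ Function.Injective f := by
  have hX := h.evalBidual_bijective (P := X)
  have hY := h.evalBidual_bijective (P := Y)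
  simp only [injective_iff_map_eq_zero]
  constructor
  · intro H x hx
    refine hX.1 ((H _ ?_).trans (map_zero _).symm)
    rw [lcomp_lcomp_evalBidual, hx, map_zero]
  · intro H Ψ hΨ
    obtain ⟨x, rfl⟩ := hX.2 Ψ
    rw [lcomp_lcomp_evalBidual] at hΨ
    rw [H x (hY.1 (hΨ.trans (map_zero _).symm)), map_zero]

lemma exact_bidual_iff (f : X →ₗ[A] Y) (g : Y →ₗ[A] Z) :
    Function.Exact (LinearMap.lcomp A D (LinearMap.lcomp B D f))
      (LinearMap.lcomp A D (LinearMap.lcomp B D g)) ↔ Function.Exact f g := by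
  have hX := h.evalBidual_bijective (P := X)
  have hY := h.evalBidual_bijective (P := Y)
  have hZ := h.evalBidual_bijective (P := Z)
  have key : ∀ y, (LinearMap.lcomp A D (LinearMap.lcomp B D g) (evalBidual B D Y y) = 0 ↔
      g y = 0) ∧ (evalBidual B D Y y ∈ Set.range (LinearMap.lcomp A D (LinearMap.lcomp B D f)) ↔
        y ∈ Set.range f) := by
    refine fun y => ⟨?_, ?_⟩
    · rw [lcomp_lcomp_evalBidual, map_eq_zero_iff _ hZ.1]
    · constructor
      · rintro ⟨Ψ, hΨ⟩
        obtain ⟨x, rfl⟩ := hX.2 Ψ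
        exact ⟨x, hY.1 hΨ⟩
      · rintro ⟨x, rfl⟩
        exact ⟨evalBidual B D X x, rfl⟩
  constructor
  · intro H y
    rw [← (key y).1, ← (key y).2]
    exact H _
  · intro H Ψ
    obtain ⟨y, rfl⟩ := hY.2 Ψ
    rw [(key y).1, (key y).2]
    exact H _

/-- The cokernel of a map and of its bidual agree. -/
noncomputable def quotBidualEquiv (g : Y →ₗ[A] Z) : (Z ⧸ LinearMap.range g) ≃ₗ[A]
    (((Z →ₗ[A] D) →ₗ[B] D) ⧸ LinearMap.range (LinearMap.lcomp A D (LinearMap.lcomp B D g))) :=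
  Submodule.Quotient.equiv _ _ (LinearEquiv.ofBijective _ (h.evalBidual_bijective (P := Z))) (by
    ext Ψ
    constructor
    · rintro ⟨_, ⟨y, rfl⟩, rfl⟩
      exact ⟨evalBidual B D Y y, rfl⟩
    · rintro ⟨Φ, rfl⟩
      obtain ⟨y, rfl⟩ := (h.evalBidual_bijective (P := Y)).2 Φ
      exact ⟨g y, ⟨y, rfl⟩, rfl⟩)

variable {f : X →ₗ[A] Y} {g : Y →ₗ[A] Z} {p : Z →ₗ[A] M}

/-- Vanishing of Ext⁰ and Ext¹ is exactness of the dual complex at its first two terms. The cokernel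
that it then resolves is Ext². -/
lemma isLengthTwoResolution_dual (hr : IsLengthTwoResolution f g p)
    (h0 : Subsingleton (ExtBi A D B M 0)) (h1 : Subsingleton (ExtBi A D B M 1)) :
    IsLengthTwoResolution (LinearMap.lcomp B D g) (LinearMap.lcomp B D f)
      (LinearMap.range (LinearMap.lcomp B D f)).mkQ :=
  isLengthTwoResolution_mkQ ((hr.subsingleton_extBi_zero_iff B D).1 h0)
    ((hr.subsingleton_extBi_one_iff B D).1 h1)

/-- `Ext^2(Ext^2(M, D), D)` is `M`, and the other conditions pass to `Ext^2(M, D)`. -/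
lemma isExtRegular_extBi_two {T : Set (ModClass A)} (hr : IsLengthTwoResolution f g p)
    (h0 : Subsingleton (ExtBi A D B M 0)) (h1 : Subsingleton (ExtBi A D B M 1))
    (hM : FiltBy T M) : IsExtRegular B T D (ExtBi A D B M 2) := by
  have hd := h.isLengthTwoResolution_dual hr h0 h1
  let e := hr.extBiTwoEquiv B D
  have := h.projective_dual (P := X)
  have := h.projective_dual (P := Y)
  have := h.projective_dual (P := Z)
  have hp := hd.hasProjectiveDimensionLT
  refine ⟨hasProjectiveDimensionLT_of_iso e.toModuleIso 3, ?_, ?_, ?_⟩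
  · rw [← (extBiCongr A D e 0).toEquiv.subsingleton_congr, hd.subsingleton_extBi_zero_iff A D,
      h.injective_bidual_iff]
    exact hr.injective
  · rw [← (extBiCongr A D e 1).toEquiv.subsingleton_congr, hd.subsingleton_extBi_one_iff A D,
      h.exact_bidual_iff]
    exact hr.exact₁
  -- M is the cokernel of g, hence of its bidual; since the dual sequence resolves Ext²(M, D), that
  -- cokernel is Ext² of Ext²(M, D).
  · exact hM.equiv (hr.quotEquiv.symm.trans ((h.quotBidualEquiv g).trans
      ((hd.extBiTwoEquiv A D).trans (extBiCongr A D e 2))))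

end Bidual

end DualizingBimodule

/-- The classes of the modules `Ext^2(S, D)` for `S` in `T`. -/
def dualClasses (B D : Type u) [Ring B] [AddCommGroup D] [Module A D] [Module B D]
    [SMulCommClass A B D] [SMulCommClass B A D] (T : Set (ModClass A)) : Set (ModClass B) :=
  {c | ∃ (S : Type u) (_ : AddCommGroup S) (_ : Module A S), modClass A S ∈ T ∧
    modClass B (ExtBi A D B S 2) = c}

/-- The classes in `T` are classes of simple modules satisfying the 2-regular condition (relative
to the bimodule `D`). -/
def IsTwoRegularClasses (B D : Type u) [Ring B] [AddCommGroup D] [Module A D] [Module B D]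
    [SMulCommClass A B D] [SMulCommClass B A D] (T : Set (ModClass A)) : Prop :=
  ∀ (S : Type u) [AddCommGroup S] [Module A S], modClass A S ∈ T →
    IsSimpleModule A S ∧ HasProjectiveDimensionLT (ModuleCat.of A S) 3 ∧
      Subsingleton (ExtBi A D B S 0) ∧ Subsingleton (ExtBi A D B S 1) ∧
        IsSimpleModule B (ExtBi A D B S 2)

namespace IsTwoRegularClasses

variable {T : Set (ModClass A)} (hT : IsTwoRegularClasses B D T)
include hT

lemma simpleClasses : SimpleClasses T := fun S _ _ hS => (hT S hS).1

lemma simpleClasses_dual : SimpleClasses (dualClasses B D T) := by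
  rintro N _ _ ⟨S, _, _, hS, hN⟩
  have := (hT S hS).2.2.2.2
  obtain ⟨e⟩ := modClass_eq_iff.1 hN
  exact IsSimpleModule.congr e.symm

lemma isExtRegular (hM : FiltBy T M) : IsExtRegular A (dualClasses B D T) D M :=
  hM.isExtRegular hT.simpleClasses_dual fun S _ _ hS =>
    ⟨(hT S hS).2.1, (hT S hS).2.2.1, (hT S hS).2.2.2.1, .of_mem ⟨S, _, _, hS, rfl⟩⟩

/-- By the long exact sequences it suffices to treat the classes Ext²(S, D), where the conditions
hold by dualizing a resolution of S. -/
lemma isExtRegular_dual (h : DualizingBimodule A B D) [IsNoetherianRing A]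
    {N : Type u} [AddCommGroup N] [Module B N]
    (hN : FiltBy (dualClasses B D T) N) : IsExtRegular B T D N := by
  refine hN.isExtRegular hT.simpleClasses ?_
  rintro N _ _ ⟨S, _, _, hS, hN⟩
  obtain ⟨h1, h2, h3, h4, h5⟩ := hT S hS
  obtain ⟨e⟩ := modClass_eq_iff.1 hN
  obtain ⟨n, m, X, g, p, hX, hr⟩ := exists_isLengthTwoResolution h2
  have hreg := h.isExtRegular_extBi_two hr h3 h4 (.of_mem hS)
  have := hreg.projDim
  have := hreg.ext_zero
  have := hreg.ext_one
  exact ⟨hasProjectiveDimensionLT_of_iso e.toModuleIso 3,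
    (extBiCongr A D e 0).symm.toEquiv.subsingleton,
    (extBiCongr A D e 1).symm.toEquiv.subsingleton,
    hreg.ext_two.equiv (extBiCongr A D e 2)⟩

variable [Module.Finite A X] [Module.Projective A X] [Module.Finite A Y] [Module.Projective A Y]
  [Module.Finite A Z] [Module.Projective A Z]

/-- The cokernel of f* is Ext² of the cokernel of g. -/
lemma filtBy_dual {f : X →ₗ[A] Y} {g : Y →ₗ[A] Z} (hf : Function.Injective f)
    (hfg : Function.Exact f g) (hg : FiltBy T (Z ⧸ LinearMap.range g)) :
    FiltBy (dualClasses B D T) ((X →ₗ[A] D) ⧸ LinearMap.range (LinearMap.lcomp B D f)) :=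
  (hT.isExtRegular hg).ext_two.equiv ((isLengthTwoResolution_mkQ hf hfg).extBiTwoEquiv B D).symm

/-- A map whose dual has a cokernel filtered by the dual classes is the kernel of a map whose
cokernel is filtered by `T`. -/
lemma exists_of_filtBy_dual (h : DualizingBimodule A B D) [IsNoetherianRing A] [IsNoetherianRing B]
    (f : X →ₗ[A] Y)
    (hf : FiltBy (dualClasses B D T)
      ((X →ₗ[A] D) ⧸ LinearMap.range (LinearMap.lcomp B D f))) :
    ∃ (Z : Type u) (_ : AddCommGroup Z) (_ : Module A Z) (g : Y →ₗ[A] Z), Module.Finite A Z ∧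
      Module.Projective A Z ∧ Function.Injective f ∧ Function.Exact f g ∧
        FiltBy T (Z ⧸ LinearMap.range g) := by
  have := h.projective_dual (P := X)
  have := h.projective_dual (P := Y)
  have := h.finite_dual (P := X)
  have := h.finite_dual (P := Y)
  have hreg := hT.isExtRegular_dual h hf
  -- The wanted third term is the dual of K, the kernel of f*. The module K is projective as a
  -- second syzygy of the cokernel of f*, which has projective dimension at most two.
  let K := LinearMap.ker (LinearMap.lcomp B D f)
  have hr : IsLengthTwoResolution K.subtype (LinearMap.lcomp B D f)
      (LinearMap.range (LinearMap.lcomp B D f)).mkQ :=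
    isLengthTwoResolution_mkQ K.injective_subtype
      (by rw [LinearMap.exact_iff, Submodule.range_subtype])
  have : Module.Projective B K := hr.projective hreg.projDim
  have hb := h.evalBidual_bijective (P := Y)
  let g : Y →ₗ[A] (K →ₗ[B] D) := LinearMap.lcomp A D K.subtype ∘ₗ evalBidual B D Y
  have hi := (hr.subsingleton_extBi_zero_iff A D).1 hreg.ext_zero
  have he := (hr.subsingleton_extBi_one_iff A D).1 hreg.ext_one
  refine ⟨K →ₗ[B] D, inferInstance, inferInstance, g, h.symm.finite_dual, h.symm.projective_dual,
    (h.injective_bidual_iff f).1 hi, ?_, ?_⟩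
  -- Vanishing of Ext⁰ and Ext¹ makes the dual of K → Y* → X* left exact; Y and X are identified
  -- with their biduals.
  · intro y
    refine (he (evalBidual B D Y y)).trans ⟨?_, ?_⟩
    · rintro ⟨Ψ, hΨ⟩
      obtain ⟨x, rfl⟩ := (h.evalBidual_bijective (P := X)).2 Ψ
      exact ⟨x, hb.1 hΨ⟩
    · rintro ⟨x, rfl⟩
      exact ⟨evalBidual B D X x, rfl⟩
  · have hg : LinearMap.range g = LinearMap.range (LinearMap.lcomp A D K.subtype) :=
      LinearMap.range_comp_of_range_eq_top _ (LinearMap.range_eq_top.2 hb.2)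
    exact hreg.ext_two.equiv (((Submodule.quotEquivOfEq _ _ hg).trans
      (hr.extBiTwoEquiv A D)).symm)

end IsTwoRegularClasses

end Dualizing

/-! ### Working with elements in the category of finitely generated projective modules -/

section ProjLayer

variable {Γ : Type u} [Ring Γ]

instance (X : ProjCat Γ) : Module.Finite Γᵐᵒᵖ X.obj := X.property.1

instance (X : ProjCat Γ) : Module.Projective Γᵐᵒᵖ X.obj := X.property.2

/-- A finitely generated projective module as an object of `proj Γ`. -/
abbrev projOf (M : Type u) [AddCommGroup M] [Module Γᵐᵒᵖ M] [h : Module.Finite Γᵐᵒᵖ M]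
    [h' : Module.Projective Γᵐᵒᵖ M] : ProjCat Γ :=
  ⟨ModuleCat.of Γᵐᵒᵖ M, h, h'⟩

variable {X Y Z W : ProjCat Γ}

/-- The linear map underlying a morphism of `proj Γ`. -/
abbrev lin (f : X ⟶ Y) : X.obj →ₗ[Γᵐᵒᵖ] Y.obj := f.hom.hom

/-- A linear map as a morphism of `proj Γ`. -/
abbrev projHom (φ : X.obj →ₗ[Γᵐᵒᵖ] Y.obj) : X ⟶ Y := ObjectProperty.homMk (ModuleCat.ofHom φ)

lemma lin_projHom (φ : X.obj →ₗ[Γᵐᵒᵖ] Y.obj) : lin (projHom φ) = φ := rfl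

lemma lin_comp_apply (f : X ⟶ Y) (g : Y ⟶ Z) (x : X.obj) : lin (f ≫ g) x = lin g (lin f x) := rfl

lemma lin_zero : lin (0 : X ⟶ Y) = 0 := rfl

lemma lin_sub (f g : X ⟶ Y) : lin (f - g) = lin f - lin g := rfl

lemma proj_ext {f g : X ⟶ Y} (h : lin f = lin g) : f = g :=
  ObjectProperty.hom_ext _ (ModuleCat.hom_ext h)

/-- An isomorphism in `proj Γ` from a linear equivalence. -/
def projIso (e : X.obj ≃ₗ[Γᵐᵒᵖ] Y.obj) : X ≅ Y where
  hom := projHom e.toLinearMap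
  inv := projHom e.symm.toLinearMap
  hom_inv_id := proj_ext (by ext x; exact e.symm_apply_apply x)
  inv_hom_id := proj_ext (by ext x; exact e.apply_symm_apply x)

/-- The linear equivalence underlying an isomorphism. -/
def linIso (e : X ≅ Y) : X.obj ≃ₗ[Γᵐᵒᵖ] Y.obj where
  __ := lin e.hom
  invFun := lin e.inv
  left_inv x := LinearMap.congr_fun (congrArg lin e.hom_inv_id) x
  right_inv x := LinearMap.congr_fun (congrArg lin e.inv_hom_id) x

variable (Γ) in
instance : Module.Finite Γᵐᵒᵖ Γ := Module.Finite.equiv (regularBimodule Γ).left.symm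

variable (Γ) in
instance : Module.Projective Γᵐᵒᵖ Γ := Module.Projective.of_equiv (regularBimodule Γ).left.symm

variable (Γ) in
/-- The regular module as an object of `proj Γ`. -/
abbrev regProj : ProjCat Γ := projOf Γ

/-- The morphism from the regular module given by an element. -/
def elemHom (x : X.obj) : regProj Γ ⟶ X :=
  projHom (LinearMap.toSpanSingleton Γᵐᵒᵖ X.obj x ∘ₗ (regularBimodule Γ).left.toLinearMap)

lemma elemHom_apply (x : X.obj) (a : Γ) : lin (elemHom x) a = MulOpposite.op a • x := rfl

lemma elemHom_one (x : X.obj) : lin (elemHom x) (1 : Γ) = x := by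
  rw [elemHom_apply, MulOpposite.op_one, one_smul]

lemma elemHom_comp (x : X.obj) (f : X ⟶ Y) : elemHom x ≫ f = elemHom (lin f x) :=
  proj_ext (LinearMap.ext fun a => map_smul (lin f) (MulOpposite.op (a : Γ)) x)

/-- Abbreviation for the dual of a linear map of right `Γ`-modules. -/
abbrev dualLin {M N : Type u} [AddCommGroup M] [Module Γᵐᵒᵖ M] [AddCommGroup N] [Module Γᵐᵒᵖ N]
    (f : M →ₗ[Γᵐᵒᵖ] N) : (N →ₗ[Γᵐᵒᵖ] Γ) →ₗ[Γ] (M →ₗ[Γᵐᵒᵖ] Γ) :=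
  LinearMap.lcomp Γ Γ f

lemma elemHom_zero : elemHom (0 : X.obj) = 0 :=
  proj_ext (LinearMap.ext fun a => smul_zero (MulOpposite.op (a : Γ)))

lemma injective_of_mono (f : X ⟶ Y) [Mono f] : Function.Injective (lin f) := by
  rw [injective_iff_map_eq_zero]
  intro x hx
  have : elemHom x = 0 := by
    rw [← cancel_mono f, elemHom_comp, hx, zero_comp, elemHom_zero]
  rw [← elemHom_one x, this]
  rfl

lemma mono_of_injective (f : X ⟶ Y) (h : Function.Injective (lin f)) : Mono f where
  right_cancellation a b hab := proj_ext (by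
    ext x
    exact h (LinearMap.congr_fun (congrArg lin hab) x))

/-- A dual basis of W reduces extending a map to W to extending its finitely many coordinate forms.
-/
lemma exists_extension_of_dual {M N : Type u} [AddCommGroup M] [Module Γᵐᵒᵖ M] [AddCommGroup N]
    [Module Γᵐᵒᵖ N] (f : M →ₗ[Γᵐᵒᵖ] N) (h : M →ₗ[Γᵐᵒᵖ] W.obj)
    (H : ∀ φ : W.obj →ₗ[Γᵐᵒᵖ] Γ, φ ∘ₗ h ∈ LinearMap.range (dualLin f)) :
    ∃ t : N →ₗ[Γᵐᵒᵖ] W.obj, t ∘ₗ f = h := by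
  obtain ⟨n, q, φ, hb⟩ := (regularBimodule Γ).exists_dualBasis (P := W.obj)
  choose ψ hψ using fun i => H (φ i)
  refine ⟨∑ i, LinearMap.toSpanSingleton Γᵐᵒᵖ W.obj (q i) ∘ₗ
    (regularBimodule Γ).left.toLinearMap ∘ₗ ψ i, ?_⟩
  ext x
  conv_rhs => rw [← hb (h x)]
  have : ∀ i, ψ i (f x) = φ i (h x) := fun i => LinearMap.congr_fun (hψ i) x
  simp [this]

lemma eq_zero_of_dual {M : Type u} [AddCommGroup M] [Module Γᵐᵒᵖ M] (h : M →ₗ[Γᵐᵒᵖ] W.obj)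
    (H : ∀ φ : W.obj →ₗ[Γᵐᵒᵖ] Γ, φ ∘ₗ h = 0) : h = 0 := by
  obtain ⟨n, q, φ, hb⟩ := (regularBimodule Γ).exists_dualBasis (P := W.obj)
  ext x
  rw [← hb (h x)]
  refine Finset.sum_eq_zero fun i _ => ?_
  rw [show φ i (h x) = 0 from LinearMap.congr_fun (H (φ i)) x, map_zero, zero_smul]

/-- Kernels are tested on maps from Γ, that is on elements, and cokernels on maps to Γ, that is on
linear forms. A cokernel in `proj Γ` need not be surjective, and the cokernel condition is exactness
of the dual sequence. -/
lemma isKernelCokernelPair_iff (S : ShortComplex (ProjCat Γ)) :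
    IsKernelCokernelPair S ↔ (Function.Injective (lin S.f) ∧ Function.Exact (lin S.f) (lin S.g)) ∧
      Function.Injective (dualLin (lin S.g)) ∧
        Function.Exact (dualLin (lin S.g)) (dualLin (lin S.f)) := by
  have hz : ∀ x, lin S.g (lin S.f x) = 0 := fun x => LinearMap.congr_fun (congrArg lin S.zero) x
  refine and_congr ⟨?_, ?_⟩ ⟨?_, ?_⟩
  · rintro ⟨hl⟩
    have : Mono S.f := mono_of_isLimit_fork hl
    refine ⟨injective_of_mono S.f, fun y => ⟨fun hy => ?_, ?_⟩⟩
    · obtain ⟨l, hl⟩ := KernelFork.IsLimit.lift' hl (elemHom y)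
        (by rw [elemHom_comp, hy, elemHom_zero])
      refine ⟨lin l (1 : Γ), ?_⟩
      have : lin (l ≫ S.f) (1 : Γ) = lin (elemHom y) (1 : Γ) := congrArg (fun t => lin t (1 : Γ)) hl
      rwa [elemHom_one] at this
    · rintro ⟨x, rfl⟩
      exact hz x
  · rintro ⟨hi, he⟩
    have hm := mono_of_injective S.f hi
    have key : ∀ {W : ProjCat Γ} (k : W ⟶ S.X₂), k ≫ S.g = 0 → ∃ l : W ⟶ S.X₁, l ≫ S.f = k := by
      intro W k hk
      obtain ⟨φ, hφ⟩ := exists_comp_eq_of_range_le hi (lin k) (by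
        rintro _ ⟨x, rfl⟩
        exact (he _).1 (LinearMap.congr_fun (congrArg lin hk) x))
      exact ⟨projHom φ, proj_ext hφ⟩
    exact ⟨KernelFork.IsLimit.ofι _ _ (fun k hk => (key k hk).choose)
      (fun k hk => (key k hk).choose_spec)
      fun k hk m hm => by rw [← cancel_mono S.f, hm, (key k hk).choose_spec]⟩
  · rintro ⟨hl⟩
    have : Epi S.g := epi_of_isColimit_cofork hl
    refine ⟨?_, fun y => ⟨fun hy => ?_, ?_⟩⟩
    · rw [injective_iff_map_eq_zero]
      intro φ hφ
      have : (projHom φ : S.X₃ ⟶ regProj Γ) = 0 := by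
        rw [← cancel_epi S.g, comp_zero]
        exact proj_ext hφ
      exact congrArg lin this
    · obtain ⟨l, hl⟩ := CokernelCofork.IsColimit.desc' hl (projHom y : S.X₂ ⟶ regProj Γ)
        (proj_ext hy)
      exact ⟨lin l, congrArg lin hl⟩
    · rintro ⟨φ, rfl⟩
      ext x
      simp [hz]
  · rintro ⟨hi, he⟩
    have key : ∀ {W : ProjCat Γ} (k : S.X₂ ⟶ W), S.f ≫ k = 0 → ∃ l : S.X₃ ⟶ W, S.g ≫ l = k := by
      intro W k hk
      obtain ⟨t, ht⟩ := exists_extension_of_dual (lin S.g) (lin k) (fun φ => (he _).1 (by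
        change φ ∘ₗ lin (S.f ≫ k) = 0
        rw [hk, lin_zero, LinearMap.comp_zero]))
      exact ⟨projHom t, proj_ext ht⟩
    have hepi : ∀ {W : ProjCat Γ} (k : S.X₃ ⟶ W), S.g ≫ k = 0 → k = 0 := by
      intro W k hk
      refine proj_ext (eq_zero_of_dual _ fun φ => hi ?_)
      change φ ∘ₗ lin (S.g ≫ k) = _
      rw [hk, lin_zero, LinearMap.comp_zero, map_zero]
    exact ⟨CokernelCofork.IsColimit.ofπ _ _ (fun k hk => (key k hk).choose)
      (fun k hk => (key k hk).choose_spec)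
      fun k hk m hm => by
        rw [← sub_eq_zero]
        refine hepi _ ?_
        rw [Preadditive.comp_sub, hm, (key k hk).choose_spec, sub_self]⟩

end ProjLayer

/-! ### The exact structure given by a set of simple modules -/

section FiltQuotients

variable {A : Type u} [Ring A] {T : Set (ModClass A)} (hT : SimpleClasses T)
variable {X Y Z W : Type u} [AddCommGroup X] [Module A X] [AddCommGroup Y] [Module A Y]
  [AddCommGroup Z] [Module A Z] [AddCommGroup W] [Module A W]
include hT

lemma FiltBy.quot_of_le {N N' : Submodule A Z} (h : FiltBy T (Z ⧸ N)) (hN : N ≤ N') :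
    FiltBy T (Z ⧸ N') :=
  h.of_surjective hT (Submodule.factor hN) (Submodule.factor_surjective hN)

/-- The quotient by a preimage embeds in the original quotient. This gives stability of deflations
under pullback, and of inflations under pushout after dualizing. -/
lemma FiltBy.quot_of_comap {N : Submodule A Z} (h : FiltBy T (Z ⧸ N)) (f : W →ₗ[A] Z)
    {N' : Submodule A W} (hN : N.comap f = N') : FiltBy T (W ⧸ N') := by
  subst hN
  refine h.of_injective hT ((N.comap f).mapQ N f le_rfl) ?_
  rw [injective_iff_map_eq_zero]
  intro x hx
  obtain ⟨x, rfl⟩ := Submodule.Quotient.mk_surjective _ x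
  exact (Submodule.Quotient.mk_eq_zero _).2 ((Submodule.Quotient.mk_eq_zero N).1 hx : f x ∈ N)

/-- The cokernel of a composite is an extension of the cokernel of h by a quotient of the cokernel
of g. -/
lemma FiltBy.quot_comp {g : X →ₗ[A] Y} {h : Y →ₗ[A] Z} (h1 : FiltBy T (Y ⧸ LinearMap.range g))
    (h2 : FiltBy T (Z ⧸ LinearMap.range h)) : FiltBy T (Z ⧸ LinearMap.range (h ∘ₗ g)) := by
  have hle : LinearMap.range (h ∘ₗ g) ≤ LinearMap.range h := LinearMap.range_comp_le_range g h
  let q := Submodule.factor hle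
  refine .of_surjective_of_ker h2 q (Submodule.factor_surjective hle) ?_
  let t : (Y ⧸ LinearMap.range g) →ₗ[A] (Z ⧸ LinearMap.range (h ∘ₗ g)) :=
    Submodule.mapQ _ _ h (by rintro _ ⟨x, rfl⟩; exact ⟨x, rfl⟩)
  have ht : LinearMap.ker q = LinearMap.range t := by
    ext z
    constructor
    · intro hz
      obtain ⟨z, rfl⟩ := Submodule.Quotient.mk_surjective _ z
      obtain ⟨y, rfl⟩ := (Submodule.Quotient.mk_eq_zero (LinearMap.range h)).1 hz
      exact ⟨Submodule.Quotient.mk y, rfl⟩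
    · rintro ⟨y, rfl⟩
      obtain ⟨y, rfl⟩ := Submodule.Quotient.mk_surjective _ y
      exact (Submodule.Quotient.mk_eq_zero (LinearMap.range h)).2 ⟨y, rfl⟩
  rw [ht]
  exact h1.of_surjective hT t.rangeRestrict t.surjective_rangeRestrict

end FiltQuotients

/-! ### The axioms of an exact structure for complexes with filtered cokernel -/

section FiltExact

variable {Γ : Type u} [Ring Γ]

/-- The conflations of the exact structure given by `T`. -/
def FiltConflation (T : Set (ModClass Γᵐᵒᵖ)) (S : ShortComplex (ProjCat Γ)) : Prop :=
  Function.Injective (lin S.f) ∧ Function.Exact (lin S.f) (lin S.g) ∧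
    FiltBy T (S.X₃.obj ⧸ LinearMap.range (lin S.g))

lemma subsingleton_of_isZero {O : ProjCat Γ} (h : IsZero O) : Subsingleton O.obj :=
  subsingleton_of_forall_eq 0 fun x =>
    LinearMap.congr_fun (congrArg lin (h.eq_of_src (𝟙 O) 0)) x

variable {T : Set (ModClass Γᵐᵒᵖ)}

lemma FiltConflation.of_iso {S S' : ShortComplex (ProjCat Γ)} (e : S ≅ S')
    (h : FiltConflation T S) : FiltConflation T S' := by
  obtain ⟨h1, h2, h3⟩ := h
  let e1 : S.X₁.obj ≃ₗ[Γᵐᵒᵖ] S'.X₁.obj := linIso (ShortComplex.π₁.mapIso e)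
  let e2 : S.X₂.obj ≃ₗ[Γᵐᵒᵖ] S'.X₂.obj := linIso (ShortComplex.π₂.mapIso e)
  let e3 : S.X₃.obj ≃ₗ[Γᵐᵒᵖ] S'.X₃.obj := linIso (ShortComplex.π₃.mapIso e)
  have c1 : ∀ x, e2 (lin S.f x) = lin S'.f (e1 x) := fun x =>
    (LinearMap.congr_fun (congrArg lin e.hom.comm₁₂) x).symm
  have c2 : ∀ x, e3 (lin S.g x) = lin S'.g (e2 x) := fun x =>
    (LinearMap.congr_fun (congrArg lin e.hom.comm₂₃) x).symm
  refine ⟨?_, ?_, h3.equiv (Submodule.Quotient.equiv _ _ e3 ?_)⟩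
  · intro x y hxy
    obtain ⟨x, rfl⟩ := e1.surjective x
    obtain ⟨y, rfl⟩ := e1.surjective y
    rw [← c1, ← c1] at hxy
    rw [h1 (e2.injective hxy)]
  · intro y
    obtain ⟨y, rfl⟩ := e2.surjective y
    rw [← c2, map_eq_zero_iff _ e3.injective, h2 y]
    constructor
    · rintro ⟨x, rfl⟩
      exact ⟨e1 x, (c1 x).symm⟩
    · rintro ⟨x, hx⟩
      obtain ⟨x, rfl⟩ := e1.surjective x
      exact ⟨x, e2.injective ((c1 x).trans hx)⟩
  · ext z
    constructor
    · rintro ⟨_, ⟨y, rfl⟩, rfl⟩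
      exact ⟨e2 y, (c2 y).symm⟩
    · rintro ⟨y, rfl⟩
      obtain ⟨y, rfl⟩ := e2.surjective y
      exact ⟨_, ⟨y, rfl⟩, c2 y⟩

section

variable [IsNoetherianRing Γᵐᵒᵖ] (hT : IsTwoRegularClasses (A := Γᵐᵒᵖ) Γ Γ T)
include hT

lemma FiltConflation.isKernelCokernelPair {S : ShortComplex (ProjCat Γ)}
    (h : FiltConflation T S) : IsKernelCokernelPair S := by
  have hr := isLengthTwoResolution_mkQ h.1 h.2.1
  have hreg := hT.isExtRegular h.2.2
  exact (isKernelCokernelPair_iff S).2 ⟨⟨h.1, h.2.1⟩,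
    (hr.subsingleton_extBi_zero_iff Γ Γ).1 hreg.ext_zero,
    (hr.subsingleton_extBi_one_iff Γ Γ).1 hreg.ext_one⟩

/-- The module-theoretic kernel is projective because the cokernel has projective dimension at most
two. -/
lemma exists_filtConflation_of_filtBy {Y Z : ProjCat Γ} (g : Y ⟶ Z)
    (h : FiltBy T (Z.obj ⧸ LinearMap.range (lin g))) :
    ∃ (K : ProjCat Γ) (i : K ⟶ Y) (w : i ≫ g = 0), FiltConflation T (ShortComplex.mk i g w) := by
  have he : Function.Exact (LinearMap.ker (lin g)).subtype (lin g) := by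
    rw [LinearMap.exact_iff, Submodule.range_subtype]
  have hr := isLengthTwoResolution_mkQ (LinearMap.ker (lin g)).injective_subtype he
  have := hr.projective (hT.isExtRegular h).projDim
  exact ⟨projOf (LinearMap.ker (lin g)), projHom (LinearMap.ker (lin g)).subtype,
    proj_ext he.linearMap_comp_eq_zero, Submodule.injective_subtype _, he, h⟩

lemma exists_filtConflation_iff {Y Z : ProjCat Γ} (g : Y ⟶ Z) :
    (∃ (K : ProjCat Γ) (i : K ⟶ Y) (w : i ≫ g = 0), FiltConflation T (ShortComplex.mk i g w)) ↔
      FiltBy T (Z.obj ⧸ LinearMap.range (lin g)) :=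
  ⟨fun ⟨_, _, _, h⟩ => h.2.2, exists_filtConflation_of_filtBy hT g⟩

/-- Inflations are recognized from f* alone, so that the dual axioms become statements about
filtered left modules. -/
lemma exists_filtConflation_iff_dual [IsNoetherianRing Γ] {X Y : ProjCat Γ} (f : X ⟶ Y) :
    (∃ (K : ProjCat Γ) (p : Y ⟶ K) (w : f ≫ p = 0), FiltConflation T (ShortComplex.mk f p w)) ↔
      FiltBy (dualClasses Γ Γ T) ((X.obj →ₗ[Γᵐᵒᵖ] Γ) ⧸ LinearMap.range (dualLin (lin f))) := by
  constructor
  · rintro ⟨K, p, w, h⟩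
    exact hT.filtBy_dual h.1 h.2.1 h.2.2
  · intro h
    obtain ⟨Z, _, _, g, h1, h2, h3, h4, h5⟩ := hT.exists_of_filtBy_dual (regularBimodule Γ) _ h
    exact ⟨projOf Z, projHom g, proj_ext h4.linearMap_comp_eq_zero, h3, h4, h5⟩

/-- The fibre product is the kernel of (g, -h), whose cokernel is a quotient of that of g, so the
kernel is projective. The image of k is the preimage under h of the image of g, so the cokernel of k
embeds in that of g. -/
lemma exists_pullback {Y Z W : ProjCat Γ} (g : Y ⟶ Z) (h : W ⟶ Z)
    (hg : FiltBy T (Z.obj ⧸ LinearMap.range (lin g))) :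
    ∃ (E : ProjCat Γ) (l : E ⟶ Y) (k : E ⟶ W), IsPullback l k g h ∧
      FiltBy T (W.obj ⧸ LinearMap.range (lin k)) := by
  let d : (Y.obj × W.obj) →ₗ[Γᵐᵒᵖ] Z.obj := (lin g).coprod (-lin h)
  have hd : FiltBy T (Z.obj ⧸ LinearMap.range d) := by
    refine hg.quot_of_le hT.simpleClasses ?_
    rintro _ ⟨y, rfl⟩
    exact ⟨(y, 0), by simp [d]⟩
  obtain ⟨E, i, w, hi, he, -⟩ := exists_filtConflation_of_filtBy hT
    (projHom d : projOf (Y.obj × W.obj) ⟶ Z) hd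
  let l : E ⟶ Y := projHom (LinearMap.fst _ _ _ ∘ₗ lin i)
  let k : E ⟶ W := projHom (LinearMap.snd _ _ _ ∘ₗ lin i)
  have hli : ∀ e : E.obj, (lin i) e = (lin l e, lin k e) := fun e => rfl
  have hmem : ∀ y w, lin g y = lin h w ↔ ∃ e, lin l e = y ∧ lin k e = w := by
    intro y w
    have h1 : lin g y = lin h w ↔ d (y, w) = 0 := by simp [d, ← sub_eq_add_neg, sub_eq_zero]
    rw [h1]
    refine (he (y, w)).trans (exists_congr fun e => ?_)
    exact Prod.ext_iff
  have hinj : ∀ a b, lin l a = lin l b → lin k a = lin k b → a = b := fun a b h1 h2 =>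
    hi (Prod.ext h1 h2)
  have comm : l ≫ g = k ≫ h := proj_ext (LinearMap.ext fun e => (hmem _ _).2 ⟨e, rfl, rfl⟩)
  refine ⟨E, l, k, ⟨⟨comm⟩, ⟨?_⟩⟩, ?_⟩
  · have key : ∀ {U : ProjCat Γ} (a : U ⟶ Y) (b : U ⟶ W), a ≫ g = b ≫ h →
        ∃ t : U ⟶ E, t ≫ l = a ∧ t ≫ k = b := by
      intro U a b hab
      obtain ⟨t, ht⟩ := exists_comp_eq_of_range_le hi ((lin a).prod (lin b)) (by
        rintro _ ⟨u, rfl⟩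
        obtain ⟨e, h1, h2⟩ := (hmem _ _).1 (LinearMap.congr_fun (congrArg lin hab) u)
        exact ⟨e, Prod.ext h1 h2⟩)
      refine ⟨projHom t, proj_ext ?_, proj_ext ?_⟩
      · exact congrArg (fun s => LinearMap.fst _ _ _ ∘ₗ s) ht
      · exact congrArg (fun s => LinearMap.snd _ _ _ ∘ₗ s) ht
    refine PullbackCone.IsLimit.mk _ (fun s => (key s.fst s.snd s.condition).choose)
      (fun s => (key s.fst s.snd s.condition).choose_spec.1)
      (fun s => (key s.fst s.snd s.condition).choose_spec.2) fun s m h1 h2 => ?_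
    refine proj_ext (LinearMap.ext fun u => hinj _ _ ?_ ?_)
    · exact LinearMap.congr_fun (congrArg lin
        (h1.trans (key s.fst s.snd s.condition).choose_spec.1.symm)) u
    · exact LinearMap.congr_fun (congrArg lin
        (h2.trans (key s.fst s.snd s.condition).choose_spec.2.symm)) u
  · refine hg.quot_of_comap hT.simpleClasses (lin h) ?_
    ext w
    constructor
    · rintro ⟨y, hy⟩
      obtain ⟨e, -, rfl⟩ := (hmem y w).1 hy
      exact ⟨e, rfl⟩
    · rintro ⟨e, rfl⟩
      exact ⟨lin l e, (hmem _ _).2 ⟨e, rfl, rfl⟩⟩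

/-- The pushout is the cokernel in `proj Γ` of (f, -h), which is an inflation since the image of its
dual contains that of f*. The image of k* is the preimage under h* of the image of f*, because
Hom(-, Γ) turns the pushout into a fibre product. -/
lemma exists_pushout [IsNoetherianRing Γ] {X Y W : ProjCat Γ} (f : X ⟶ Y) (h : X ⟶ W)
    (hf : FiltBy (dualClasses Γ Γ T) ((X.obj →ₗ[Γᵐᵒᵖ] Γ) ⧸ LinearMap.range (dualLin (lin f)))) :
    ∃ (E : ProjCat Γ) (l : Y ⟶ E) (k : W ⟶ E), IsPushout f h l k ∧
      FiltBy (dualClasses Γ Γ T)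
        ((W.obj →ₗ[Γᵐᵒᵖ] Γ) ⧸ LinearMap.range (dualLin (lin k))) := by
  let a : X.obj →ₗ[Γᵐᵒᵖ] (Y.obj × W.obj) := (lin f).prod (-lin h)
  have ha : FiltBy (dualClasses Γ Γ T)
      ((X.obj →ₗ[Γᵐᵒᵖ] Γ) ⧸ LinearMap.range (dualLin a)) := by
    refine hf.quot_of_le hT.simpleClasses_dual ?_
    rintro _ ⟨φ, rfl⟩
    exact ⟨φ ∘ₗ LinearMap.fst _ _ _, by ext; rfl⟩
  obtain ⟨E, p, w, hc⟩ := (exists_filtConflation_iff_dual hT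
    (projHom a : X ⟶ projOf (Y.obj × W.obj))).2 ha
  have hz : ∀ x, lin p (lin f x, - lin h x) = 0 := fun x =>
    LinearMap.congr_fun (congrArg lin w) x
  obtain ⟨-, -, hde⟩ := (isKernelCokernelPair_iff _).1 (hc.isKernelCokernelPair hT)
  obtain ⟨-, ⟨hcol⟩⟩ := hc.isKernelCokernelPair hT
  have : Epi p := epi_of_isColimit_cofork hcol
  let l : Y ⟶ E := projHom (lin p ∘ₗ LinearMap.inl _ _ _)
  let k : W ⟶ E := projHom (lin p ∘ₗ LinearMap.inr _ _ _)
  have hp : ∀ y w, lin p (y, w) = lin l y + lin k w := by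
    intro y w
    change _ = lin p (y, 0) + lin p (0, w)
    rw [← map_add]
    simp
  have comm : f ≫ l = h ≫ k := proj_ext (LinearMap.ext fun x => by
    have := hz x
    rw [hp, map_neg, ← sub_eq_add_neg, sub_eq_zero] at this
    exact this)
  refine ⟨E, l, k, ⟨⟨comm⟩, ⟨?_⟩⟩, ?_⟩
  · have key : ∀ {U : ProjCat Γ} (b : Y ⟶ U) (c : W ⟶ U), f ≫ b = h ≫ c →
        ∃ t : E ⟶ U, l ≫ t = b ∧ k ≫ t = c := by
      intro U b c hbc
      obtain ⟨t, ht⟩ := CokernelCofork.IsColimit.desc' hcol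
        (projHom ((lin b).coprod (lin c)) : projOf (Y.obj × W.obj) ⟶ U) (proj_ext (by
          ext x
          have := LinearMap.congr_fun (congrArg lin hbc) x
          change lin b (lin f x) + lin c (-lin h x) = 0
          rw [map_neg, ← sub_eq_add_neg, sub_eq_zero]
          exact this))
      have ht := congrArg lin ht
      refine ⟨t, proj_ext ?_, proj_ext ?_⟩
      · ext y
        exact (LinearMap.congr_fun ht (y, 0)).trans
          ((LinearMap.coprod_apply _ _ _).trans (by simp))
      · ext y
        exact (LinearMap.congr_fun ht (0, y)).trans
          ((LinearMap.coprod_apply _ _ _).trans (by simp))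
    refine PushoutCocone.IsColimit.mk _ (fun s => (key s.inl s.inr s.condition).choose)
      (fun s => (key s.inl s.inr s.condition).choose_spec.1)
      (fun s => (key s.inl s.inr s.condition).choose_spec.2) fun s m h1 h2 => ?_
    rw [← cancel_epi p]
    have e1 := h1.trans (key s.inl s.inr s.condition).choose_spec.1.symm
    have e2 := h2.trans (key s.inl s.inr s.condition).choose_spec.2.symm
    refine proj_ext (LinearMap.ext fun ⟨y, w⟩ => ?_)
    rw [lin_comp_apply, lin_comp_apply, hp, map_add, map_add]
    exact congrArg₂ (· + ·) (LinearMap.congr_fun (congrArg lin e1) y)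
      (LinearMap.congr_fun (congrArg lin e2) w)
  · refine hf.quot_of_comap hT.simpleClasses_dual (dualLin (lin h)) ?_
    ext ψ
    constructor
    · rintro ⟨φ, hφ⟩
      obtain ⟨ξ, hξ⟩ := (hde (φ.coprod ψ)).1 (by
        ext x
        have := LinearMap.congr_fun hφ x
        change φ (lin f x) + ψ (-lin h x) = 0
        rw [map_neg, ← sub_eq_add_neg, sub_eq_zero]
        exact this)
      refine ⟨ξ, ?_⟩
      ext w
      exact (LinearMap.congr_fun hξ (0, w)).trans ((LinearMap.coprod_apply _ _ _).trans (by simp))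
    · rintro ⟨ξ, rfl⟩
      refine ⟨ξ ∘ₗ lin l, ?_⟩
      ext x
      exact congrArg ξ (LinearMap.congr_fun (congrArg lin comm) x)

/-- The exact structure on `proj Γ` given by a set of simple modules satisfying the 2-regular
condition. -/
def filtExactStructure [IsNoetherianRing Γ] : ExactStructure (ProjCat Γ) where
  conflation := FiltConflation T
  isKernelCokernelPair _ h := h.isKernelCokernelPair hT
  of_iso _ _ e h := h.of_iso e
  ex0 O X hO := by
    have := subsingleton_of_isZero hO
    refine ⟨Function.injective_of_subsingleton _, fun y => ⟨fun hy => ⟨0, ?_⟩, ?_⟩, ?_⟩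
    · exact (map_zero _).trans (Eq.symm hy)
    · rintro ⟨x, rfl⟩
      rfl
    · have : Subsingleton (X.obj ⧸ LinearMap.range (lin (𝟙 X))) := by
        refine subsingleton_of_forall_eq 0 fun x => ?_
        obtain ⟨x, rfl⟩ := Submodule.Quotient.mk_surjective _ x
        exact (Submodule.Quotient.mk_eq_zero _).2 ⟨x, rfl⟩
      exact .of_subsingleton
  ex0_op O X hO := by
    have := subsingleton_of_isZero hO
    refine ⟨fun _ _ h => h, fun y => ⟨fun _ => ⟨y, rfl⟩, fun _ => rfl⟩, ?_⟩
    have : Subsingleton (O.obj ⧸ LinearMap.range (lin (0 : X ⟶ O))) :=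
      (Submodule.mkQ_surjective _).subsingleton
    exact .of_subsingleton
  ex1 g h := by
    simp only [exists_filtConflation_iff hT]
    exact fun h1 h2 => FiltBy.quot_comp hT.simpleClasses (g := lin g) (h := lin h) h1 h2
  ex1_op g h := by
    simp only [exists_filtConflation_iff_dual hT]
    -- Dualizing reverses composition, so the two hypotheses are swapped.
    exact fun h1 h2 => FiltBy.quot_comp hT.simpleClasses_dual (g := dualLin (lin h))
      (h := dualLin (lin g)) h2 h1
  ex2 g h := by
    simp only [exists_filtConflation_iff hT]
    exact exists_pullback hT g h
  ex2_op f h := by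
    simp only [exists_filtConflation_iff_dual hT]
    exact exists_pushout hT f h

end

end FiltExact

/-! ### The cokernels of the deflations of an exact structure -/

section Deflations

variable {Γ : Type u} [Ring Γ] (F : ExactStructure (ProjCat Γ))

/-- `M` is isomorphic to the cokernel of a deflation. -/
def IsCokerOfDeflation (M : Type u) [AddCommGroup M] [Module Γᵐᵒᵖ M] : Prop :=
  ∃ (Y Z : ProjCat Γ) (g : Y ⟶ Z), F.IsDeflation g ∧
    Nonempty ((Z.obj ⧸ LinearMap.range (lin g)) ≃ₗ[Γᵐᵒᵖ] M)

/-- Elements are maps from Γ, so a pullback in `proj Γ` is a fibre product on elements. -/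
lemma exists_of_isPullback {E Y Z W : ProjCat Γ} {l : E ⟶ Y} {k : E ⟶ W} {g : Y ⟶ Z} {h : W ⟶ Z}
    (hp : IsPullback l k g h) {y : Y.obj} {w : W.obj} (hyw : lin g y = lin h w) :
    ∃ e, lin l e = y ∧ lin k e = w := by
  have hc : elemHom y ≫ g = elemHom w ≫ h := by rw [elemHom_comp, elemHom_comp, hyw]
  refine ⟨lin (hp.lift _ _ hc) (1 : Γ), ?_, ?_⟩
  · rw [← lin_comp_apply, hp.lift_fst, elemHom_one]
  · rw [← lin_comp_apply, hp.lift_snd, elemHom_one]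

lemma comm_apply {E Y Z W : ProjCat Γ} {l : E ⟶ Y} {k : E ⟶ W} {g : Y ⟶ Z} {h : W ⟶ Z}
    (hc : l ≫ g = k ≫ h) (e : E.obj) : lin g (lin l e) = lin h (lin k e) :=
  LinearMap.congr_fun (congrArg lin hc) e

variable {F}
variable {M N : Type u} [AddCommGroup M] [Module Γᵐᵒᵖ M] [AddCommGroup N] [Module Γᵐᵒᵖ N]

lemma isCokerOfDeflation_of_ker {E Z : ProjCat Γ} {k : E ⟶ Z} (hk : F.IsDeflation k)
    (p : Z.obj →ₗ[Γᵐᵒᵖ] M) (hp : Function.Surjective p)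
    (h : LinearMap.range (lin k) = LinearMap.ker p) : IsCokerOfDeflation F M :=
  ⟨E, Z, k, hk, ⟨(Submodule.quotEquivOfEq _ _ h).trans (p.quotKerEquivOfSurjective hp)⟩⟩

namespace IsCokerOfDeflation

/-- Independence of the presentation: lift p to a map into the target of the given deflation and
pull the deflation back. The map p need not be surjective, which yields closure under submodules. -/
lemma exists_range_eq_ker (hM : IsCokerOfDeflation F M) (Z : ProjCat Γ)
    (p : Z.obj →ₗ[Γᵐᵒᵖ] M) :
    ∃ (E : ProjCat Γ) (k : E ⟶ Z), F.IsDeflation k ∧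
      LinearMap.range (lin k) = LinearMap.ker p := by
  obtain ⟨Y, Z', g, hg, ⟨e⟩⟩ := hM
  obtain ⟨h, hh⟩ := Module.projective_lifting_property
    (e.toLinearMap ∘ₗ (LinearMap.range (lin g)).mkQ) p
    (e.surjective.comp (Submodule.mkQ_surjective _))
  obtain ⟨E, l, k, hp, hk⟩ := F.ex2 g (projHom h) hg
  refine ⟨E, k, hk, ?_⟩
  have hmem : ∀ z, p z = 0 ↔ h z ∈ LinearMap.range (lin g) := by
    intro z
    rw [← hh, LinearMap.comp_apply, LinearMap.comp_apply, LinearEquiv.coe_coe,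
      map_eq_zero_iff _ e.injective, Submodule.mkQ_apply, Submodule.Quotient.mk_eq_zero]
  ext z
  rw [LinearMap.mem_ker, hmem]
  constructor
  · rintro ⟨x, rfl⟩
    exact ⟨lin l x, comm_apply hp.w x⟩
  · rintro ⟨y, hy⟩
    obtain ⟨x, -, hx⟩ := exists_of_isPullback hp hy
    exact ⟨x, hx⟩

lemma finite (hM : IsCokerOfDeflation F M) : Module.Finite Γᵐᵒᵖ M := by
  obtain ⟨Y, Z, g, -, ⟨e⟩⟩ := hM
  exact Module.Finite.equiv e

lemma equiv (hM : IsCokerOfDeflation F M) (e : M ≃ₗ[Γᵐᵒᵖ] N) : IsCokerOfDeflation F N := by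
  obtain ⟨Y, Z, g, hg, ⟨e'⟩⟩ := hM
  exact ⟨Y, Z, g, hg, ⟨e'.trans e⟩⟩

lemma submodule [IsNoetherianRing Γᵐᵒᵖ] (hM : IsCokerOfDeflation F M) (N : Submodule Γᵐᵒᵖ M) :
    IsCokerOfDeflation F N := by
  have := hM.finite
  obtain ⟨n, π, hπ⟩ := Module.Finite.exists_fin' Γᵐᵒᵖ N
  obtain ⟨E, k, hk, hr⟩ := hM.exists_range_eq_ker (projOf (Fin n → Γᵐᵒᵖ)) (N.subtype ∘ₗ π)
  rw [LinearMap.ker_comp_of_ker_eq_bot _ N.ker_subtype] at hr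
  exact isCokerOfDeflation_of_ker hk π hπ hr

end IsCokerOfDeflation

variable (Γ) in
/-- A zero object of `proj Γ`. -/
abbrev zeroProj : ProjCat Γ := projOf PUnit

lemma isZero_zeroProj : IsZero (zeroProj Γ) where
  unique_to Y := ⟨⟨⟨0⟩, fun f => proj_ext (LinearMap.ext fun x => by
    rw [Subsingleton.elim x 0, map_zero, map_zero])⟩⟩
  unique_from Y := ⟨⟨⟨0⟩, fun f => proj_ext (LinearMap.ext fun x => Subsingleton.elim _ _)⟩⟩

/-- Enlarging the image of a deflation gives closure of the cokernels under quotients. -/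
lemma exists_deflation_range_sup {Y Z W : ProjCat Γ} {g : Y ⟶ Z} (hg : F.IsDeflation g)
    (h : W ⟶ Z) : ∃ (E : ProjCat Γ) (k : E ⟶ Z), F.IsDeflation k ∧
      LinearMap.range (lin k) = LinearMap.range (lin g) ⊔ LinearMap.range (lin h) := by
  -- E is the product W × Z, realized as a pullback over zero, so that its projection k to Z is a
  -- deflation.
  obtain ⟨E, l, k, hp, hk⟩ := F.ex2 (0 : W ⟶ zeroProj Γ) (0 : Z ⟶ zeroProj Γ)
    ⟨W, 𝟙 W, comp_zero, F.ex0_op _ _ isZero_zeroProj⟩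
  -- E' consists of the triples (y, w, z) with g y = z - h w, so its composite deflation to Z has
  -- values g y + h w.
  obtain ⟨E', l', k', hp', hk'⟩ := F.ex2 g (k - l ≫ h) hg
  refine ⟨E', k' ≫ k, F.ex1 k' k hk' hk, ?_⟩
  ext z
  rw [Submodule.mem_sup]
  constructor
  · rintro ⟨e, rfl⟩
    refine ⟨_, ⟨lin l' e, rfl⟩, _, ⟨lin l (lin k' e), rfl⟩, ?_⟩
    rw [comm_apply hp'.w e, lin_sub, LinearMap.sub_apply, lin_comp_apply, lin_comp_apply,
      sub_add_cancel]
  · rintro ⟨_, ⟨y, rfl⟩, _, ⟨x, rfl⟩, rfl⟩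
    obtain ⟨e, he, hz⟩ := exists_of_isPullback hp (y := x) (w := lin g y + lin h x) rfl
    obtain ⟨e', -, rfl⟩ := exists_of_isPullback hp' (y := y) (w := e) (by
      rw [lin_sub, LinearMap.sub_apply, lin_comp_apply, he, hz, add_sub_cancel_right])
    exact ⟨e', hz⟩

namespace IsCokerOfDeflation

lemma of_surjective [IsNoetherianRing Γᵐᵒᵖ] (hM : IsCokerOfDeflation F M) (q : M →ₗ[Γᵐᵒᵖ] N)
    (hq : Function.Surjective q) : IsCokerOfDeflation F N := by
  obtain ⟨Y, Z, g, hg, ⟨e⟩⟩ := hM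
  let p : Z.obj →ₗ[Γᵐᵒᵖ] N := q ∘ₗ e.toLinearMap ∘ₗ (LinearMap.range (lin g)).mkQ
  have hp : Function.Surjective p :=
    hq.comp (e.surjective.comp (Submodule.mkQ_surjective _))
  obtain ⟨n, π, hπ⟩ := Module.Finite.exists_fin' Γᵐᵒᵖ (LinearMap.ker p)
  obtain ⟨E, k, hk, hr⟩ := exists_deflation_range_sup hg
    (projHom ((LinearMap.ker p).subtype ∘ₗ π) : projOf (Fin n → Γᵐᵒᵖ) ⟶ Z)
  refine isCokerOfDeflation_of_ker hk p hp ?_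
  rw [hr, lin_projHom, LinearMap.range_comp_of_range_eq_top _ (LinearMap.range_eq_top.2 hπ),
    Submodule.range_subtype, sup_eq_right]
  rintro _ ⟨y, rfl⟩
  have : (Submodule.Quotient.mk (lin g y) : Z.obj ⧸ LinearMap.range (lin g)) = 0 :=
    (Submodule.Quotient.mk_eq_zero _).2 ⟨y, rfl⟩
  change q (e (Submodule.Quotient.mk (lin g y))) = 0
  rw [this, map_zero, map_zero]

/-- Compose two deflations: k has image the preimage of N in a free cover of M, and k' has image the
kernel of the induced map to N. The composite has image the kernel of the cover. -/
lemma of_ext [IsNoetherianRing Γᵐᵒᵖ] (N : Submodule Γᵐᵒᵖ M) (h1 : IsCokerOfDeflation F N)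
    (h2 : IsCokerOfDeflation F (M ⧸ N)) : IsCokerOfDeflation F M := by
  have := h1.finite
  have := h2.finite
  have : Module.Finite Γᵐᵒᵖ M := Module.Finite.of_submodule_quotient N
  obtain ⟨n, π, hπ⟩ := Module.Finite.exists_fin' Γᵐᵒᵖ M
  obtain ⟨E, k, hk, hr⟩ := h2.exists_range_eq_ker (projOf (Fin n → Γᵐᵒᵖ)) (N.mkQ ∘ₗ π)
  have hmem : ∀ x, π x ∈ N ↔ ∃ e, lin k e = x := by
    intro x
    have := SetLike.ext_iff.1 hr x
    rw [LinearMap.mem_ker, LinearMap.comp_apply, Submodule.mkQ_apply,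
      Submodule.Quotient.mk_eq_zero] at this
    exact this.symm
  obtain ⟨E', k', hk', hr'⟩ := h1.exists_range_eq_ker E
    ((π ∘ₗ lin k).codRestrict N fun e => (hmem _).2 ⟨e, rfl⟩)
  refine isCokerOfDeflation_of_ker (F.ex1 k' k hk' hk) π hπ ?_
  rw [LinearMap.ker_codRestrict] at hr'
  ext x
  constructor
  · rintro ⟨e, rfl⟩
    have : lin k' e ∈ LinearMap.ker (π ∘ₗ lin k) := by rw [← hr']; exact ⟨e, rfl⟩
    exact this
  · intro hx
    obtain ⟨e, rfl⟩ := (hmem x).1 (by rw [LinearMap.mem_ker.1 hx]; exact N.zero_mem)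
    have : e ∈ LinearMap.range (lin k') := by rw [hr']; exact hx
    obtain ⟨e', rfl⟩ := this
    exact ⟨e', rfl⟩

lemma of_subsingleton [Subsingleton M] : IsCokerOfDeflation F M :=
  isCokerOfDeflation_of_ker (k := 𝟙 (zeroProj Γ)) ⟨_, _, _, F.ex0 _ _ isZero_zeroProj⟩ 0
    (Function.surjective_to_subsingleton _) (by
      rw [LinearMap.ker_zero]
      exact LinearMap.range_id)

end IsCokerOfDeflation

/-- Pushing out a conflation along a morphism from its first term. -/
lemma exists_conflation_pushout {K E Z X : ProjCat Γ} {i : K ⟶ E} {k : E ⟶ Z} {w : i ≫ k = 0}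
    (h : F.conflation (ShortComplex.mk i k w)) (a : K ⟶ X) :
    ∃ (E' : ProjCat Γ) (j : X ⟶ E') (t : E ⟶ E') (c : E' ⟶ Z) (w' : j ≫ c = 0),
      F.conflation (ShortComplex.mk j c w') ∧ t ≫ c = k ∧ IsPushout i a t j := by
  obtain ⟨E', t, j, hp, Z', p, wp, hc⟩ := F.ex2_op i a ⟨Z, k, w, h⟩
  obtain ⟨-, ⟨hk⟩⟩ := F.isKernelCokernelPair _ h
  obtain ⟨-, ⟨hpc⟩⟩ := F.isKernelCokernelPair _ hc
  have : Epi k := epi_of_isColimit_cofork hk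
  have : Epi p := epi_of_isColimit_cofork hpc
  -- The cokernel p of j supplied by the axiom is replaced by c, which ends in Z itself; α and β are
  -- the inverse comparisons.
  let c : E' ⟶ Z := hp.desc k 0 (by rw [w, comp_zero])
  have htc : t ≫ c = k := hp.inl_desc _ _ _
  have hjc : j ≫ c = 0 := hp.inr_desc _ _ _
  obtain ⟨α, hα⟩ := CokernelCofork.IsColimit.desc' hpc c hjc
  obtain ⟨β, hβ⟩ := CokernelCofork.IsColimit.desc' hk (t ≫ p) (by
    change i ≫ t ≫ p = 0
    rw [reassoc_of% hp.w, wp, comp_zero])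
  replace hα : p ≫ α = c := hα
  replace hβ : k ≫ β = t ≫ p := hβ
  have hcβ : c ≫ β = p := by
    refine hp.hom_ext ?_ ?_
    · rw [reassoc_of% htc, hβ]
    · rw [reassoc_of% hjc, zero_comp, wp]
  let e : Z' ≅ Z := ⟨α, β, by rw [← cancel_epi p, reassoc_of% hα, hcβ, Category.comp_id],
    by rw [← cancel_epi k, reassoc_of% hβ, hα, htc, Category.comp_id]⟩
  refine ⟨E', j, t, c, hjc, F.of_iso (ShortComplex.mk j p wp) (ShortComplex.mk j c hjc)
    (ShortComplex.isoMk (Iso.refl X) (Iso.refl E') e ?_ ?_) hc,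
    htc, hp⟩
  · exact (Category.id_comp j).trans (Category.comp_id j).symm
  · change 𝟙 _ ≫ c = p ≫ α
    rw [hα, Category.id_comp]

lemma conflation_exact {X Y Z : ProjCat Γ} {f : X ⟶ Y} {g : Y ⟶ Z} {w : f ≫ g = 0}
    (h : F.conflation (ShortComplex.mk f g w)) :
    Function.Injective (lin f) ∧ Function.Exact (lin f) (lin g) :=
  ((isKernelCokernelPair_iff _).1 (F.isKernelCokernelPair _ h)).1

lemma conflation_dual_exact {X Y Z : ProjCat Γ} {f : X ⟶ Y} {g : Y ⟶ Z} {w : f ≫ g = 0}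
    (h : F.conflation (ShortComplex.mk f g w)) :
    Function.Injective (dualLin (lin g)) ∧ Function.Exact (dualLin (lin g)) (dualLin (lin f)) :=
  ((isKernelCokernelPair_iff _).1 (F.isKernelCokernelPair _ h)).2

lemma exists_lift_of_range_le {Y Z W : ProjCat Γ} (g : Y ⟶ Z) (h : W ⟶ Z)
    (hr : LinearMap.range (lin h) ≤ LinearMap.range (lin g)) : ∃ t : W ⟶ Y, t ≫ g = h := by
  obtain ⟨t, ht⟩ := exists_comp_eq_of_projective (lin h) hr
  exact ⟨projHom t, proj_ext ht⟩

lemma exists_lift_of_comp_eq_zero {X Y Z W : ProjCat Γ} {f : X ⟶ Y} {g : Y ⟶ Z}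
    (he : Function.Exact (lin f) (lin g)) (h : W ⟶ Y)
    (hw : h ≫ g = 0) : ∃ t : W ⟶ X, t ≫ f = h := by
  refine exists_lift_of_range_le f h ?_
  rintro _ ⟨x, rfl⟩
  exact (he _).1 (LinearMap.congr_fun (congrArg lin hw) x)

/-- A left exact sequence whose last map has the same image as a deflation is a conflation. -/
lemma conflation_of_range_eq {X Y Z E : ProjCat Γ} {f : X ⟶ Y} {g : Y ⟶ Z} (w : f ≫ g = 0)
    (hf : Function.Injective (lin f)) (he : Function.Exact (lin f) (lin g)) {k : E ⟶ Z}
    (hk : F.IsDeflation k) (hr : LinearMap.range (lin k) = LinearMap.range (lin g)) :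
    F.conflation (ShortComplex.mk f g w) := by
  obtain ⟨K, i, wi, hc⟩ := hk
  -- Projectivity of E lifts k through g, which induces a on kernels. Pushing out along a gives a
  -- conflation from X to Z, and d compares it with the given sequence.
  obtain ⟨s, hs⟩ := exists_lift_of_range_le g k hr.le
  obtain ⟨a, ha⟩ := exists_lift_of_comp_eq_zero he (i ≫ s) (by rw [Category.assoc, hs, wi])
  obtain ⟨E', j, t, c, wc, hc', htc, hp⟩ := exists_conflation_pushout hc a
  let d : E' ⟶ Y := hp.desc s f ha.symm
  have hd1 : t ≫ d = s := hp.inl_desc _ _ _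
  have hd2 : j ≫ d = f := hp.inr_desc _ _ _
  have hdg : d ≫ g = c := by
    refine hp.hom_ext ?_ ?_
    · rw [reassoc_of% hd1, hs, htc]
    · rw [reassoc_of% hd2, w, wc]
  obtain ⟨hj, hjc⟩ := conflation_exact hc'
  have c1 : ∀ e, lin g (lin d e) = lin c e := fun e => LinearMap.congr_fun (congrArg lin hdg) e
  have c2 : ∀ x, lin d (lin j x) = lin f x := fun e => LinearMap.congr_fun (congrArg lin hd2) e
  -- A five-lemma chase; for surjectivity, every value of g is a value of k by the equality of
  -- images.
  have hb : Function.Bijective (lin d) := by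
    constructor
    · rw [injective_iff_map_eq_zero]
      intro e hde
      obtain ⟨x, rfl⟩ := (hjc e).1 (by rw [← c1, hde, map_zero])
      rw [c2] at hde
      rw [hf (hde.trans (map_zero _).symm), map_zero]
    · intro y
      obtain ⟨e, he'⟩ : lin g y ∈ LinearMap.range (lin k) := by rw [hr]; exact ⟨y, rfl⟩
      have h0 : lin g (y - lin d (lin t e)) = 0 := by
        rw [map_sub, c1, ← lin_comp_apply, htc, he', sub_self]
      obtain ⟨x, hx⟩ := (he _).1 h0
      refine ⟨lin t e + lin j x, ?_⟩
      rw [map_add, c2, hx, add_sub_cancel]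
  let e2 : E' ≅ Y := projIso (LinearEquiv.ofBijective (lin d) hb)
  refine F.of_iso (ShortComplex.mk j c wc) (ShortComplex.mk f g w)
    (ShortComplex.isoMk (Iso.refl X) e2 (Iso.refl Z) ?_ ?_) hc'
  · change 𝟙 _ ≫ f = j ≫ d
    rw [hd2, Category.id_comp]
  · change d ≫ g = c ≫ 𝟙 _
    rw [hdg, Category.comp_id]

/-- The exact structure can be read off from the cokernels of its deflations; this is what makes the
correspondence injective. -/
lemma conflation_iff_isCokerOfDeflation (S : ShortComplex (ProjCat Γ)) :
    F.conflation S ↔ Function.Injective (lin S.f) ∧ Function.Exact (lin S.f) (lin S.g) ∧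
      IsCokerOfDeflation F (S.X₃.obj ⧸ LinearMap.range (lin S.g)) := by
  constructor
  · intro h
    obtain ⟨h1, h2⟩ := conflation_exact (F := F) (w := S.zero) h
    exact ⟨h1, h2, _, _, S.g, ⟨_, S.f, S.zero, h⟩, ⟨LinearEquiv.refl _ _⟩⟩
  · rintro ⟨h1, h2, h3⟩
    obtain ⟨E, k, hk, hr⟩ := h3.exists_range_eq_ker S.X₃ (LinearMap.range (lin S.g)).mkQ
    rw [Submodule.ker_mkQ] at hr
    exact conflation_of_range_eq S.zero h1 h2 hk hr

end Deflations

/-! ### Simple cokernels of deflations satisfy the 2-regular condition -/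

section SimpleCokernels

variable {Γ : Type u} [Ring Γ] {F : ExactStructure (ProjCat Γ)}

lemma IsCokerOfDeflation.exists_resolution {M : Type u} [AddCommGroup M] [Module Γᵐᵒᵖ M]
    (hM : IsCokerOfDeflation F M) :
    ∃ (X Y Z : ProjCat Γ) (f : X ⟶ Y) (g : Y ⟶ Z) (w : f ≫ g = 0) (p : Z.obj →ₗ[Γᵐᵒᵖ] M),
      F.conflation (ShortComplex.mk f g w) ∧ IsLengthTwoResolution (lin f) (lin g) p := by
  obtain ⟨Y, Z, g, ⟨X, f, w, hc⟩, ⟨e⟩⟩ := hM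
  obtain ⟨h1, h2⟩ := conflation_exact hc
  refine ⟨X, Y, Z, f, g, w, e.toLinearMap ∘ₗ (LinearMap.range (lin g)).mkQ, hc, h1, h2, ?_,
    e.surjective.comp (Submodule.mkQ_surjective _)⟩
  rw [LinearMap.exact_iff, LinearMap.ker_comp_of_ker_eq_bot _ e.ker, Submodule.ker_mkQ]

variable {X Y Z : ProjCat Γ} {f : X ⟶ Y} {g : Y ⟶ Z} {w : f ≫ g = 0}

/-- If every linear form on the first term of a conflation extends, then the deflation is
surjective. -/
lemma surjective_of_dual_surjective (hc : F.conflation (ShortComplex.mk f g w))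
    (h : Function.Surjective (dualLin (lin f))) : Function.Surjective (lin g) := by
  -- Extending the identity of X gives a retraction of f, so the conflation splits.
  obtain ⟨r, hr⟩ := exists_extension_of_dual (W := X) (lin f) LinearMap.id fun φ => h _
  obtain ⟨-, ⟨hcol⟩⟩ := F.isKernelCokernelPair _ hc
  have : Epi g := epi_of_isColimit_cofork hcol
  have hr' : f ≫ projHom r = 𝟙 X := proj_ext hr
  obtain ⟨m, hm⟩ := CokernelCofork.IsColimit.desc' hcol (𝟙 Y - projHom r ≫ f) (by
    change f ≫ _ = 0
    rw [Preadditive.comp_sub, reassoc_of% hr', Category.comp_id, sub_self])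
  replace hm : g ≫ m = 𝟙 Y - projHom r ≫ f := hm
  have hmg : m ≫ g = 𝟙 Z := by
    rw [← cancel_epi g, reassoc_of% hm, Preadditive.sub_comp, Category.assoc, w, comp_zero,
      sub_zero, Category.comp_id, Category.id_comp]
  exact fun z => ⟨lin m z, LinearMap.congr_fun (congrArg lin hmg) z⟩

/-- If the pushout of a conflation has a surjective deflation, then the map along which it was
pushed out extends. -/
lemma exists_extension_of_surjective {W E : ProjCat Γ} {x : X ⟶ W} {j : W ⟶ E} {c : E ⟶ Z}
    {wc : j ≫ c = 0} (hc : F.conflation (ShortComplex.mk j c wc)) {t : Y ⟶ E}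
    (hp : f ≫ t = x ≫ j) (hs : Function.Surjective (lin c)) : ∃ r : Y ⟶ W, f ≫ r = x := by
  obtain ⟨s, hs⟩ := exists_lift_of_range_le c (𝟙 Z) (by
    rw [LinearMap.range_eq_top.2 hs]; exact le_top)
  obtain ⟨h1, h2⟩ := conflation_exact hc
  have := mono_of_injective j h1
  obtain ⟨r, hr⟩ := exists_lift_of_comp_eq_zero h2 (𝟙 E - c ≫ s) (by
    rw [Preadditive.sub_comp, Category.assoc, hs, Category.comp_id, Category.id_comp, sub_self])
  have hjr : j ≫ r = 𝟙 W := by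
    rw [← cancel_mono j, Category.assoc, hr, Preadditive.comp_sub, reassoc_of% wc, zero_comp,
      sub_zero, Category.comp_id, Category.id_comp]
  exact ⟨t ≫ r, by rw [reassoc_of% hp, hjr, Category.comp_id]⟩

lemma range_le_of_comp_eq {A B C : ProjCat Γ} {a : A ⟶ B} {b : B ⟶ C} {c : A ⟶ C}
    (h : a ≫ b = c) : LinearMap.range (lin c) ≤ LinearMap.range (lin b) := by
  subst h
  rintro _ ⟨x, rfl⟩
  exact ⟨lin a x, rfl⟩

lemma isCoatom_range {S : Type u} [AddCommGroup S] [Module Γᵐᵒᵖ S] [IsSimpleModule Γᵐᵒᵖ S]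
    {p : Z.obj →ₗ[Γᵐᵒᵖ] S} (hr : IsLengthTwoResolution (lin f) (lin g) p) :
    IsCoatom (LinearMap.range (lin g)) := by
  rw [← isSimpleModule_iff_isCoatom]
  exact IsSimpleModule.congr hr.quotEquiv

/-- The quotient is nonzero because a split conflation would have zero cokernel. It is simple
because each form x outside im f* generates it: the pushout along x still has the maximal submodule
im g as image, so it maps back to the original conflation. -/
lemma isSimpleModule_dual_quotient {S : Type u} [AddCommGroup S] [Module Γᵐᵒᵖ S]
    [IsSimpleModule Γᵐᵒᵖ S] {p : Z.obj →ₗ[Γᵐᵒᵖ] S} (hc : F.conflation (ShortComplex.mk f g w))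
    (hr : IsLengthTwoResolution (lin f) (lin g) p) :
    IsSimpleModule Γ ((X.obj →ₗ[Γᵐᵒᵖ] Γ) ⧸ LinearMap.range (dualLin (lin f))) := by
  have hco := isCoatom_range hr
  rw [isSimpleModule_iff_toSpanSingleton_surjective]
  constructor
  · rw [Submodule.Quotient.nontrivial_iff]
    intro htop
    exact hco.1 (LinearMap.range_eq_top.2
      (surjective_of_dual_surjective hc (LinearMap.range_eq_top.1 htop)))
  · intro x hx y
    obtain ⟨x, rfl⟩ := Submodule.Quotient.mk_surjective _ x
    obtain ⟨y, rfl⟩ := Submodule.Quotient.mk_surjective _ y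
    have hx : x ∉ LinearMap.range (dualLin (lin f)) := fun h =>
      hx ((Submodule.Quotient.mk_eq_zero _).2 h)
    obtain ⟨E, j, t, c, wc, hc', htc, hp⟩ :=
      exists_conflation_pushout hc (projHom x : X ⟶ regProj Γ)
    have hns : ¬ Function.Surjective (lin c) := by
      intro hs
      obtain ⟨r, hr⟩ := exists_extension_of_surjective hc' hp.w hs
      exact hx ⟨lin r, congrArg lin hr⟩
    -- The image of c contains the maximal submodule im g and is not everything.
    have hle : LinearMap.range (lin c) ≤ LinearMap.range (lin g) := by
      rcases hco.le_iff.1 (range_le_of_comp_eq htc) with h | h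
      · exact (hns (LinearMap.range_eq_top.1 h)).elim
      · exact h.le
    obtain ⟨u, hu⟩ := exists_lift_of_range_le g c hle
    obtain ⟨v, hv⟩ := exists_lift_of_comp_eq_zero hr.exact₁ (j ≫ u)
      (by rw [Category.assoc, hu, wc])
    obtain ⟨r, hr'⟩ := exists_lift_of_comp_eq_zero hr.exact₁ (t ≫ u - 𝟙 Y)
      (by rw [Preadditive.sub_comp, Category.assoc, hu, htc, Category.id_comp, sub_self])
    have := mono_of_injective f hr.injective
    -- Going to the pushout along x and back induces x ≫ v on X; the induced map on Z is the
    -- identity, so x ≫ v is homotopic to the identity.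
    have key : (projHom x : X ⟶ regProj Γ) ≫ v - 𝟙 X = f ≫ r := by
      rw [← cancel_mono f, Preadditive.sub_comp, Category.assoc, hv, Category.assoc, hr',
        Preadditive.comp_sub, Category.id_comp, Category.comp_id, reassoc_of% hp.w]
    -- Composing the homotopy with y shows that y agrees modulo im f* with z ↦ y (v (x z)) = y (v 1)
    -- * x z.
    refine ⟨y (lin v (1 : Γ)), ?_⟩
    rw [LinearMap.toSpanSingleton_apply, ← Submodule.Quotient.mk_smul, Submodule.Quotient.eq]
    refine ⟨y ∘ₗ lin r, ?_⟩
    ext z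
    have h1 : lin v (x z) - z = lin r (lin f z) := LinearMap.congr_fun (congrArg lin key) z
    have h2 : lin v (x z) = MulOpposite.op (x z) • lin v (1 : Γ) := by
      rw [← map_smul]
      congr 1
      exact (one_mul (x z)).symm
    change y (lin r (lin f z)) = y (lin v (1 : Γ)) * x z - y z
    rw [← h1, map_sub, h2, map_smul]
    rfl

end SimpleCokernels

/-! ### The 2-regular condition in terms of resolutions -/

section TwoRegular

variable {Γ : Type u} [Ring Γ]

/-- An upper bound on the projective dimension is enough, since Ext² is simple, hence nonzero. -/
lemma isTwoRegularSimple_iff (S : RightMod Γ) :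
    IsTwoRegularSimple S ↔ IsSimpleModule Γᵐᵒᵖ S ∧
      HasProjectiveDimensionLT (ModuleCat.of Γᵐᵒᵖ S) 3 ∧
      Subsingleton (ExtBi Γᵐᵒᵖ Γ Γ S 0) ∧ Subsingleton (ExtBi Γᵐᵒᵖ Γ Γ S 1) ∧
        IsSimpleModule Γ (ExtBi Γᵐᵒᵖ Γ Γ S 2) := by
  constructor
  · rintro ⟨h1, h2, h3, h4, h5⟩
    exact ⟨h1, (projectiveDimension_le_iff S 2).1 h2.le, h3, h4,
      IsSimpleModule.congr (extBiToRing S 2)⟩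
  · rintro ⟨h1, h2, h3, h4, h5⟩
    refine ⟨h1, le_antisymm ((projectiveDimension_le_iff S 2).2 h2)
      ((projectiveDimension_ge_iff S 2).2 fun h => ?_), h3, h4,
      IsSimpleModule.congr (extBiToRing S 2).symm⟩
    have := IsSimpleModule.nontrivial Γ (ExtBi Γᵐᵒᵖ Γ Γ S 2)
    exact not_subsingleton (ExtBi Γᵐᵒᵖ Γ Γ S 2)
      (HasProjectiveDimensionLT.subsingleton S 2 2 le_rfl _)

lemma IsTwoRegularSimple.of_equiv {S S' : RightMod Γ} (e : S ≃ₗ[Γᵐᵒᵖ] S')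
    (h : IsTwoRegularSimple S) : IsTwoRegularSimple S' := by
  rw [isTwoRegularSimple_iff] at h ⊢
  obtain ⟨h1, h2, h3, h4, h5⟩ := h
  exact ⟨IsSimpleModule.congr e.symm, hasProjectiveDimensionLT_of_iso e.toModuleIso 3,
    (extBiCongr Γ Γ e 0).symm.toEquiv.subsingleton, (extBiCongr Γ Γ e 1).symm.toEquiv.subsingleton,
    IsSimpleModule.congr (extBiCongr Γ Γ e 2).symm⟩

lemma TwoRegularSet.isTwoRegularSimple (T : TwoRegularSet Γ) {S : RightMod Γ}
    (hS : isoClass S ∈ T.1) : IsTwoRegularSimple S := by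
  obtain ⟨S', h, hS'⟩ := T.2 _ hS
  obtain ⟨e⟩ := Quotient.exact hS'
  exact h.of_equiv e.toLinearEquiv

lemma TwoRegularSet.isTwoRegularClasses (T : TwoRegularSet Γ) :
    IsTwoRegularClasses (A := Γᵐᵒᵖ) Γ Γ T.1 := fun S _ _ hS =>
  (isTwoRegularSimple_iff (ModuleCat.of Γᵐᵒᵖ S)).1 (T.isTwoRegularSimple hS)

lemma IsCokerOfDeflation.isTwoRegularSimple {F : ExactStructure (ProjCat Γ)} {S : RightMod Γ}
    [hS : IsSimpleModule Γᵐᵒᵖ S] (h : IsCokerOfDeflation F S) : IsTwoRegularSimple S := by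
  obtain ⟨X, Y, Z, f, g, w, p, hc, hr⟩ := h.exists_resolution
  obtain ⟨h1, h2⟩ := conflation_dual_exact hc
  have := isSimpleModule_dual_quotient hc hr
  rw [isTwoRegularSimple_iff]
  exact ⟨hS, hr.hasProjectiveDimensionLT, (hr.subsingleton_extBi_zero_iff Γ Γ).2 h1,
    (hr.subsingleton_extBi_one_iff Γ Γ).2 h2, IsSimpleModule.congr (hr.extBiTwoEquiv Γ Γ).symm⟩

end TwoRegular

/-! ### Finite length of cokernel functors -/

section CokernelFunctor

open Opposite

variable {Γ : Type u} [Ring Γ] {Y Z : ProjCat Γ} (g : Y ⟶ Z)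

/-- The cokernel functor of a morphism. -/
noncomputable abbrev cokerFunctor : (ProjCat Γ)ᵒᵖ ⥤ AddCommGrpCat.{u} :=
  cokernel (preadditiveYoneda.map g)

/-- The class of a morphism in the cokernel functor. -/
noncomputable def cokerClass {P : ProjCat Γ} : (P ⟶ Z) →+ (cokerFunctor g).obj (op P) :=
  ((cokernel.π (preadditiveYoneda.map g)).app (op P)).hom

lemma cokerClass_surjective (P : ProjCat Γ) :
    Function.Surjective (cokerClass g (P := P)) := by
  have : Epi ((cokernel.π (preadditiveYoneda.map g)).app (op P)) :=
    (NatTrans.epi_iff_epi_app _).1 inferInstance _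
  exact (AddCommGrpCat.epi_iff_surjective _).1 this

lemma cokerClass_eq_zero_iff {P : ProjCat Γ} (a : P ⟶ Z) :
    cokerClass g a = 0 ↔ ∃ b : P ⟶ Y, b ≫ g = a := by
  have h : (ShortComplex.mk _ _ (cokernel.condition (preadditiveYoneda.map g))).Exact :=
    ShortComplex.exact_cokernel _
  have h' := h.map ((evaluation _ _).obj (op P))
  rw [ShortComplex.ab_exact_iff_function_exact] at h'
  exact h' a

lemma cokerClass_comp {P Q : ProjCat Γ} (b : P ⟶ Q) (a : Q ⟶ Z) :
    cokerClass g (b ≫ a) = (cokerFunctor g).map b.op (cokerClass g a) :=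
  ConcreteCategory.congr_hom ((cokernel.π (preadditiveYoneda.map g)).naturality b.op) a

/-- The values of a subobject of the cokernel functor. -/
noncomputable abbrev arrowRange (U : Subobject (cokerFunctor g)) (P : ProjCat Γ) :
    AddSubgroup ((cokerFunctor g).obj (op P)) :=
  (U.arrow.app (op P)).hom.range

/-- The submodule of the target given by a subobject of the cokernel functor. -/
noncomputable def subobjectSubmodule (U : Subobject (cokerFunctor g)) :
    Submodule Γᵐᵒᵖ Z.obj where
  carrier := {z | cokerClass g (elemHom z) ∈ arrowRange g U (regProj Γ)}
  zero_mem' := by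
    change cokerClass g (elemHom 0) ∈ arrowRange g U (regProj Γ)
    rw [elemHom_zero, map_zero]
    exact zero_mem _
  add_mem' {a b} ha hb := by
    have : elemHom (a + b) = elemHom a + elemHom b :=
      proj_ext (LinearMap.ext fun c => smul_add (MulOpposite.op (c : Γ)) a b)
    change cokerClass g (elemHom (a + b)) ∈ arrowRange g U (regProj Γ)
    rw [this, map_add]
    exact add_mem ha hb
  smul_mem' c z hz := by
    obtain ⟨x, hx⟩ := hz
    have : elemHom (c • z) = elemHom (X := regProj Γ) (MulOpposite.unop c) ≫ elemHom z := by
      rw [elemHom_comp]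
      rfl
    refine ⟨(U : (ProjCat Γ)ᵒᵖ ⥤ AddCommGrpCat.{u}).map
      (elemHom (X := regProj Γ) (MulOpposite.unop c)).op x, ?_⟩
    rw [this, cokerClass_comp, ← hx]
    exact ConcreteCategory.congr_hom
      (U.arrow.naturality (elemHom (X := regProj Γ) (MulOpposite.unop c)).op) x

/-- A dual basis writes a as a sum of maps through Γ, so a subfunctor is determined by its value at
Γ, that is by a submodule of Z. -/
lemma mem_range_arrow_iff (U : Subobject (cokerFunctor g)) {P : ProjCat Γ} (a : P ⟶ Z) :
    cokerClass g a ∈ (U.arrow.app (op P)).hom.range ↔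
      LinearMap.range (lin a) ≤ subobjectSubmodule g U := by
  have hnat : ∀ {P Q : ProjCat Γ} (b : P ⟶ Q) (a : Q ⟶ Z),
      cokerClass g a ∈ (U.arrow.app (op Q)).hom.range →
        cokerClass g (b ≫ a) ∈ (U.arrow.app (op P)).hom.range := by
    rintro P Q b a ⟨x, hx⟩
    refine ⟨(U : (ProjCat Γ)ᵒᵖ ⥤ AddCommGrpCat.{u}).map b.op x, ?_⟩
    rw [cokerClass_comp, ← hx]
    exact ConcreteCategory.congr_hom (U.arrow.naturality b.op) x
  constructor
  · rintro h _ ⟨p, rfl⟩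
    change cokerClass g (elemHom (lin a p)) ∈ arrowRange g U (regProj Γ)
    rw [← elemHom_comp]
    exact hnat _ _ h
  · intro h
    obtain ⟨n, q, φ, hb⟩ := (regularBimodule Γ).exists_dualBasis (P := P.obj)
    have ha : a = ∑ i, (projHom (φ i) : P ⟶ regProj Γ) ≫ elemHom (lin a (q i)) := by
      refine proj_ext (LinearMap.ext fun x => ?_)
      conv_lhs => rw [← hb x, map_sum]
      have hsum : ∀ s : Finset (Fin n),
          lin (∑ i ∈ s, (projHom (φ i) : P ⟶ regProj Γ) ≫ elemHom (lin a (q i))) x =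
            ∑ i ∈ s, MulOpposite.op (φ i x) • lin a (q i) := by
        intro s
        classical
        induction s using Finset.induction_on with
        | empty => rfl
        | insert i s hi ih => rw [Finset.sum_insert hi, Finset.sum_insert hi, ← ih]; rfl
      rw [hsum]
      exact Finset.sum_congr rfl fun i _ => map_smul _ _ _
    rw [ha, map_sum]
    exact sum_mem fun i _ => hnat _ _ (h ⟨q i, rfl⟩)

lemma le_of_subobjectSubmodule_le {U V : Subobject (cokerFunctor g)}
    (h : subobjectSubmodule g U ≤ subobjectSubmodule g V) : U ≤ V := by
  have h0 : U.arrow ≫ cokernel.π V.arrow = 0 := by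
    ext ⟨P⟩ x
    obtain ⟨a, ha⟩ := cokerClass_surjective g P ((U.arrow.app (op P)).hom x)
    obtain ⟨y, hy⟩ : cokerClass g a ∈ (V.arrow.app (op P)).hom.range :=
      (mem_range_arrow_iff g V a).2 (((mem_range_arrow_iff g U a).1 ⟨x, ha.symm⟩).trans h)
    have hc := ConcreteCategory.congr_hom
      (congrArg (fun t => t.app (op P)) (cokernel.condition V.arrow)) y
    change (cokernel.π V.arrow).app (op P) ((U.arrow.app (op P)).hom x) = 0
    rw [← ha, ← hy]
    exact hc
  exact Subobject.le_of_comm (Abelian.monoLift V.arrow U.arrow h0) (Abelian.monoLift_comp _ _ _)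

lemma subobjectSubmodule_mono {U V : Subobject (cokerFunctor g)} (h : U ≤ V) :
    subobjectSubmodule g U ≤ subobjectSubmodule g V := by
  rintro z ⟨x, hx⟩
  refine ⟨(Subobject.ofLE U V h).app _ x, ?_⟩
  rw [← hx]
  exact ConcreteCategory.congr_hom
    (congrArg (fun t => t.app (op (regProj Γ))) (Subobject.ofLE_arrow h)) x

lemma range_le_subobjectSubmodule (U : Subobject (cokerFunctor g)) :
    LinearMap.range (lin g) ≤ subobjectSubmodule g U := by
  rw [← mem_range_arrow_iff, (cokerClass_eq_zero_iff g g).2 ⟨𝟙 _, Category.id_comp _⟩]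
  exact zero_mem _

lemma map_mkQ_le_iff {M : Type u} [AddCommGroup M] [Module Γᵐᵒᵖ M] {K N N' : Submodule Γᵐᵒᵖ M}
    (hN' : K ≤ N') : N.map K.mkQ ≤ N'.map K.mkQ ↔ N ≤ N' := by
  rw [Submodule.map_le_iff_le_comap, Submodule.comap_map_eq, Submodule.ker_mkQ,
    sup_eq_left.2 hN']

lemma strictMono_subobjectSubmodule :
    StrictMono fun U : Subobject (cokerFunctor g) =>
      (subobjectSubmodule g U).map (LinearMap.range (lin g)).mkQ := by
  intro U V h
  refine lt_of_le_not_ge (Submodule.map_mono (subobjectSubmodule_mono g h.le)) fun h' => ?_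
  rw [map_mkQ_le_iff (range_le_subobjectSubmodule g U)] at h'
  exact h.not_ge (le_of_subobjectSubmodule_le g h')

variable [IsNoetherianRing Γᵐᵒᵖ]

lemma exists_range_eq (N : Submodule Γᵐᵒᵖ Z.obj) :
    ∃ (W : ProjCat Γ) (h : W ⟶ Z), LinearMap.range (lin h) = N := by
  obtain ⟨n, π, hπ⟩ := Module.Finite.exists_fin' Γᵐᵒᵖ N
  refine ⟨projOf (Fin n → Γᵐᵒᵖ), projHom (N.subtype ∘ₗ π), ?_⟩
  rw [lin_projHom, LinearMap.range_comp_of_range_eq_top _ (LinearMap.range_eq_top.2 hπ),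
    Submodule.range_subtype]

/-- The subobject of the cokernel functor given by a submodule. -/
noncomputable def submoduleSubobject (N : Submodule Γᵐᵒᵖ Z.obj) : Subobject (cokerFunctor g) :=
  imageSubobject (preadditiveYoneda.map (exists_range_eq N).choose_spec.choose ≫
    cokernel.π (preadditiveYoneda.map g))

/-- The subobject attached to N is the image of a map from a representable functor whose module
image is N; evaluating at Γ returns N modulo the image of g, which N contains. -/
lemma subobjectSubmodule_submoduleSubobject {N : Submodule Γᵐᵒᵖ Z.obj}
    (hN : LinearMap.range (lin g) ≤ N) :
    subobjectSubmodule g (submoduleSubobject g N) = N := by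
  set W := (exists_range_eq N).choose with hW
  set h : W ⟶ Z := (exists_range_eq N).choose_spec.choose with hh
  have hr : LinearMap.range (lin h) = N := (exists_range_eq N).choose_spec.choose_spec
  have hf := imageSubobject_arrow_comp (preadditiveYoneda.map h ≫
    cokernel.π (preadditiveYoneda.map g))
  have hf' : ∀ {P : ProjCat Γ} (b : P ⟶ W),
      (submoduleSubobject g N).arrow.app (op P) ((factorThruImageSubobject
        (preadditiveYoneda.map h ≫ cokernel.π (preadditiveYoneda.map g))).app (op P) b) =
        cokerClass g (b ≫ h) := fun {P} b =>
    congrArg (fun t : preadditiveYoneda.obj W ⟶ cokerFunctor g => (t.app (op P)).hom b) hf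
  refine le_antisymm ?_ ?_
  · rintro z ⟨x, hx⟩
    have : Epi ((factorThruImageSubobject (preadditiveYoneda.map h ≫
        cokernel.π (preadditiveYoneda.map g))).app (op (regProj Γ))) :=
      (NatTrans.epi_iff_epi_app _).1 inferInstance _
    obtain ⟨b, rfl⟩ := (AddCommGrpCat.epi_iff_surjective _).1 this x
    have h0 : cokerClass g (elemHom z - b ≫ h) = 0 := by
      rw [map_sub, ← hx, sub_eq_zero]
      exact hf' b
    obtain ⟨c, hc⟩ := (cokerClass_eq_zero_iff g _).1 h0
    have hz := LinearMap.congr_fun (congrArg lin hc) (1 : Γ)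
    rw [lin_sub, LinearMap.sub_apply, elemHom_one] at hz
    have hz' : z = lin g (lin c (1 : Γ)) + lin h (lin b (1 : Γ)) := by
      rw [← sub_eq_iff_eq_add]; exact hz.symm
    rw [hz']
    exact add_mem (hN ⟨_, rfl⟩) (hr.le ⟨_, rfl⟩)
  · refine hr.ge.trans ((mem_range_arrow_iff g _ h).1 ?_)
    exact ⟨_, (hf' (𝟙 W)).trans (by rw [Category.id_comp])⟩

lemma strictMono_submoduleSubobject :
    StrictMono fun N : Submodule Γᵐᵒᵖ (Z.obj ⧸ LinearMap.range (lin g)) =>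
      submoduleSubobject g (N.comap (LinearMap.range (lin g)).mkQ) := by
  have hN : ∀ N : Submodule Γᵐᵒᵖ (Z.obj ⧸ LinearMap.range (lin g)),
      LinearMap.range (lin g) ≤ N.comap (LinearMap.range (lin g)).mkQ := fun N =>
    (LinearMap.range (lin g)).le_comap_mkQ N
  have hle : ∀ N N' : Submodule Γᵐᵒᵖ (Z.obj ⧸ LinearMap.range (lin g)),
      submoduleSubobject g (N.comap (LinearMap.range (lin g)).mkQ) ≤
        submoduleSubobject g (N'.comap (LinearMap.range (lin g)).mkQ) ↔ N ≤ N' := by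
    intro N N'
    rw [← Submodule.comap_le_comap_iff_of_surjective (Submodule.mkQ_surjective
      (LinearMap.range (lin g)))]
    constructor
    · intro h
      have := subobjectSubmodule_mono g h
      rwa [subobjectSubmodule_submoduleSubobject g (hN N),
        subobjectSubmodule_submoduleSubobject g (hN N')] at this
    · intro h
      refine le_of_subobjectSubmodule_le g ?_
      rwa [subobjectSubmodule_submoduleSubobject g (hN N),
        subobjectSubmodule_submoduleSubobject g (hN N')]
  intro N N' h
  exact lt_of_le_not_ge ((hle _ _).2 h.le) fun h' => h.not_ge ((hle _ _).1 h')

/-- Strictly monotone maps in both directions between the two lattices transfer the chain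
conditions. The module is noetherian anyway, being finitely generated. -/
lemma cokerFunctor_finiteLength_iff :
    (IsNoetherianObject (cokerFunctor g) ∧ IsArtinianObject (cokerFunctor g)) ↔
      IsFiniteLength Γᵐᵒᵖ (Z.obj ⧸ LinearMap.range (lin g)) := by
  rw [isFiniteLength_iff_isNoetherian_isArtinian]
  constructor
  · rintro ⟨h1, h2⟩
    have : WellFoundedLT (Submodule Γᵐᵒᵖ (Z.obj ⧸ LinearMap.range (lin g))) :=
      (strictMono_submoduleSubobject g).wellFoundedLT
    exact ⟨inferInstance, this⟩
  · rintro ⟨h1, h2⟩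
    have h1 : WellFoundedGT (Submodule Γᵐᵒᵖ (Z.obj ⧸ LinearMap.range (lin g))) := inferInstance
    have h2 : WellFoundedLT (Submodule Γᵐᵒᵖ (Z.obj ⧸ LinearMap.range (lin g))) := h2
    exact ⟨⟨(strictMono_subobjectSubmodule g).wellFoundedGT⟩,
      ⟨(strictMono_subobjectSubmodule g).wellFoundedLT⟩⟩

end CokernelFunctor

/-! ### Admissible exact structures and sets of 2-regular simple modules -/

section Correspondence

variable {Γ : Type u} [Ring Γ] [IsNoetherianRing Γᵐᵒᵖ]

/-- The classes of simple modules which are cokernels of deflations. -/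
def simpleCokers (F : ExactStructure (ProjCat Γ)) : TwoRegularSet Γ where
  val := {c | ∃ S : RightMod Γ, IsSimpleModule Γᵐᵒᵖ S ∧ IsCokerOfDeflation F S ∧ isoClass S = c}
  property := by
    rintro c ⟨S, hS, h, rfl⟩
    exact ⟨S, h.isTwoRegularSimple, rfl⟩

lemma mem_simpleCokers_iff (F : ExactStructure (ProjCat Γ)) (S : RightMod Γ)
    [hS : IsSimpleModule Γᵐᵒᵖ S] : isoClass S ∈ (simpleCokers F).1 ↔ IsCokerOfDeflation F S := by
  refine ⟨fun ⟨S', h1, h2, h3⟩ => ?_, fun h => ⟨S, hS, h, rfl⟩⟩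
  obtain ⟨e⟩ := Quotient.exact h3
  exact h2.equiv e.toLinearEquiv

/-- Closure of the cokernels of deflations under extensions, applied along the filtration. -/
lemma isCokerOfDeflation_of_filtBy (F : ExactStructure (ProjCat Γ)) {M : Type u} [AddCommGroup M]
    [Module Γᵐᵒᵖ M] (h : FiltBy (simpleCokers F).1 M) : IsCokerOfDeflation F M := by
  induction h with
  | of_subsingleton => exact .of_subsingleton
  | of_quotient N _ hN ih =>
    have := (simpleCokers F).isTwoRegularClasses.simpleClasses _ hN
    exact .of_ext N ih ((mem_simpleCokers_iff F (ModuleCat.of Γᵐᵒᵖ _)).1 hN)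

/-- Closure under submodules and quotients puts each composition factor among the simple cokernels.
-/
lemma filtBy_of_isCokerOfDeflation (F : ExactStructure (ProjCat Γ)) {M : Type u} [AddCommGroup M]
    [Module Γᵐᵒᵖ M] (hM : IsFiniteLength Γᵐᵒᵖ M) (h : IsCokerOfDeflation F M) :
    FiltBy (simpleCokers F).1 M := by
  induction hM with
  | of_subsingleton => exact .of_subsingleton
  | @of_simple_quotient M _ _ N _ _ ih =>
    exact .of_quotient N (ih (h.submodule N)) ((mem_simpleCokers_iff F (ModuleCat.of Γᵐᵒᵖ _)).2
      (h.of_surjective N.mkQ N.mkQ_surjective))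

lemma isFiniteLength_of_isCokerOfDeflation {F : ExactStructure (ProjCat Γ)} (hF : F.IsAdmissible)
    {M : Type u} [AddCommGroup M] [Module Γᵐᵒᵖ M] (h : IsCokerOfDeflation F M) :
    IsFiniteLength Γᵐᵒᵖ M := by
  obtain ⟨Y, Z, g, hg, ⟨e⟩⟩ := h
  exact e.isFiniteLength ((cokerFunctor_finiteLength_iff g).1 (hF g hg))

variable [IsNoetherianRing Γ]

/-- The admissible exact structure given by a set of 2-regular simple modules. -/
def admissibleOfTwoRegularSet (T : TwoRegularSet Γ) : AdmissibleExactStructure Γ where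
  val := filtExactStructure T.isTwoRegularClasses
  property := by
    rintro Y Z g ⟨X, f, w, h⟩
    exact (cokerFunctor_finiteLength_iff g).2
      (h.2.2.isFiniteLength T.isTwoRegularClasses.simpleClasses)

lemma filtConflation_iff {F : ExactStructure (ProjCat Γ)} (hF : F.IsAdmissible)
    (S : ShortComplex (ProjCat Γ)) : FiltConflation (simpleCokers F).1 S ↔ F.conflation S := by
  rw [conflation_iff_isCokerOfDeflation]
  exact and_congr_right fun _ => and_congr_right fun _ =>
    ⟨isCokerOfDeflation_of_filtBy F, fun h =>
      filtBy_of_isCokerOfDeflation F (isFiniteLength_of_isCokerOfDeflation hF h) h⟩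

lemma isCokerOfDeflation_of_mem (T : TwoRegularSet Γ) {S : RightMod Γ} (hS : isoClass S ∈ T.1) :
    IsCokerOfDeflation (admissibleOfTwoRegularSet T).1 S := by
  have h := (isTwoRegularSimple_iff S).1 (T.isTwoRegularSimple hS)
  have := h.1
  obtain ⟨n, m, X, g, p, hX, hr⟩ := exists_isLengthTwoResolution h.2.1
  have e := hr.quotEquiv
  have hfilt : FiltBy T.1 ((Fin m → Γᵐᵒᵖ) ⧸ LinearMap.range g) :=
    (FiltBy.of_mem (M := S) hS).equiv e.symm
  obtain ⟨K, i, w, hK⟩ := exists_filtConflation_of_filtBy T.isTwoRegularClasses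
    (projHom (X := projOf (Fin n → Γᵐᵒᵖ)) (Y := projOf (Fin m → Γᵐᵒᵖ)) g) hfilt
  exact ⟨_, _, _, ⟨K, i, w, hK⟩, ⟨e⟩⟩

/-- Admissible exact structures correspond to sets of 2-regular simple modules. -/
def admissibleEquiv : AdmissibleExactStructure Γ ≃ TwoRegularSet Γ where
  toFun F := simpleCokers F.1
  invFun := admissibleOfTwoRegularSet
  left_inv F := Subtype.ext (ExactStructure.ext
    (funext fun S => propext (filtConflation_iff F.2 S)))
  right_inv T := by
    refine Subtype.ext (Set.ext fun c => ?_)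
    constructor
    · rintro ⟨S, hS, ⟨Y, Z, g, ⟨X, f, w, h⟩, ⟨e⟩⟩, rfl⟩
      exact (h.2.2.equiv e).mem_of_isSimpleModule T.isTwoRegularClasses.simpleClasses
    · intro hc
      obtain ⟨S, hS, rfl⟩ := T.2 c hc
      have := hS.isSimple
      exact (mem_simpleCokers_iff _ S).2 (isCokerOfDeflation_of_mem T hc)

lemma admissibleEquiv_symm_conflation_iff (T : TwoRegularSet Γ) (S : ShortComplex (ProjCat Γ)) :
    (admissibleEquiv.symm T).1.conflation S ↔
      ∃ (M : RightMod Γ) (p : S.X₃.obj →ₗ[Γᵐᵒᵖ] M), IsResolutionOf S M p ∧ IsFilt T.1 M := by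
  have hT := T.isTwoRegularClasses.simpleClasses
  constructor
  · rintro ⟨h1, h2, h3⟩
    have hr := isLengthTwoResolution_mkQ h1 h2
    exact ⟨ModuleCat.of Γᵐᵒᵖ _, (LinearMap.range (lin S.g)).mkQ, ⟨h1, h2, hr.exact₂, hr.surjective⟩,
      (isFilt_iff hT _).2 h3⟩
  · rintro ⟨M, p, ⟨h1, h2, h3, h4⟩, hM⟩
    have hr : IsLengthTwoResolution (lin S.f) (lin S.g) p := ⟨h1, h2, h3, h4⟩
    exact ⟨h1, h2, ((isFilt_iff hT M).1 hM).equiv hr.quotEquiv.symm⟩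

end Correspondence

/-! ### Finite algebras over complete local rings -/

section CompleteLocal

open IsLocalRing

variable {R : Type v} [CommRing R]

/-- The completion of a finite module is a quotient of M tensored with the completion of R, which is
R. -/
lemma isPrecomplete_of_finite (I : Ideal R) [IsAdicComplete I R] (M : Type w) [AddCommGroup M]
    [Module R M] [Module.Finite R M] : IsPrecomplete I M := by
  rw [← AdicCompletion.of_surjective_iff]
  intro y
  obtain ⟨t, rfl⟩ := AdicCompletion.ofTensorProduct_surjective_of_finite I M y
  induction t with
  | zero => exact ⟨0, by simp⟩
  | add a b ha hb =>
    obtain ⟨a', ha⟩ := ha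
    obtain ⟨b', hb⟩ := hb
    exact ⟨a' + b', by rw [map_add, map_add, ha, hb]⟩
  | tmul r m =>
    obtain ⟨r', rfl⟩ := (AdicCompletion.of_bijective_iff.2 ‹IsAdicComplete I R›).2 r
    refine ⟨r' • m, ?_⟩
    rw [AdicCompletion.ofTensorProduct_tmul, map_smul]
    rfl

/-- The powers of (x) stabilize. The equation makes x ^ (n + 1) * y idempotent; the positive
exponent ensures that x is a unit when this idempotent is 1. -/
lemma exists_isIdempotentElem_eq_pow_mul {A : Type w} [CommRing A] [IsArtinianRing A] (x : A) :
    ∃ (n : ℕ) (y : A), x ^ (n + 1) * (x ^ (n + 1) * y) = x ^ (n + 1) := by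
  obtain ⟨n, hn⟩ := IsArtinian.monotone_stabilizes (R := A) (M := A)
    ⟨fun n => OrderDual.toDual (Ideal.span {x ^ n}), fun a b h => by
      exact Ideal.span_singleton_le_span_singleton.2 (pow_dvd_pow x h)⟩
  have h : Ideal.span {x ^ (n + 1)} = Ideal.span {x ^ (n + 1 + (n + 1))} :=
    (hn (n + 1) n.le_succ).symm.trans (hn (n + 1 + (n + 1)) (by omega))
  obtain ⟨y, hy⟩ := Ideal.span_singleton_le_span_singleton.1 h.le
  exact ⟨n, y, by rw [← mul_assoc, ← pow_add, ← hy]⟩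

variable [IsLocalRing R] [IsNoetherianRing R] [IsAdicComplete (maximalIdeal R) R]

/-- In the artinian ring B/𝔪B a multiple of a power of x is idempotent, and it lifts to an
idempotent of B. If the lift is 0, x is nilpotent modulo 𝔪B; if it is 1, x is a unit there; units
lift because 𝔪B lies in the Jacobson radical. -/
lemma isUnit_or_isUnit_one_sub_of_idempotents {B : Type w} [CommRing B] [Algebra R B]
    [Module.Finite R B] (h : ∀ e : B, IsIdempotentElem e → e = 0 ∨ e = 1) (x : B) :
    IsUnit x ∨ IsUnit (1 - x) := by
  set I := (maximalIdeal R).map (algebraMap R B) with hI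
  have := isPrecomplete_of_finite (maximalIdeal R) B
  have : IsAdicComplete (maximalIdeal R) B := {}
  have : IsAdicComplete I B := (IsAdicComplete.map_algebraMap_iff _ _).2 this
  have hjac : I ≤ Ideal.jacobson ⊥ := IsAdicComplete.le_jacobson_bot I
  have hunit : ∀ b : B, IsUnit (Ideal.Quotient.mk I b) → IsUnit b := fun b hb =>
    (isLocalHom_of_le_jacobson_bot I hjac).map_nonunit b hb
  have : IsArtinianRing (B ⧸ I) := by
    have : IsArtinianRing (R ⧸ maximalIdeal R) := inferInstanceAs (IsArtinianRing (ResidueField R))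
    exact IsArtinianRing.of_finite (R ⧸ maximalIdeal R) (B ⧸ I)
  obtain ⟨n, y, hy⟩ := exists_isIdempotentElem_eq_pow_mul (Ideal.Quotient.mk I x)
  obtain ⟨y, rfl⟩ := Ideal.Quotient.mk_surjective y
  have he : Ideal.Quotient.mk I ((x ^ (n + 1) * y) * (x ^ (n + 1) * y)) =
      Ideal.Quotient.mk I (x ^ (n + 1) * y) := by
    simp only [map_mul, map_pow]
    linear_combination (Ideal.Quotient.mk I y) * hy
  obtain ⟨e, h1, h2⟩ := HenselianRing.is_henselian (I := I)
    (Polynomial.X ^ 2 - Polynomial.X : Polynomial B) (by monicity!) (x ^ (n + 1) * y)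
    (by
      rw [← Ideal.Quotient.eq_zero_iff_mem]
      rw [Polynomial.eval_sub, Polynomial.eval_pow, Polynomial.eval_X, map_sub, pow_two, he,
        sub_self])
    (by
      -- The derivative of X² - X at an idempotent e is 2e - 1, which is its own inverse.
      refine .of_mul_eq_one (Ideal.Quotient.mk I (2 * (x ^ (n + 1) * y) - 1)) ?_
      simp only [Polynomial.derivative_sub, Polynomial.derivative_X_pow, Polynomial.derivative_X,
        Polynomial.eval_sub, Polynomial.eval_mul, Polynomial.eval_one]
      simp only [map_mul, map_pow] at he
      simp only [Polynomial.eval_ofNat, Polynomial.eval_X, map_sub, map_mul, map_pow, map_one,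
        map_ofNat, Nat.cast_ofNat, Nat.add_one_sub_one, pow_one]
      linear_combination 4 * he)
  have he' : Ideal.Quotient.mk I e = Ideal.Quotient.mk I (x ^ (n + 1) * y) := Ideal.Quotient.eq.2 h2
  have h1' : e ^ 2 - e = 0 := by simpa using h1
  rcases h e (by rw [IsIdempotentElem, ← pow_two]; exact sub_eq_zero.1 h1') with rfl | rfl
  · right
    apply hunit
    rw [map_sub, map_one]
    refine IsNilpotent.isUnit_one_sub ⟨n + 1, ?_⟩
    rw [map_zero, map_mul, map_pow] at he'
    rw [← hy, ← he', mul_zero]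
  · left
    apply hunit
    rw [map_one, map_mul, map_pow] at he'
    exact isUnit_of_mul_isUnit_left (y := Ideal.Quotient.mk I x ^ n * Ideal.Quotient.mk I y) (by
      rw [← mul_assoc, ← pow_succ', ← he']; exact isUnit_one)

/-- E need not be commutative, but x and 1 - x lie in the commutative subalgebra R[x], which is
finite over the noetherian ring R and inherits the condition on idempotents. -/
lemma isLocalRing_of_idempotents {E : Type w} [Ring E] [Nontrivial E] [Algebra R E]
    [Module.Finite R E] (h : ∀ e : E, IsIdempotentElem e → e = 0 ∨ e = 1) : IsLocalRing E := by
  refine .of_isUnit_or_isUnit_one_sub_self fun x => ?_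
  set φ := Polynomial.aeval (R := R) x
  have hinj : Function.Injective (Ideal.kerLiftAlg φ) := Ideal.kerLiftAlg_injective φ
  have : Module.Finite R (Polynomial R ⧸ RingHom.ker φ) :=
    Module.Finite.of_injective (Ideal.kerLiftAlg φ).toLinearMap hinj
  have h' : ∀ e : Polynomial R ⧸ RingHom.ker φ, IsIdempotentElem e → e = 0 ∨ e = 1 := fun e he => by
    rcases h _ (he.map (Ideal.kerLiftAlg φ)) with h | h
    · exact Or.inl (hinj (by rw [h, map_zero]))
    · exact Or.inr (hinj (by rw [h, map_one]))
  have hx : Ideal.kerLiftAlg φ (Ideal.Quotient.mk _ Polynomial.X) = x := by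
    rw [Ideal.kerLiftAlg_mk]; exact Polynomial.aeval_X x
  rcases isUnit_or_isUnit_one_sub_of_idempotents (R := R) h' (Ideal.Quotient.mk _ Polynomial.X)
    with h | h
  · left
    rw [← hx]; exact h.map _
  · right
    rw [← hx, ← map_one (Ideal.kerLiftAlg φ), ← map_sub]; exact h.map _

end CompleteLocal

/-! ### Projective modules with local endomorphism ring -/

section LocalProjective

variable {A : Type w} [Ring A] {P : Type u} [AddCommGroup P] [Module A P]

lemma surjective_or_surjective_of_comp_add_comp [IsLocalRing (Module.End A P)]
    {M N : Type*} [AddCommGroup M] [Module A M] [AddCommGroup N] [Module A N]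
    (f : M →ₗ[A] P) (f' : P →ₗ[A] M) (g : N →ₗ[A] P) (g' : P →ₗ[A] N)
    (h : f ∘ₗ f' + g ∘ₗ g' = LinearMap.id) : Function.Surjective f ∨ Function.Surjective g := by
  rcases IsLocalRing.isUnit_or_isUnit_of_add_one (R := Module.End A P) h with h | h
  · exact Or.inl (.of_comp (g := f') ((Module.End.isUnit_iff _).1 h).2)
  · exact Or.inr (.of_comp (g := g') ((Module.End.isUnit_iff _).1 h).2)

section

variable [Module.Projective A P] [IsLocalRing (Module.End A P)]

/-- Lifting the identity through N × N' → P writes it as a sum of two endomorphisms, one of which is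
invertible. Hence every proper submodule of P is superfluous. -/
lemma eq_top_or_eq_top_of_sup_eq_top (N N' : Submodule A P) (h : N ⊔ N' = ⊤) :
    N = ⊤ ∨ N' = ⊤ := by
  obtain ⟨s, hs⟩ := Module.projective_lifting_property (N.subtype.coprod N'.subtype)
    LinearMap.id (by
      rw [← LinearMap.range_eq_top, LinearMap.range_coprod, N.range_subtype, N'.range_subtype, h])
  refine (surjective_or_surjective_of_comp_add_comp N.subtype (LinearMap.fst A N N' ∘ₗ s)
    N'.subtype (LinearMap.snd A N N' ∘ₗ s) ?_).imp (fun h => ?_) (fun h => ?_)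
  · rw [← hs]; ext x; rfl
  · rw [← N.range_subtype, LinearMap.range_eq_top.2 h]
  · rw [← N'.range_subtype, LinearMap.range_eq_top.2 h]

lemma le_of_isCoatom {N C : Submodule A P} (hC : IsCoatom C) (hN : N ≠ ⊤) : N ≤ C := by
  rcases hC.le_iff.1 (le_sup_right : C ≤ N ⊔ C) with h | h
  · exact ((eq_top_or_eq_top_of_sup_eq_top N C h).resolve_left hN).symm.le.trans' le_top
  · exact h ▸ le_sup_left

lemma jacobson_eq_of_isCoatom {C : Submodule A P} (hC : IsCoatom C) :
    Module.jacobson A P = C :=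
  le_antisymm (sInf_le hC) (le_sInf fun _ hD => le_of_isCoatom hD hC.1)

lemma nontrivial_of_isLocalRing_end (A : Type w) [Ring A] (P : Type u) [AddCommGroup P]
    [Module A P] [IsLocalRing (Module.End A P)] : Nontrivial P := by
  by_contra h
  rw [not_nontrivial_iff_subsingleton] at h
  exact one_ne_zero (α := Module.End A P) (LinearMap.ext fun x => Subsingleton.elim _ _)

section

variable [Module.Finite A P]

variable (A P) in
lemma isCoatom_jacobson : IsCoatom (Module.jacobson A P) := by
  have : Nontrivial P := nontrivial_of_isLocalRing_end A P
  obtain ⟨C, hC, -⟩ := (eq_top_or_exists_le_coatom (⊥ : Submodule A P)).resolve_left bot_ne_top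
  rwa [jacobson_eq_of_isCoatom hC]

lemma le_jacobson {N : Submodule A P} (hN : N ≠ ⊤) : N ≤ Module.jacobson A P :=
  le_of_isCoatom (isCoatom_jacobson A P) hN

instance : IsSimpleModule A (P ⧸ Module.jacobson A P) :=
  isSimpleModule_iff_isCoatom.2 (isCoatom_jacobson A P)

end

lemma ker_eq_jacobson {S : Type*} [AddCommGroup S] [Module A S] [IsSimpleModule A S]
    {π : P →ₗ[A] S} (hπ : Function.Surjective π) : LinearMap.ker π = Module.jacobson A P := by
  refine (jacobson_eq_of_isCoatom (isSimpleModule_iff_isCoatom.1 ?_)).symm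
  exact IsSimpleModule.congr (π.quotKerEquivOfSurjective hπ)

/-- A simple quotient of a projective module with local endomorphism ring is its top. -/
noncomputable def topEquiv {S : Type*} [AddCommGroup S] [Module A S] [IsSimpleModule A S]
    {π : P →ₗ[A] S} (hπ : Function.Surjective π) : (P ⧸ Module.jacobson A P) ≃ₗ[A] S :=
  (Submodule.quotEquivOfEq _ _ (ker_eq_jacobson hπ).symm).trans (π.quotKerEquivOfSurjective hπ)

lemma isProjectiveCover_of_surjective {M : Type u'} [AddCommGroup M] [Module A M] [Nontrivial M]
    {π : P →ₗ[A] M} (hπ : Function.Surjective π) : IsProjectiveCover π := by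
  refine ⟨inferInstance, hπ, fun N hN => (eq_top_or_eq_top_of_sup_eq_top _ _ hN).resolve_right ?_⟩
  rw [LinearMap.ker_eq_top]
  rintro rfl
  obtain ⟨x, hx⟩ := exists_ne (0 : M)
  obtain ⟨y, rfl⟩ := hπ x
  exact hx rfl

end

lemma IsProjectiveCover.surjective_of_comp_eq {P' : Type u} [AddCommGroup P'] [Module A P']
    {M : Type u'} [AddCommGroup M] [Module A M] {π : P →ₗ[A] M} (hπ : IsProjectiveCover π)
    {π' : P' →ₗ[A] M} (hπ' : Function.Surjective π') {h : P' →ₗ[A] P} (hh : π ∘ₗ h = π') :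
    Function.Surjective h := by
  rw [← LinearMap.range_eq_top]
  refine hπ.2.2 _ (eq_top_iff.2 fun x _ => ?_)
  obtain ⟨y, hy⟩ := hπ' (π x)
  rw [← sub_add_cancel x (h y), add_comm]
  refine Submodule.add_mem_sup ⟨y, rfl⟩ ?_
  rw [LinearMap.mem_ker, map_sub, ← hy, ← hh, LinearMap.comp_apply, sub_self]

lemma IsProjectiveCover.nonempty_equiv {P' : Type u} [AddCommGroup P'] [Module A P']
    {M : Type u'} [AddCommGroup M] [Module A M] {π : P →ₗ[A] M} (hπ : IsProjectiveCover π)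
    {π' : P' →ₗ[A] M} (hπ' : IsProjectiveCover π') : Nonempty (P ≃ₗ[A] P') := by
  have := hπ.1
  have := hπ'.1
  obtain ⟨h, hh⟩ := Module.projective_lifting_property π' π hπ'.2.1
  have hs := hπ'.surjective_of_comp_eq hπ.2.1 hh
  obtain ⟨s, hs'⟩ := Module.projective_lifting_property h LinearMap.id hs
  have hss := hπ.surjective_of_comp_eq hπ'.2.1 (h := s) (by
    rw [← hh, LinearMap.comp_assoc, hs', LinearMap.comp_id])
  refine ⟨LinearEquiv.ofBijective h ⟨?_, hs⟩⟩
  have hl : Function.LeftInverse h s := LinearMap.congr_fun hs'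
  exact (hl.rightInverse_of_surjective hss).injective

/-- A noetherian module has an idempotent endomorphism, not killed by a given additive map, whose
range has no nontrivial idempotent endomorphisms. -/
lemma exists_primitive_idempotent [IsNoetherian A P] {G : Type*} [AddCommGroup G]
    (Λ : Module.End A P →+ G) (hΛ : Λ 1 ≠ 0) :
    ∃ e : Module.End A P, IsIdempotentElem e ∧ Λ e ≠ 0 ∧
      ∀ g : Module.End A (LinearMap.range e), IsIdempotentElem g → g = 0 ∨ g = 1 := by
  -- Among the idempotents not killed by Λ, take one with maximal kernel.
  obtain ⟨K, ⟨e, he, hΛe, rfl⟩, hmax⟩ := wellFounded_gt.has_min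
    {K : Submodule A P | ∃ e : Module.End A P, IsIdempotentElem e ∧ Λ e ≠ 0 ∧
      LinearMap.ker e = K} ⟨⊥, 1, IsIdempotentElem.one, hΛ, LinearMap.ker_id⟩
  have hcomp : e.rangeRestrict ∘ₗ (LinearMap.range e).subtype = LinearMap.id := by
    ext ⟨-, x, rfl⟩
    exact LinearMap.congr_fun he x
  -- The idempotent of P induced by g has a kernel containing that of e; by maximality they agree,
  -- so g is injective, and an injective idempotent is 1.
  have key : ∀ g : Module.End A (LinearMap.range e), IsIdempotentElem g →
      Λ ((LinearMap.range e).subtype ∘ₗ g ∘ₗ e.rangeRestrict) ≠ 0 → g = 1 := by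
    intro g hg h
    have hle : LinearMap.ker e ≤
        LinearMap.ker ((LinearMap.range e).subtype ∘ₗ g ∘ₗ e.rangeRestrict) := fun x hx => by
      have hx' : e.rangeRestrict x = 0 := Subtype.ext hx
      rw [LinearMap.mem_ker, LinearMap.comp_apply, LinearMap.comp_apply, hx', map_zero, map_zero]
    have hidem : IsIdempotentElem (M := Module.End A P)
        ((LinearMap.range e).subtype ∘ₗ g ∘ₗ e.rangeRestrict) := by
      refine LinearMap.ext fun x => congrArg Subtype.val ?_
      change g ((e.rangeRestrict ∘ₗ (LinearMap.range e).subtype) (g (e.rangeRestrict x))) = _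
      rw [hcomp]
      exact LinearMap.congr_fun hg _
    have heq := eq_of_le_of_not_lt hle (hmax _ ⟨_, hidem, h, rfl⟩)
    have hinj : Function.Injective g := by
      rw [← LinearMap.ker_eq_bot, LinearMap.ker_eq_bot']
      rintro ⟨-, x, rfl⟩ hx
      have : x ∈ LinearMap.ker e := by
        rw [heq]
        exact congrArg Subtype.val hx
      exact Subtype.ext this
    exact LinearMap.ext fun x => hinj (LinearMap.congr_fun hg x)
  refine ⟨e, he, hΛe, fun g hg => ?_⟩
  -- Since Λ is additive, it is nonzero on the part given by g or on that given by 1 - g.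
  have hsum : e = (LinearMap.range e).subtype ∘ₗ g ∘ₗ e.rangeRestrict +
      (LinearMap.range e).subtype ∘ₗ (1 - g) ∘ₗ e.rangeRestrict := by
    ext x
    simp
  by_cases h : Λ ((LinearMap.range e).subtype ∘ₗ g ∘ₗ e.rangeRestrict) = 0
  · have h1 := key (1 - g) hg.one_sub fun h' => hΛe (by
      rw [hsum, map_add, h, h', add_zero])
    exact Or.inl (sub_eq_self.1 h1)
  · exact Or.inr (key g hg h)

end LocalProjective

/-! ### Irreducible morphisms between objects with local endomorphism ring -/

section Irreducible

variable {C : Type u} [Category.{v} C] [Preadditive C]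

/-- `X` is nonzero and of each two endomorphisms with sum `𝟙 X`, one is invertible. -/
structure HasLocalEnd (X : C) : Prop where
  not_isZero : ¬ IsZero X
  isIso_or : ∀ f : X ⟶ X, IsIso f ∨ IsIso (𝟙 X - f)

variable {X Y : C}

lemma isZero_of_one_mem_catRadical {f : X ⟶ Y} (hf : f ∈ catRadical X Y) {g : Y ⟶ X}
    (h : f ≫ g = 𝟙 X) : IsZero X := by
  have h0 : IsIso (0 : X ⟶ X) := by simpa [h] using hf g
  rw [IsZero.iff_id_eq_zero, ← IsIso.hom_inv_id (0 : X ⟶ X), zero_comp]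

lemma not_isSplitMono_of_mem_catRadical (hX : ¬ IsZero X) {f : X ⟶ Y} (hf : f ∈ catRadical X Y) :
    ¬ IsSplitMono f :=
  fun _ => hX (isZero_of_one_mem_catRadical hf (IsSplitMono.id f))

lemma not_isSplitEpi_of_mem_catRadical (hY : ¬ IsZero Y) {f : X ⟶ Y} (hf : f ∈ catRadical X Y) :
    ¬ IsSplitEpi f := fun h => by
  have := comp_mem_catRadical' (section_ f) hf
  exact hY (isZero_of_one_mem_catRadical this (g := 𝟙 Y) (by rw [Category.comp_id, IsSplitEpi.id]))

lemma HasLocalEnd.mem_catRadical_of_not_isSplitMono (hX : HasLocalEnd X) {f : X ⟶ Y}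
    (hf : ¬ IsSplitMono f) : f ∈ catRadical X Y := fun g => by
  refine (hX.isIso_or (f ≫ g)).resolve_left fun h => hf ⟨⟨g ≫ inv (f ≫ g), ?_⟩⟩
  rw [← Category.assoc, IsIso.hom_inv_id]

lemma HasLocalEnd.mem_catRadical_of_not_isSplitEpi (hY : HasLocalEnd Y) {f : X ⟶ Y}
    (hf : ¬ IsSplitEpi f) : f ∈ catRadical X Y := fun g => by
  refine isIso_one_sub_swap g f ((hY.isIso_or (g ≫ f)).resolve_left fun h => ?_)
  exact hf ⟨⟨inv (g ≫ f) ≫ g, by rw [Category.assoc, IsIso.inv_hom_id]⟩⟩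

/-- A sum of composites is a single composite through a biproduct. -/
lemma exists_factorization_of_mem_catRadicalSq [HasBinaryBiproducts C] {f : X ⟶ Y}
    (hf : f ∈ catRadicalSq X Y) :
    ∃ (W : C) (a : X ⟶ W) (b : W ⟶ Y), a ∈ catRadical X W ∧ b ∈ catRadical W Y ∧ a ≫ b = f := by
  induction hf using AddSubgroup.closure_induction with
  | mem x hx => exact hx
  | zero => exact ⟨X, 0, 0, zero_mem _, zero_mem _, comp_zero⟩
  | add x y _ _ hx hy =>
    obtain ⟨W, a, b, ha, hb, rfl⟩ := hx
    obtain ⟨W', a', b', ha', hb', rfl⟩ := hy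
    refine ⟨W ⊞ W', a ≫ biprod.inl + a' ≫ biprod.inr, biprod.fst ≫ b + biprod.snd ≫ b',
      add_mem (comp_mem_catRadical ha _) (comp_mem_catRadical ha' _),
      add_mem (comp_mem_catRadical' _ hb) (comp_mem_catRadical' _ hb'), ?_⟩
    simp
  | neg x _ hx =>
    obtain ⟨W, a, b, ha, hb, rfl⟩ := hx
    exact ⟨W, -a, b, neg_mem ha, hb, Preadditive.neg_comp _ _⟩

/-- With local endomorphism rings, the non-sections from X and the non-retractions to Y are exactly
the radical morphisms, so a radical morphism is irreducible exactly when it is not in J². -/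
lemma exists_isIrreducibleMorphism_iff [HasBinaryBiproducts C] (hX : HasLocalEnd X)
    (hY : HasLocalEnd Y) :
    (∃ f : X ⟶ Y, IsIrreducibleMorphism f) ↔ ¬ catRadical X Y ≤ catRadicalSq X Y := by
  rw [SetLike.not_le_iff_exists]
  constructor
  · rintro ⟨f, h1, h2, h3⟩
    refine ⟨f, hX.mem_catRadical_of_not_isSplitMono h1, fun hf => ?_⟩
    obtain ⟨W, a, b, ha, hb, hab⟩ := exists_factorization_of_mem_catRadicalSq hf
    rcases h3 W a b hab with h | h
    · exact not_isSplitMono_of_mem_catRadical hX.not_isZero ha h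
    · exact not_isSplitEpi_of_mem_catRadical hY.not_isZero hb h
  · rintro ⟨f, hf, hf'⟩
    refine ⟨f, not_isSplitMono_of_mem_catRadical hX.not_isZero hf,
      not_isSplitEpi_of_mem_catRadical hY.not_isZero hf, fun W g h hgh => ?_⟩
    by_contra! hcon
    exact hf' (AddSubgroup.subset_closure ⟨W, g, h, hX.mem_catRadical_of_not_isSplitMono hcon.1,
      hY.mem_catRadical_of_not_isSplitEpi hcon.2, hgh⟩)

end Irreducible

/-! ### Indecomposable projective modules -/

section Indecomposables

variable {Γ : Type u} [Ring Γ] {X Y : ProjCat Γ}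

lemma isZero_of_subsingleton [Subsingleton X.obj] : IsZero X := by
  rw [IsZero.iff_id_eq_zero]
  exact proj_ext (LinearMap.ext fun x => Subsingleton.elim _ _)

lemma isIso_iff_bijective (f : X ⟶ Y) : IsIso f ↔ Function.Bijective (lin f) := by
  refine ⟨fun _ => (linIso (asIso f)).bijective, fun h => ?_⟩
  exact (projIso (LinearEquiv.ofBijective (lin f) h)).isIso_hom

lemma isSplitEpi_iff_surjective (f : X ⟶ Y) : IsSplitEpi f ↔ Function.Surjective (lin f) := by
  constructor
  · intro h y
    exact ⟨lin (section_ f) y, LinearMap.congr_fun (congrArg lin (IsSplitEpi.id f)) y⟩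
  · intro h
    obtain ⟨s, hs⟩ := Module.projective_lifting_property (lin f) LinearMap.id h
    exact ⟨⟨projHom s, proj_ext hs⟩⟩

lemma hasLocalEnd_of_isLocalRing [IsLocalRing (Module.End Γᵐᵒᵖ X.obj)] : HasLocalEnd X where
  not_isZero h := by
    have := subsingleton_of_isZero h
    have := nontrivial_of_isLocalRing_end Γᵐᵒᵖ X.obj
    exact not_subsingleton X.obj inferInstance
  isIso_or f := by
    refine (IsLocalRing.isUnit_or_isUnit_of_add_one (R := Module.End Γᵐᵒᵖ X.obj)
      (add_sub_cancel (lin f) LinearMap.id)).imp (fun h => ?_) (fun h => ?_)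
    · exact (isIso_iff_bijective f).2 ((Module.End.isUnit_iff _).1 h)
    · exact (isIso_iff_bijective (𝟙 X - f)).2 ((Module.End.isUnit_iff _).1 h)

lemma IndClass.indecomposable_rep {C : Type u} [Category.{v} C] [Preadditive C]
    [HasBinaryBiproducts C] (c : IndClass C) : Indecomposable c.rep := by
  obtain ⟨X, ⟨h0, h⟩, hX⟩ := c.2
  obtain ⟨e⟩ : Nonempty (X ≅ c.rep) := Quotient.exact (hX.trans (Quotient.out_eq c.1).symm)
  exact ⟨fun hz => h0 (hz.of_iso e), fun Y Z i => h Y Z (e ≪≫ i)⟩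

lemma IndClass.eq_of_iso {C : Type u} [Category.{v} C] [Preadditive C] [HasBinaryBiproducts C]
    {c c' : IndClass C} (e : c.rep ≅ c'.rep) : c = c' := by
  refine Subtype.ext ?_
  rw [← Quotient.out_eq c.1, ← Quotient.out_eq c'.1]
  exact Quotient.sound ⟨e⟩

lemma exists_indClass_of_indecomposable {C : Type u} [Category.{v} C] [Preadditive C]
    [HasBinaryBiproducts C] {X : C} (hX : Indecomposable X) :
    ∃ c : IndClass C, Nonempty (c.rep ≅ X) :=
  ⟨⟨Quotient.mk _ X, X, hX, rfl⟩,
    Quotient.exact (Quotient.out_eq (Quotient.mk (isIsomorphicSetoid C) X))⟩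

lemma HasLocalEnd.indecomposable {C : Type u} [Category.{v} C] [Preadditive C]
    [HasBinaryBiproducts C] {X : C} (hX : HasLocalEnd X) : Indecomposable X := by
  refine ⟨hX.not_isZero, fun Y Z e => ?_⟩
  have h1 : 𝟙 X - (e.hom ≫ biprod.fst) ≫ biprod.inl ≫ e.inv =
      (e.hom ≫ biprod.snd) ≫ biprod.inr ≫ e.inv := by
    have h := congrArg (fun t => e.hom ≫ t ≫ e.inv) (biprod.total (X := Y) (Y := Z))
    simp only [Preadditive.add_comp, Preadditive.comp_add, Category.assoc, Category.id_comp,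
      e.hom_inv_id] at h
    rw [← h]
    simp
  rcases hX.isIso_or ((e.hom ≫ biprod.fst) ≫ biprod.inl ≫ e.inv) with h | h
  · right
    rw [IsZero.iff_id_eq_zero]
    have h2 : ((e.hom ≫ biprod.fst) ≫ biprod.inl ≫ e.inv) ≫ e.hom ≫ biprod.snd = 0 := by simp
    have h3 : e.hom ≫ (biprod.snd : Y ⊞ Z ⟶ Z) = 0 := by
      rw [← cancel_epi ((e.hom ≫ biprod.fst) ≫ biprod.inl ≫ e.inv), h2, comp_zero]
    have h4 : (biprod.snd : Y ⊞ Z ⟶ Z) = 0 := by rw [← cancel_epi e.hom, h3, comp_zero]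
    rw [← biprod.inr_snd (X := Y) (Y := Z), h4, comp_zero]
  · left
    rw [h1] at h
    rw [IsZero.iff_id_eq_zero]
    have h2 : ((e.hom ≫ biprod.snd) ≫ biprod.inr ≫ e.inv) ≫ e.hom ≫ biprod.fst = 0 := by simp
    have h3 : e.hom ≫ (biprod.fst : Y ⊞ Z ⟶ Y) = 0 := by
      rw [← cancel_epi ((e.hom ≫ biprod.snd) ≫ biprod.inr ≫ e.inv), h2, comp_zero]
    have h4 : (biprod.fst : Y ⊞ Z ⟶ Y) = 0 := by rw [← cancel_epi e.hom, h3, comp_zero]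
    rw [← biprod.inl_fst (X := Y) (Y := Z), h4, comp_zero]

lemma projective_range {A : Type w} [Ring A] {P : Type u} [AddCommGroup P] [Module A P]
    [Module.Projective A P] {e : Module.End A P} (he : IsIdempotentElem e) :
    Module.Projective A (LinearMap.range e) := by
  refine Module.Projective.of_split (LinearMap.range e).subtype e.rangeRestrict ?_
  ext ⟨-, x, rfl⟩
  exact LinearMap.congr_fun he x

/-- An idempotent decomposes a projective module. -/
lemma nonempty_iso_biprod {e : Module.End Γᵐᵒᵖ X.obj} (he : IsIdempotentElem e) :
    haveI := projective_range he
    haveI := projective_range he.one_sub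
    Nonempty (X ≅ projOf (LinearMap.range e) ⊞ projOf (LinearMap.range (1 - e))) := by
  have := projective_range he
  have := projective_range he.one_sub
  have hee : ∀ x, e (e x) = e x := LinearMap.congr_fun he
  refine ⟨⟨biprod.lift (projHom e.rangeRestrict) (projHom (1 - e).rangeRestrict),
    biprod.desc (projHom (LinearMap.range e).subtype) (projHom (LinearMap.range (1 - e)).subtype),
    ?_, ?_⟩⟩
  · rw [biprod.lift_desc]
    refine proj_ext (LinearMap.ext fun x => ?_)
    change e x + (x - e x) = x
    abel
  · refine biprod.hom_ext' _ _ ?_ ?_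
    · rw [biprod.inl_desc_assoc, Category.comp_id]
      refine biprod.hom_ext _ _ ?_ ?_
      · rw [Category.assoc, biprod.lift_fst, biprod.inl_fst]
        refine proj_ext (LinearMap.ext ?_)
        rintro ⟨-, x, rfl⟩
        exact Subtype.ext (hee x)
      · rw [Category.assoc, biprod.lift_snd, biprod.inl_snd]
        refine proj_ext (LinearMap.ext ?_)
        rintro ⟨-, x, rfl⟩
        refine Subtype.ext ?_
        change e x - e (e x) = 0
        rw [hee, sub_self]
    · rw [biprod.inr_desc_assoc, Category.comp_id]
      refine biprod.hom_ext _ _ ?_ ?_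
      · rw [Category.assoc, biprod.lift_fst, biprod.inr_fst]
        refine proj_ext (LinearMap.ext ?_)
        rintro ⟨-, x, rfl⟩
        refine Subtype.ext ?_
        change e (x - e x) = 0
        rw [map_sub, hee, sub_self]
      · rw [Category.assoc, biprod.lift_snd, biprod.inr_snd]
        refine proj_ext (LinearMap.ext ?_)
        rintro ⟨-, x, rfl⟩
        refine Subtype.ext ?_
        change (x - e x) - e (x - e x) = x - e x
        rw [map_sub, hee, sub_self, sub_zero]

lemma CategoryTheory.Indecomposable.eq_zero_or_eq_one (hX : Indecomposable X)
    (e : Module.End Γᵐᵒᵖ X.obj) (he : IsIdempotentElem e) : e = 0 ∨ e = 1 := by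
  have := projective_range he
  have := projective_range he.one_sub
  obtain ⟨i⟩ := nonempty_iso_biprod he
  have key : ∀ (f : Module.End Γᵐᵒᵖ X.obj), Subsingleton (LinearMap.range f) → f = 0 := fun f hf =>
    LinearMap.range_eq_bot.1 (Submodule.subsingleton_iff_eq_bot.1 hf)
  rcases hX.2 _ _ i with h | h
  · exact Or.inl (key _ (subsingleton_of_isZero h))
  · exact Or.inr (sub_eq_zero.1 (key _ (subsingleton_of_isZero h))).symm

variable (Γ) in
/-- A finitely generated projective module has a local endomorphism ring if its only idempotent
endomorphisms are `0` and `1`. -/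
class HasLocalEndomorphismRings : Prop where
  isLocalRing (X : ProjCat Γ) [Nontrivial X.obj]
    (h : ∀ e : Module.End Γᵐᵒᵖ X.obj, IsIdempotentElem e → e = 0 ∨ e = 1) :
    IsLocalRing (Module.End Γᵐᵒᵖ X.obj)

/-- Values on generators embed the endomorphism ring in a finite R-module, so it is a finite
R-algebra. -/
lemma hasLocalEndomorphismRings_of_isAdicComplete (R : Type v) [CommRing R] [IsLocalRing R]
    [IsNoetherianRing R] [IsAdicComplete (IsLocalRing.maximalIdeal R) R] [Algebra R Γ]
    [Module.Finite R Γ] : HasLocalEndomorphismRings Γ where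
  isLocalRing X _ h := by
    let : Module R X.obj := Module.compHom X.obj (algebraMap R Γᵐᵒᵖ)
    have : IsScalarTower R Γᵐᵒᵖ X.obj := .of_algebraMap_smul fun _ _ => rfl
    have : SMulCommClass Γᵐᵒᵖ R X.obj := IsScalarTower.to_smulCommClass' ..
    have : Module.Finite R Γᵐᵒᵖ := Module.Finite.equiv (MulOpposite.opLinearEquiv R)
    have : Module.Finite R X.obj := Module.Finite.trans Γᵐᵒᵖ X.obj
    obtain ⟨n, s, hs⟩ := Module.Finite.exists_fin (R := Γᵐᵒᵖ) (M := X.obj)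
    let ev : Module.End Γᵐᵒᵖ X.obj →ₗ[R] (Fin n → X.obj) :=
      { toFun f i := f (s i), map_add' _ _ := rfl, map_smul' _ _ := rfl }
    have hev : Function.Injective ev := fun f g hfg =>
      LinearMap.ext_on_range hs fun i => congrFun hfg i
    have : Module.Finite R (Module.End Γᵐᵒᵖ X.obj) := Module.Finite.of_injective ev hev
    exact isLocalRing_of_idempotents (R := R) h

lemma CategoryTheory.Indecomposable.isLocalRing_end [HasLocalEndomorphismRings Γ]
    (hX : Indecomposable X) : IsLocalRing (Module.End Γᵐᵒᵖ X.obj) := by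
  have : Nontrivial X.obj := by
    rw [← not_subsingleton_iff_nontrivial]
    exact fun h => hX.1 isZero_of_subsingleton
  exact HasLocalEndomorphismRings.isLocalRing X hX.eq_zero_or_eq_one

instance [HasLocalEndomorphismRings Γ] (c : IndClass (ProjCat Γ)) :
    IsLocalRing (Module.End Γᵐᵒᵖ c.rep.obj) :=
  c.indecomposable_rep.isLocalRing_end

/-- The dual of a projective module with local endomorphism ring has a local endomorphism ring. -/
instance [IsLocalRing (Module.End Γᵐᵒᵖ X.obj)] :
    IsLocalRing (Module.End Γ (X.obj →ₗ[Γᵐᵒᵖ] Γ)) := by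
  have : Nontrivial (X.obj →ₗ[Γᵐᵒᵖ] Γ) := by
    by_contra h
    rw [not_nontrivial_iff_subsingleton] at h
    have h1 : (LinearMap.id : X.obj →ₗ[Γᵐᵒᵖ] X.obj) = 0 :=
      eq_zero_of_dual _ fun φ => Subsingleton.elim _ _
    exact one_ne_zero (α := Module.End Γᵐᵒᵖ X.obj) h1
  have key : ∀ a b : Module.End Γᵐᵒᵖ X.obj, a * b = 1 → b * a = 1 →
      IsUnit (M := Module.End Γ (X.obj →ₗ[Γᵐᵒᵖ] Γ)) (dualLin a) := fun a b h1 h2 =>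
    ⟨⟨dualLin a, dualLin b, LinearMap.ext fun φ => LinearMap.ext fun x =>
      congrArg φ (LinearMap.congr_fun h2 x), LinearMap.ext fun φ => LinearMap.ext fun x =>
      congrArg φ (LinearMap.congr_fun h1 x)⟩, rfl⟩
  have key : ∀ a : Module.End Γᵐᵒᵖ X.obj, IsUnit a →
      IsUnit (M := Module.End Γ (X.obj →ₗ[Γᵐᵒᵖ] Γ)) (dualLin a) := by
    rintro _ ⟨u, rfl⟩
    exact key _ _ u.mul_inv u.inv_mul
  refine IsLocalRing.of_isUnit_or_isUnit_one_sub_self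
    (R := Module.End Γ (X.obj →ₗ[Γᵐᵒᵖ] Γ)) fun α => ?_
  obtain ⟨a, rfl⟩ := (regularBimodule Γ).exists_eq_lcomp (P := X.obj) (Q := X.obj) α
  have hsub : 1 - LinearMap.lcomp Γ Γ a = dualLin (1 - a : Module.End Γᵐᵒᵖ X.obj) := by
    ext φ x
    simp
  rw [hsub]
  exact (IsLocalRing.isUnit_or_isUnit_of_add_one (add_sub_cancel a 1)).imp (key _) (key _)

lemma nonempty_iso_of_dual_equiv (e : (Y.obj →ₗ[Γᵐᵒᵖ] Γ) ≃ₗ[Γ] (X.obj →ₗ[Γᵐᵒᵖ] Γ)) :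
    Nonempty (X ≅ Y) := by
  obtain ⟨a, ha⟩ := (regularBimodule Γ).exists_eq_lcomp e.toLinearMap
  obtain ⟨b, hb⟩ := (regularBimodule Γ).exists_eq_lcomp e.symm.toLinearMap
  refine ⟨⟨projHom a, projHom b, proj_ext ?_, proj_ext ?_⟩⟩ <;>
  refine (regularBimodule Γ).lcomp_injective ?_
  · refine LinearMap.ext fun φ => ?_
    change LinearMap.lcomp Γ Γ a (LinearMap.lcomp Γ Γ b φ) = φ
    rw [ha, hb]
    exact e.apply_symm_apply φ
  · refine LinearMap.ext fun φ => ?_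
    change LinearMap.lcomp Γ Γ b (LinearMap.lcomp Γ Γ a φ) = φ
    rw [ha, hb]
    exact e.symm_apply_apply φ

end Indecomposables

/-! ### Dotted arrows and Auslander-Reiten conflations -/

section DottedArrows

variable {Γ : Type u} [Ring Γ] [IsNoetherianRing Γᵐᵒᵖ] [HasLocalEndomorphismRings Γ]

/-- Some indecomposable direct summand is not killed by a nonzero additive map. -/
lemma exists_indClass_retract {G : Type*} [AddCommGroup G] (Z : ProjCat Γ)
    (Λ : Module.End Γᵐᵒᵖ Z.obj →+ G) (hΛ : Λ 1 ≠ 0) :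
    ∃ (c : IndClass (ProjCat Γ)) (i : c.rep.obj →ₗ[Γᵐᵒᵖ] Z.obj) (r : Z.obj →ₗ[Γᵐᵒᵖ] c.rep.obj),
      Λ (i ∘ₗ r) ≠ 0 := by
  obtain ⟨e, he, hΛe, hid⟩ := exists_primitive_idempotent Λ hΛ
  have := projective_range he
  have : Nontrivial (LinearMap.range e) := by
    rw [Submodule.nontrivial_iff_ne_bot]
    intro h
    rw [LinearMap.range_eq_bot.1 h, map_zero] at hΛe
    exact hΛe rfl
  have : IsLocalRing (Module.End Γᵐᵒᵖ (projOf (Γ := Γ) (LinearMap.range e)).obj) :=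
    HasLocalEndomorphismRings.isLocalRing _ hid
  obtain ⟨c, ⟨φ⟩⟩ := exists_indClass_of_indecomposable
    (hasLocalEnd_of_isLocalRing (X := projOf (Γ := Γ) (LinearMap.range e))).indecomposable
  refine ⟨c, (LinearMap.range e).subtype ∘ₗ (linIso φ).toLinearMap,
    (linIso φ).symm.toLinearMap ∘ₗ e.rangeRestrict, ?_⟩
  convert hΛe using 2
  ext x
  change ((linIso φ ((linIso φ).symm (e.rangeRestrict x)) : LinearMap.range e) : Z.obj) = e x
  rw [LinearEquiv.apply_symm_apply]
  rfl

/-- A nonzero map Γ → S stays nonzero on some indecomposable summand of Γ, whose top is then S. -/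
lemma exists_indClass_topModule (S : RightMod Γ) [IsSimpleModule Γᵐᵒᵖ S] :
    ∃ c : IndClass (ProjCat Γ), Nonempty (topModule c.rep.obj ≃ₗ[Γᵐᵒᵖ] S) := by
  have := IsSimpleModule.nontrivial Γᵐᵒᵖ S
  obtain ⟨x, hx⟩ := exists_ne (0 : S)
  let p : (regProj Γ).obj →ₗ[Γᵐᵒᵖ] S :=
    LinearMap.toSpanSingleton Γᵐᵒᵖ S x ∘ₗ (regularBimodule Γ).left.toLinearMap
  have hp : p (1 : Γ) = x := one_smul Γᵐᵒᵖ x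
  obtain ⟨c, i, r, h⟩ := exists_indClass_retract (regProj Γ)
    { toFun f := p ∘ₗ f
      map_zero' := LinearMap.comp_zero p
      map_add' f g := LinearMap.comp_add f g p }
    fun h => hx (hp.symm.trans (LinearMap.congr_fun h (1 : Γ)))
  have h0 : p ∘ₗ i ≠ 0 := fun h0 => h (by
    change p ∘ₗ (i ∘ₗ r) = 0
    rw [← LinearMap.comp_assoc, h0, LinearMap.zero_comp])
  exact ⟨c, ⟨topEquiv (LinearMap.surjective_of_ne_zero h0)⟩⟩

/-- Ext² is a quotient of X* for a resolution starting in X. Some indecomposable summand of X has a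
dual that maps nontrivially to this simple module, and this is a projective cover. -/
lemma exists_isTranslate (c : IndClass (ProjCat Γ))
    (hc : IsTwoRegularSimple (topModule c.rep.obj)) :
    ∃ d : IndClass (ProjCat Γ), IsTranslate c.rep d.rep := by
  obtain ⟨-, hpd, -, -, hs⟩ := (isTwoRegularSimple_iff _).1 hc
  obtain ⟨n, m, X, g, p, hX, hr⟩ := exists_isLengthTwoResolution hpd
  obtain ⟨π, hπ, -⟩ := hr.exists_extBi_two Γ Γ
  have := IsSimpleModule.nontrivial Γ (ExtBi Γᵐᵒᵖ Γ Γ (topModule c.rep.obj) 2)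
  obtain ⟨x, hx⟩ := exists_ne (0 : ExtBi Γᵐᵒᵖ Γ Γ (topModule c.rep.obj) 2)
  obtain ⟨φ, rfl⟩ := hπ x
  obtain ⟨d, i, r, h⟩ := exists_indClass_retract (projOf X)
    { toFun f := π (φ ∘ₗ f)
      map_zero' := by rw [LinearMap.comp_zero, map_zero]
      map_add' f g := by rw [LinearMap.comp_add, map_add] } hx
  have h0 : π ∘ₗ dualLin r ≠ 0 := fun h0 => h (LinearMap.congr_fun h0 (φ ∘ₗ i))
  have := (regularBimodule Γ).projective_dual (P := d.rep.obj)
  have := hc.ext_two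
  have := IsSimpleModule.nontrivial Γ (ExtToRing Γ (topModule c.rep.obj) 2)
  exact ⟨d, hc, (extBiToRing _ 2).toLinearMap ∘ₗ (π ∘ₗ dualLin r), isProjectiveCover_of_surjective
    ((extBiToRing _ 2).surjective.comp (LinearMap.surjective_of_ne_zero h0))⟩

lemma IsTranslate.nonempty_iso {P Q Q' : ProjCat Γ} (h : IsTranslate P Q) (h' : IsTranslate P Q') :
    Nonempty (Q ≅ Q') := by
  obtain ⟨-, π, hπ⟩ := h
  obtain ⟨-, π', hπ'⟩ := h'
  obtain ⟨e⟩ := hπ'.nonempty_equiv hπ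
  exact nonempty_iso_of_dual_equiv e

/-- Both modules are projective covers of the same simple module. -/
lemma IndClass.eq_of_topModule_equiv {c d : IndClass (ProjCat Γ)}
    (e : topModule c.rep.obj ≃ₗ[Γᵐᵒᵖ] topModule d.rep.obj) : c = d := by
  have := IsSimpleModule.nontrivial Γᵐᵒᵖ (topModule d.rep.obj)
  obtain ⟨e⟩ := (isProjectiveCover_of_surjective
    (π := e.toLinearMap ∘ₗ (Module.jacobson Γᵐᵒᵖ c.rep.obj).mkQ)
    (e.surjective.comp (Submodule.mkQ_surjective _))).nonempty_equiv
    (isProjectiveCover_of_surjective (Module.jacobson Γᵐᵒᵖ d.rep.obj).mkQ_surjective)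
  exact IndClass.eq_of_iso (projIso e)

lemma DottedArrow.ext_of_isoClass {a b : DottedArrow Γ}
    (h : isoClass (topModule a.1.1.rep.obj) = isoClass (topModule b.1.1.rep.obj)) : a = b := by
  obtain ⟨e⟩ := Quotient.exact h
  have h1 := IndClass.eq_of_topModule_equiv e.toLinearEquiv
  obtain ⟨⟨c, d⟩, ha⟩ := a
  obtain ⟨⟨c', d'⟩, hb⟩ := b
  obtain rfl : c = c' := h1
  obtain ⟨i⟩ := IsTranslate.nonempty_iso ha hb
  obtain rfl := IndClass.eq_of_iso i
  rfl

/-- Sets of 2-regular simple modules correspond to sets of dotted arrows. -/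
def twoRegularSetEquiv : TwoRegularSet Γ ≃ Set (DottedArrow Γ) where
  toFun T := {a | isoClass (topModule a.1.1.rep.obj) ∈ T.1}
  invFun X := ⟨{c | ∃ a ∈ X, isoClass (topModule a.1.1.rep.obj) = c}, by
    rintro c ⟨a, -, rfl⟩
    exact ⟨_, a.2.1, rfl⟩⟩
  left_inv T := by
    refine Subtype.ext (Set.ext fun c => ⟨?_, fun hc => ?_⟩)
    · rintro ⟨a, ha, rfl⟩
      exact ha
    · obtain ⟨S, hS, rfl⟩ := T.2 c hc
      have := hS.isSimple
      obtain ⟨c, ⟨e⟩⟩ := exists_indClass_topModule S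
      obtain ⟨d, hd⟩ := exists_isTranslate c (hS.of_equiv e.symm)
      have hcS : isoClass (topModule c.rep.obj) = isoClass S := Quotient.sound ⟨e.toModuleIso⟩
      exact ⟨⟨(c, d), hd⟩, hcS.symm.subst (motive := (· ∈ T.1)) hc, hcS⟩
  right_inv X := by
    refine Set.ext fun a => ⟨?_, fun ha => ⟨a, ha, rfl⟩⟩
    rintro ⟨b, hb, h⟩
    exact DottedArrow.ext_of_isoClass h ▸ hb

end DottedArrows

/-! ### Construction of Auslander-Reiten conflations -/

section AuslanderReiten

variable {Γ : Type u} [Ring Γ] [IsNoetherianRing Γᵐᵒᵖ]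

variable {F : ExactStructure (ProjCat Γ)} {P Q : ProjCat Γ}
  [IsLocalRing (Module.End Γᵐᵒᵖ P.obj)] [IsLocalRing (Module.End Γᵐᵒᵖ Q.obj)]

/-- A map to P fails to be a retraction exactly when its image lies in rad P, the unique maximal
submodule. -/
lemma isRightAlmostSplit_iff {E : ProjCat Γ} (g : E ⟶ P) :
    IsRightAlmostSplit g ↔ LinearMap.range (lin g) = Module.jacobson Γᵐᵒᵖ P.obj := by
  have hns : ∀ {W : ProjCat Γ} (h : W ⟶ P),
      ¬ IsSplitEpi h ↔ LinearMap.range (lin h) ≤ Module.jacobson Γᵐᵒᵖ P.obj := fun h => by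
    refine (not_congr ((isSplitEpi_iff_surjective h).trans LinearMap.range_eq_top.symm)).trans ?_
    exact ⟨le_jacobson, fun hle htop =>
      (isCoatom_jacobson Γᵐᵒᵖ P.obj).1 (top_le_iff.1 (htop ▸ hle))⟩
  constructor
  · rintro ⟨h1, h2⟩
    refine le_antisymm ((hns g).1 h1) fun x hx => ?_
    obtain ⟨t, ht⟩ := h2 _ (elemHom x) ((hns _).2 (by
      rintro _ ⟨a, rfl⟩
      exact Submodule.smul_mem _ (MulOpposite.op (a : Γ)) hx))
    exact range_le_of_comp_eq ht ⟨(1 : Γ), elemHom_one x⟩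
  · intro hg
    exact ⟨(hns g).2 hg.le, fun W h hh => exists_lift_of_range_le g h (((hns h).1 hh).trans hg.ge)⟩

/-- A map h from Q is a section if h* is surjective. Otherwise im h* lies in the unique maximal
submodule im f* of Q*, and h extends along f. -/
lemma isLeftAlmostSplit_of_isCoatom {E : ProjCat Γ} (f : Q ⟶ E)
    (hf : IsCoatom (LinearMap.range (dualLin (lin f)))) : IsLeftAlmostSplit f := by
  have := (regularBimodule Γ).projective_dual (P := Q.obj)
  constructor
  · rintro ⟨⟨r, hr⟩⟩
    refine hf.1 (LinearMap.range_eq_top.2 fun φ => ⟨φ ∘ₗ lin r, ?_⟩)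
    exact LinearMap.ext fun x => congrArg φ (LinearMap.congr_fun (congrArg lin hr) x)
  · intro W h hh
    by_cases htop : LinearMap.range (dualLin (lin h)) = ⊤
    · obtain ⟨σ, hσ⟩ := Module.projective_lifting_property _ LinearMap.id
        (LinearMap.range_eq_top.1 htop)
      obtain ⟨s, rfl⟩ := (regularBimodule Γ).exists_eq_lcomp σ
      refine (hh ⟨⟨projHom s, proj_ext ((regularBimodule Γ).lcomp_injective ?_)⟩⟩).elim
      exact hσ
    · have hle := le_of_isCoatom hf htop
      obtain ⟨t, ht⟩ := exists_extension_of_dual (lin f) (lin h) fun φ => hle ⟨φ, rfl⟩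
      exact ⟨projHom t, proj_ext ht⟩

/-- The conflation is a resolution of the top of P, so Q* maps onto the simple module Ext² and is
its projective cover. -/
lemma isTranslate_of_isARConflation {E : ProjCat Γ} {f : Q ⟶ E} {g : E ⟶ P} {w : f ≫ g = 0}
    (h : F.IsARConflation (ShortComplex.mk f g w)) :
    IsTranslate P Q ∧ IsCokerOfDeflation F (topModule P.obj) := by
  obtain ⟨hc, -, hg⟩ := h
  have hg : LinearMap.range (lin g) = Module.jacobson Γᵐᵒᵖ P.obj := (isRightAlmostSplit_iff g).1 hg
  have hcok : IsCokerOfDeflation F (topModule P.obj) :=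
    ⟨_, _, g, ⟨_, f, w, hc⟩, ⟨Submodule.quotEquivOfEq _ _ hg⟩⟩
  obtain ⟨h1, h2⟩ := conflation_exact hc
  have hr : IsLengthTwoResolution (lin f) (lin g) (Module.jacobson Γᵐᵒᵖ P.obj).mkQ :=
    ⟨h1, h2, by rw [LinearMap.exact_iff, Submodule.ker_mkQ, hg], Submodule.mkQ_surjective _⟩
  have hreg : IsTwoRegularSimple (topModule P.obj) := hcok.isTwoRegularSimple
  obtain ⟨π, hπ, -⟩ := hr.exists_extBi_two Γ Γ
  have := (regularBimodule Γ).projective_dual (P := Q.obj)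
  have := hreg.ext_two
  have := IsSimpleModule.nontrivial Γ (ExtToRing Γ (topModule P.obj) 2)
  exact ⟨⟨hreg, (extBiToRing (topModule P.obj) 2).toLinearMap ∘ₗ π, isProjectiveCover_of_surjective
    ((extBiToRing (topModule P.obj) 2).surjective.comp hπ)⟩, hcok⟩

/-- Some conflation resolves the top of P but may start in a wrong X; pushing it out along a
suitable X → Q corrects the first term and keeps the image rad P. -/
lemma exists_isARConflation (ht : IsTranslate P Q) (hc : IsCokerOfDeflation F (topModule P.obj)) :
    ∃ (E : ProjCat Γ) (f : Q ⟶ E) (g : E ⟶ P) (w : f ≫ g = 0),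
      F.IsARConflation (ShortComplex.mk f g w) := by
  obtain ⟨E, k, ⟨X, i, w, hik⟩, hk⟩ :=
    hc.exists_range_eq_ker P (Module.jacobson Γᵐᵒᵖ P.obj).mkQ
  have key : ∀ {X E : ProjCat Γ} {i : X ⟶ E} {k : E ⟶ P} {w : i ≫ k = 0},
      F.conflation (ShortComplex.mk i k w) →
      LinearMap.range (lin k) = Module.jacobson Γᵐᵒᵖ P.obj →
      IsLengthTwoResolution (lin i) (lin k) (Module.jacobson Γᵐᵒᵖ P.obj).mkQ := fun hc hg =>
    ⟨(conflation_exact hc).1, (conflation_exact hc).2,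
      by rw [LinearMap.exact_iff, Submodule.ker_mkQ, hg], Submodule.mkQ_surjective _⟩
  rw [Submodule.ker_mkQ] at hk
  obtain ⟨π', hπ', hex⟩ := (key hik hk).exists_extBi_two Γ Γ
  obtain ⟨hreg, π, hproj, hπ, -⟩ := ht
  -- Lifting the projective cover Q* → Ext² through X* → Ext² gives a map Q* → X*, which is the dual
  -- of some x : X → Q.
  obtain ⟨σ, hσ⟩ := Module.projective_lifting_property
    ((extBiToRing (topModule P.obj) 2).toLinearMap ∘ₗ π') π
    ((extBiToRing (topModule P.obj) 2).surjective.comp hπ')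
  obtain ⟨x, rfl⟩ := (regularBimodule Γ).exists_eq_lcomp σ
  obtain ⟨E', j, t, c, w', hjc, htc, hp⟩ := exists_conflation_pushout hik (projHom x)
  -- If c were surjective, x would factor through i, so x* would land in im i* and the projective
  -- cover would vanish.
  have hns : ¬ Function.Surjective (lin c) := by
    intro hs
    obtain ⟨r, hr⟩ := exists_extension_of_surjective hjc hp.w hs
    have := hreg.ext_two
    have := IsSimpleModule.nontrivial Γ (ExtToRing Γ (topModule P.obj) 2)
    obtain ⟨y, hy⟩ := exists_ne (0 : ExtToRing Γ (topModule P.obj) 2)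
    obtain ⟨φ, rfl⟩ := hπ y
    refine hy ?_
    rw [← hσ]
    have h0 : π' (LinearMap.lcomp Γ Γ x φ) = 0 := (hex _).2 ⟨φ ∘ₗ lin r, by
      have hr' : lin r ∘ₗ lin i = x := congrArg lin hr
      rw [← hr']
      rfl⟩
    change extBiToRing (topModule P.obj) 2 (π' (LinearMap.lcomp Γ Γ x φ)) = 0
    rw [h0, map_zero]
  have hrc : LinearMap.range (lin c) = Module.jacobson Γᵐᵒᵖ P.obj :=
    le_antisymm (le_jacobson fun h => hns (LinearMap.range_eq_top.1 h))
      (hk ▸ range_le_of_comp_eq htc)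
  refine ⟨E', j, c, w', hjc, isLeftAlmostSplit_of_isCoatom j ?_, (isRightAlmostSplit_iff c).2 hrc⟩
  rw [← isSimpleModule_iff_isCoatom]
  exact isSimpleModule_dual_quotient hjc (key hjc hrc)

end AuslanderReiten

/-! ### Comparison of the Auslander-Reiten quiver with the quiver of Γ -/

section ARQuiverComparison

variable {Γ : Type u} [Ring Γ] [IsNoetherianRing Γᵐᵒᵖ] [HasLocalEndomorphismRings Γ]

lemma arQuiver_eq_quiverWith (F : ExactStructure (ProjCat Γ)) :
    F.arQuiver = quiverWith Γ (twoRegularSetEquiv (simpleCokers F)) := by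
  refine DottedValuedQuiver.ext ?_ rfl ?_
  · funext P Q
    exact propext (exists_isIrreducibleMorphism_iff hasLocalEnd_of_isLocalRing
      hasLocalEnd_of_isLocalRing)
  · funext P Q
    refine propext ⟨?_, ?_⟩
    · rintro ⟨E, f, g, w, h⟩
      obtain ⟨h1, h2⟩ := isTranslate_of_isARConflation h
      exact ⟨⟨(P, Q), h1⟩, (mem_simpleCokers_iff F (topModule P.rep.obj)).2 h2, rfl⟩
    · rintro ⟨⟨_, ha⟩, h, rfl⟩
      exact exists_isARConflation ha ((mem_simpleCokers_iff F (topModule P.rep.obj)).1 h)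

end ARQuiverComparison

theorem theorem3p6 (Γ : Type u) [Ring Γ] [IsNoetherianRing Γ] [IsNoetherianRing Γᵐᵒᵖ] :
    ∃ e : AdmissibleExactStructure Γ ≃ TwoRegularSet Γ,
      (∀ (T : TwoRegularSet Γ) (S : ShortComplex (ProjCat Γ)),
        (e.symm T).1.conflation S ↔
          ∃ (M : RightMod Γ) (p : S.X₃.obj →ₗ[Γᵐᵒᵖ] M), IsResolutionOf S M p ∧ IsFilt T.1 M) ∧
      (∀ (F : AdmissibleExactStructure Γ) (S : RightMod Γ), IsSimpleModule Γᵐᵒᵖ S →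
        (isoClass S ∈ (e F).1 ↔
          ∃ (Y Z : ProjCat Γ) (g : Y ⟶ Z), F.1.IsDeflation g ∧
            Nonempty ((Z.obj ⧸ LinearMap.range g.hom.hom) ≃ₗ[Γᵐᵒᵖ] S))) ∧
      (∀ (R : Type v) [CommRing R] [IsLocalRing R] [IsNoetherianRing R]
        [IsAdicComplete (IsLocalRing.maximalIdeal R) R] [Algebra R Γ] [Module.Finite R Γ],
        ∃ e' : AdmissibleExactStructure Γ ≃ Set (DottedArrow Γ),
          (∀ (F : AdmissibleExactStructure Γ) (a : DottedArrow Γ),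
            a ∈ e' F ↔ isoClass (topModule a.1.1.rep.obj) ∈ (e F).1) ∧
          (∀ F : AdmissibleExactStructure Γ, F.1.arQuiver = quiverWith Γ (e' F))) := by
  refine ⟨admissibleEquiv, admissibleEquiv_symm_conflation_iff,
    fun F S _ => mem_simpleCokers_iff F.1 S, fun R _ _ _ _ _ _ => ?_⟩
  have := hasLocalEndomorphismRings_of_isAdicComplete (Γ := Γ) R
  exact ⟨admissibleEquiv.trans twoRegularSetEquiv, fun F a => Iff.rfl,
    fun F => arQuiver_eq_quiverWith F.1⟩
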